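/- Let $m,n\ge 0$ and let $p\in\mathbb C[z_1,z_2]$ have no zeros in the bidisk $\mathbb D^2$. Put $\tilde p(z)=z_1^m z_2^n\,\overline{p(1/\bar z_1,1/\bar z_2)}$, and suppose that $p$ and $\tilde p$ are polynomials without common factor and that $m$ and $n$ are the highest degrees of $z_1$ and of $z_2$ appearing in $p$ or $\tilde p$; thus $\Theta=\tilde p/p$ is a rational inner function of degree $(m,n)$. Let $\mathcal K_\Theta=H^2(\mathbb D^2)\ominus\Theta H^2(\mathbb D^2)$ and let $\mathcal K_\Theta=\mathcal S_1\oplus\mathcal S_2$ be an orthogonal decomposition into closed subspaces such that $z_1\mathcal S_1\subseteq\mathcal S_1$ and $z_2\mathcal S_2\subseteq\mathcal S_2$. Let $S^1_\Theta=P_{\mathcal S_2}M_{z_1}|_{\mathcal S_2}$, where $M_{z_1}$ is multiplication by $z_1$ on $H^2(\mathbb D^2)$ and $P_{\mathcal S_2}$ is the orthogonal projection onto $\mathcal S_2$. For a bounded operator $T$ on a Hilbert space let $\mathcal W(T)=\{\langle Th,h\rangle:\|h\|=1\}$, and for a matrix $A\in\mathbb C^{m\times m}$ let $\mathcal W(A)$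 be the numerical range of $A$ acting on Euclidean $\mathbb C^m$. Then $\mathcal S_2\ominus z_2\mathcal S_2$ has dimension $m$. Moreover, for every orthonormal basis $b_1,\dots,b_m$ of $\mathcal S_2\ominus z_2\mathcal S_2$ there is an $m\times m$ matrix-valued function $M_\Theta$ on $\overline{\mathbb D}$, with entries that are rational functions of $\bar z_2$ and continuous on $\overline{\mathbb D}$, such that $$S^1_\Theta=\mathcal U\,T_{M_\Theta}\,\mathcal U^*,$$ where $\mathcal U:H^2(\mathbb D)^m\to\mathcal S_2$, $\mathcal U(f_1,\dots,f_m)(z)=\sum_{i=1}^m b_i(z_1,z_2)f_i(z_2)$, is unitary, and $T_{M_\Theta}\vec f=P_{H^2(\mathbb D)^m}(M_\Theta\vec f)$ is the Toeplitz operator on $H^2(\mathbb D)^m$ with symbol $M_\Theta|_{\mathbb T}$, $P_{H^2(\mathbb D)^m}$ being the orthogonal projection of $L^2(\mathbb T)^m$ onto $H^2(\mathbb D)^m$. For every such $M_\Theta$, $$\overline{\mathcal W(S^1_\Theta)}=\operatorname{Conv}\Big(\bigcup_{\tau\in\mathbb T}\mathcal W\big(M_\Theta(\tau)\big)\Big).$$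 -/

import Mathlib

open MeasureTheory
open scoped ENNReal ComplexConjugate

noncomputable section

namespace BidiskModel

/-! ### Hardy spaces, through square-summable Taylor coefficients -/

/-- The Hardy space `H²(𝔻)` of the disk: power series `∑ aₖ zᵏ` with `∑ |aₖ|² < ∞`. -/
abbrev HardyDisk : Type := lp (fun _ : ℕ => ℂ) 2

/-- The Hardy space `H²(𝔻²)` of the bidisk: power series `∑ aⱼₖ z₁ʲ z₂ᵏ` with
`∑ |aⱼₖ|² < ∞`. -/
abbrev HardyBidisk : Type := lp (fun _ : ℕ × ℕ => ℂ) 2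

/-- `H²(𝔻)^m`, the Hilbert space direct sum of `m` copies of `H²(𝔻)`. -/
abbrev HardyDiskVec (m : ℕ) : Type := PiLp 2 (fun _ : Fin m => HardyDisk)

/-- The value at `z ∈ 𝔻` of an element of `H²(𝔻)`. -/
def diskEval (f : HardyDisk) (z : ℂ) : ℂ := ∑' k : ℕ, f k * z ^ k

/-- The value at `z ∈ 𝔻²` of an element of `H²(𝔻²)`. -/
def bidiskEval (f : HardyBidisk) (z : ℂ × ℂ) : ℂ := ∑' a : ℕ × ℕ, f a * (z.1 ^ a.1 * z.2 ^ a.2)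

/-- The open bidisk `𝔻²`. -/
def bidisk : Set (ℂ × ℂ) := {z | ‖z.1‖ < 1 ∧ ‖z.2‖ < 1}

/-! ### Moving coefficients along an injection: shifts and the embedding `H²(𝔻) ⊆ L²(𝕋)` -/

section Extend

variable {α β : Type} (φ : α ↪ β)

theorem extend_hasSum (f : lp (fun _ : α => ℂ) 2) :
    HasSum (fun b => ‖Function.extend φ (⇑f) 0 b‖ ^ (2 : ℝ≥0∞).toReal)
      (‖f‖ ^ (2 : ℝ≥0∞).toReal) := by
  have h := lp.hasSum_norm (p := 2) (by norm_num) f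
  have hrange : ∀ x, x ∉ Set.range φ →
      ‖Function.extend φ (⇑f) 0 x‖ ^ (2 : ℝ≥0∞).toReal = 0 := by
    intro x hx
    rw [Function.extend_apply' _ _ _ (by simpa using hx)]
    simp
  rw [← φ.injective.hasSum_iff hrange]
  convert h using 2 with a
  simp [φ.injective.extend_apply]

/-- The isometry `ℓ²(α) → ℓ²(β)` that extends a sequence along the injection `φ : α ↪ β`
by zero: the coefficient at `φ a` is the old coefficient at `a`. -/
def coeffExtend : lp (fun _ : α => ℂ) 2 →ₗᵢ[ℂ] lp (fun _ : β => ℂ) 2 where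
  toFun f := ⟨Function.extend φ (⇑f) 0, memℓp_gen (extend_hasSum φ f).summable⟩
  map_add' f g := by
    ext b
    change Function.extend φ (⇑f + ⇑g) 0 b =
      Function.extend φ (⇑f) 0 b + Function.extend φ (⇑g) 0 b
    by_cases hb : ∃ a, φ a = b
    · obtain ⟨a, rfl⟩ := hb
      simp [φ.injective.extend_apply]
    · simp [Function.extend_apply' _ _ _ hb]
  map_smul' c f := by
    ext b
    by_cases hb : ∃ a, φ a = b
    · obtain ⟨a, rfl⟩ := hb
      simp [φ.injective.extend_apply]
    · simp [Function.extend_apply' _ _ _ hb]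
  norm_map' f := by
    have h2 : 0 < (2 : ℝ≥0∞).toReal := by norm_num
    rw [← Real.rpow_left_inj (norm_nonneg _) (norm_nonneg _) h2.ne',
      lp.norm_rpow_eq_tsum h2]
    exact (extend_hasSum φ f).tsum_eq

@[simp] theorem coeffExtend_apply (f : lp (fun _ : α => ℂ) 2) (a : α) :
    coeffExtend φ f (φ a) = f a :=
  φ.injective.extend_apply _ _ _

theorem coeffExtend_apply' (f : lp (fun _ : α => ℂ) 2) {b : β} (hb : ¬ ∃ a, φ a = b) :
    coeffExtend φ f b = 0 :=
  Function.extend_apply' _ _ _ hb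

end Extend

/-- The injection `(j, k) ↦ (j + 1, k)`. -/
def succFst : ℕ × ℕ ↪ ℕ × ℕ := ⟨fun a => (a.1 + 1, a.2), fun a b h => by
  simp only [Prod.mk.injEq, add_left_inj] at h; exact Prod.ext h.1 h.2⟩

/-- The injection `(j, k) ↦ (j, k + 1)`. -/
def succSnd : ℕ × ℕ ↪ ℕ × ℕ := ⟨fun a => (a.1, a.2 + 1), fun a b h => by
  simp only [Prod.mk.injEq, add_left_inj] at h; exact Prod.ext h.1 h.2⟩

/-- Multiplication by `z₁` on `H²(𝔻²)`. -/
def mulZ1 : HardyBidisk →L[ℂ] HardyBidisk := (coeffExtend succFst).toContinuousLinearMap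

/-- Multiplication by `z₂` on `H²(𝔻²)`. -/
def mulZ2 : HardyBidisk →L[ℂ] HardyBidisk := (coeffExtend succSnd).toContinuousLinearMap

theorem bidiskEval_mulZ1 (f : HardyBidisk) (z : ℂ × ℂ) :
    bidiskEval (mulZ1 f) z = z.1 * bidiskEval f z := by
  unfold bidiskEval
  rw [← tsum_mul_left, ← succFst.injective.tsum_eq]
  · refine tsum_congr fun a => ?_
    change coeffExtend succFst f (succFst a) * (z.1 ^ (a.1 + 1) * z.2 ^ a.2) = _
    rw [coeffExtend_apply]
    ring
  · intro b hb
    by_contra hne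
    refine hb ?_
    change coeffExtend succFst f b * _ = 0
    rw [coeffExtend_apply' succFst f (by simpa using hne), zero_mul]

theorem bidiskEval_mulZ2 (f : HardyBidisk) (z : ℂ × ℂ) :
    bidiskEval (mulZ2 f) z = z.2 * bidiskEval f z := by
  unfold bidiskEval
  rw [← tsum_mul_left, ← succSnd.injective.tsum_eq]
  · refine tsum_congr fun a => ?_
    change coeffExtend succSnd f (succSnd a) * (z.1 ^ a.1 * z.2 ^ (a.2 + 1)) = _
    rw [coeffExtend_apply]
    ring
  · intro b hb
    by_contra hne
    refine hb ?_
    change coeffExtend succSnd f b * _ = 0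
    rw [coeffExtend_apply' succSnd f (by simpa using hne), zero_mul]

/-! ### Rational inner functions and their model spaces -/

/-- Value of a polynomial in two variables. -/
def polyEval (p : MvPolynomial (Fin 2) ℂ) (z : ℂ × ℂ) : ℂ := MvPolynomial.eval ![z.1, z.2] p

/-- The reflection `p̃(z) = z₁ᵐ z₂ⁿ conj (p (1 / conj z₁, 1 / conj z₂))` of a polynomial `p` with
`deg p ≤ (m, n)`: the monomial `c z₁ʲ z₂ᵏ` goes to `conj c z₁^(m-j) z₂^(n-k)`. -/
def reflection (m n : ℕ) (p : MvPolynomial (Fin 2) ℂ) : MvPolynomial (Fin 2) ℂ :=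
  ∑ d ∈ p.support, MvPolynomial.C (conj (p.coeff d)) *
    (MvPolynomial.X 0 ^ (m - d 0) * MvPolynomial.X 1 ^ (n - d 1))

/-- The data of a rational inner function `Θ = p̃ / p` of degree `(m, n)` on the bidisk:
`p` has no zeros in `𝔻²`, `p` and `p̃` have no common factor, and `m`, `n` are the highest
degrees of `z₁`, `z₂` that appear in `p` or in `p̃`. -/
structure IsRationalInner (m n : ℕ) (p : MvPolynomial (Fin 2) ℂ) : Prop where
  ne_zero : ∀ z ∈ bidisk, polyEval p z ≠ 0
  no_common_factor : IsRelPrime p (reflection m n p)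
  degree_fst : max (p.degreeOf 0) ((reflection m n p).degreeOf 0) = m
  degree_snd : max (p.degreeOf 1) ((reflection m n p).degreeOf 1) = n

/-- The function `Θ = p̃ / p`. -/
def theta (m n : ℕ) (p : MvPolynomial (Fin 2) ℂ) (z : ℂ × ℂ) : ℂ :=
  polyEval (reflection m n p) z / polyEval p z

/-- The model space `𝓚_Θ = H²(𝔻²) ⊖ Θ H²(𝔻²)`. -/
def modelSpace (Θ : ℂ × ℂ → ℂ) : Submodule ℂ HardyBidisk :=
  (Submodule.span ℂ {h : HardyBidisk | ∃ g : HardyBidisk,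
    ∀ z ∈ bidisk, bidiskEval h z = Θ z * bidiskEval g z})ᗮ

/-- `𝓚 = S₁ ⊕ S₂` is an orthogonal decomposition into closed subspaces with `S₁` invariant
under multiplication by `z₁` and `S₂` invariant under multiplication by `z₂`. -/
structure IsShiftDecomposition (K S₁ S₂ : Submodule ℂ HardyBidisk) : Prop where
  closed_fst : IsClosed (S₁ : Set HardyBidisk)
  closed_snd : IsClosed (S₂ : Set HardyBidisk)
  orthogonal : S₁ ⟂ S₂
  sum_eq : S₁ ⊔ S₂ = K
  invariant_fst : ∀ f ∈ S₁, mulZ1 f ∈ S₁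
  invariant_snd : ∀ f ∈ S₂, mulZ2 f ∈ S₂

/-- The compression `P_S T |_S` of an operator `T` to a subspace `S`. -/
def compression (S : Submodule ℂ HardyBidisk) [S.HasOrthogonalProjection]
    (T : HardyBidisk →L[ℂ] HardyBidisk) : S →L[ℂ] S :=
  S.orthogonalProjectionOnto ∘L T ∘L S.subtypeL

/-- The subspace `S ⊖ z₂ S`. -/
def wandering (S : Submodule ℂ HardyBidisk) : Submodule ℂ HardyBidisk :=
  S ⊓ (S.map (mulZ2 : HardyBidisk →ₗ[ℂ] HardyBidisk))ᗮ

/-! ### Matrix-valued Toeplitz operators -/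

/-- `L²(𝕋)` with normalized Lebesgue measure; the circle is parametrized by
`t ↦ exp (2πit)`, `t ∈ ℝ/ℤ`. -/
abbrev CircleL2 : Type := Lp ℂ 2 (AddCircle.haarAddCircle (T := (1 : ℝ)))

/-- The inclusion `H²(𝔻) → L²(𝕋)` by boundary values: `∑ aₖ zᵏ` goes to the function with
Fourier coefficients `aₖ` for `k ≥ 0` and `0` for `k < 0`. -/
def boundaryValue : HardyDisk →ₗᵢ[ℂ] CircleL2 :=
  (fourierBasis (T := (1 : ℝ))).repr.symm.toLinearIsometry.comp (coeffExtend Nat.castEmbedding)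

/-- The orthogonal projection of `L²(𝕋)` onto `H²(𝔻)`, as the adjoint of the isometric
inclusion. -/
def rieszProjection : CircleL2 →L[ℂ] HardyDisk :=
  ContinuousLinearMap.adjoint boundaryValue.toContinuousLinearMap

open Classical in
/-- Multiplication by a bounded measurable function `φ` on `L²(𝕋)` (and `0` for any other `φ`). -/
def mulL2 (φ : AddCircle (1 : ℝ) → ℂ) : CircleL2 →L[ℂ] CircleL2 :=
  if h : MemLp φ ∞ (AddCircle.haarAddCircle (T := (1 : ℝ))) then
    (ContinuousLinearMap.mul ℂ ℂ).holderL AddCircle.haarAddCircle ∞ 2 2 (h.toLp φ)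
  else 0

/-- The matrix-valued Toeplitz operator `T_F f = P (F f)` on `H²(𝔻)^m`. Its symbol is the
restriction to the unit circle of the function `F`. -/
def toeplitz {m : ℕ} (F : ℂ → Matrix (Fin m) (Fin m) ℂ) :
    HardyDiskVec m →L[ℂ] HardyDiskVec m :=
  (PiLp.continuousLinearEquiv 2 ℂ (fun _ : Fin m => HardyDisk)).symm.toContinuousLinearMap ∘L
    ContinuousLinearMap.pi fun i =>
      rieszProjection ∘L ∑ j : Fin m,
        mulL2 (fun t => F (AddCircle.toCircle t : ℂ) i j) ∘L
          boundaryValue.toContinuousLinearMap ∘L PiLp.proj 2 (fun _ : Fin m => HardyDisk) j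

/-! ### The symbol `M_Θ` and numerical ranges -/

/-- `M` is a symbol `M_Θ` for `S¹_Θ = P_{S₂} M_{z₁} |_{S₂}`, with respect to the orthonormal basis
`b` of `S₂ ⊖ z₂ S₂`: its entries are rational functions of `conj z₂` and continuous on the closed
disk, and `S¹_Θ = U T_M U*`, where `U : H²(𝔻)^m → S₂` is the unitary operator
`U (f₁, …, f_m) = ∑ bᵢ(z₁, z₂) fᵢ(z₂)`. -/
structure IsSymbol {m : ℕ} (S₂ : Submodule ℂ HardyBidisk) [S₂.HasOrthogonalProjection]
    (b : OrthonormalBasis (Fin m) ℂ (wandering S₂))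
    (M : ℂ → Matrix (Fin m) (Fin m) ℂ) : Prop where
  rational : ∀ i j, ∃ A B : Polynomial ℂ, B ≠ 0 ∧
    ∀ z ∈ Metric.closedBall (0 : ℂ) 1, B.eval (conj z) ≠ 0 →
      M z i j = A.eval (conj z) / B.eval (conj z)
  continuous : ∀ i j, ContinuousOn (fun z => M z i j) (Metric.closedBall (0 : ℂ) 1)
  unitarily_equivalent : ∃ U : HardyDiskVec m ≃ₗᵢ[ℂ] S₂,
    (∀ f : HardyDiskVec m, ∀ z ∈ bidisk, bidiskEval (U f : HardyBidisk) z =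
      ∑ i, bidiskEval (b i : HardyBidisk) z * diskEval (f i) z.2) ∧
    compression S₂ mulZ1 = U.toContinuousLinearEquiv.toContinuousLinearMap ∘L toeplitz M ∘L
      U.symm.toContinuousLinearEquiv.toContinuousLinearMap

/-- The numerical range `{⟨T h, h⟩ : ‖h‖ = 1}` of a bounded operator (the inner product of
Mathlib is linear in its second argument). -/
def numericalRange {H : Type*} [NormedAddCommGroup H] [InnerProductSpace ℂ H]
    (T : H →L[ℂ] H) : Set ℂ :=
  {w | ∃ h : H, ‖h‖ = 1 ∧ inner ℂ h (T h) = w}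

/-- The numerical range of a square matrix acting on `ℂᵐ` with the Euclidean norm. -/
def matrixNumericalRange {m : ℕ} (A : Matrix (Fin m) (Fin m) ℂ) : Set ℂ :=
  numericalRange (Matrix.toEuclideanCLM (𝕜 := ℂ) A)

end BidiskModel

end

open BidiskModel

noncomputable section

namespace BidiskModel

/-! ### Coefficients of shifted functions -/

/-! Multiplication by `p` turns every space involved into a condition on Taylor coefficients. On the
torus the conjugate of `p̃` equals `z₁⁻ᵐ z₂⁻ⁿ p`, so pairing `f` with `p̃ z₁ⁱ z₂ʲ` reads off the
coefficient of `p f` at `(m + i, n + j)`. Because `p` is cyclic (`dense_range_mulPoly`), the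
multiples of `p̃` are dense in `Θ H²`, and `f` lies in the model space exactly when all these
coefficients vanish (`mem_modelSpace_iff`). Invariance then forces `p f` to have `z₁`-degree below
`m` for `f ∈ S₂` and `z₂`-degree below `n` for `f ∈ S₁`. For `f ∈ S₂ ⊖ z₂ S₂` the product `p f` is a
polynomial of degree at most `(m - 1, n)`, so this space is finite-dimensional.

The Wold decomposition makes `z₂ᵏ bᵢ` a Hilbert basis of `S₂`, hence `S₂ ≅ H²(𝔻)^r`. The rows of
`z₁`-coefficients of the `p bᵢ` are linearly independent vectors in `ℂ[z₂]^m`, so `r ≤ m`.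
Conversely, the resultant of `p` and `p̃` in `z₁` yields functions `e` with `p e = z₁ᵏ δ(z₂)`, one
for each `k < m`. Up to a finite-dimensional defect these lie in `S₂`, and they rule out any
`ℂ[z₂]`-linear relation between the columns, so `m ≤ r` (`IsShiftDecomposition.le_card`).

The backward shift in `z₁` maps `S₂` to itself. If `gᵢⱼ` are the coordinates of the backward shift
of `bᵢ`, the compression has matrix entries `conj (gᵢⱼ (l - k))` for `k ≤ l` and zero otherwise,
which is the block Toeplitz matrix of the symbol `conj gᵢⱼ`. Cramer's rule shows that `gᵢⱼ` is
rational (`exists_symbolVec_rational`), and a rational function in `H²(𝔻)` has no pole on the closed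
disk, which gives continuity.

For the numerical range, `⟨f, T_M f⟩` is an average over the circle of the quadratic forms of
`M(τ)`, so every closed half plane containing all `W(M(τ))` contains `W(T_M)`. In the other
direction, `T_M` acts on a Szegő kernel times a vector `x` as `M(z)` acts on `x`, so `W(M(z)) ⊆
W(T_M)` inside the disk, and radial limits reach the circle. The closure is convex because `f` and
`z₂ᴺ g` become orthogonal as `N → ∞`. -/

@[simp] theorem mulZ1_succ (f : HardyBidisk) (i j : ℕ) : mulZ1 f (i + 1, j) = f (i, j) :=
  coeffExtend_apply succFst f (i, j)

@[simp] theorem mulZ1_zero (f : HardyBidisk) (j : ℕ) : mulZ1 f (0, j) = 0 :=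
  coeffExtend_apply' succFst f (by rintro ⟨a, ha⟩; simp [succFst, Prod.ext_iff] at ha)

@[simp] theorem mulZ2_succ (f : HardyBidisk) (i j : ℕ) : mulZ2 f (i, j + 1) = f (i, j) :=
  coeffExtend_apply succSnd f (i, j)

@[simp] theorem mulZ2_zero (f : HardyBidisk) (i : ℕ) : mulZ2 f (i, 0) = 0 :=
  coeffExtend_apply' succSnd f (by rintro ⟨a, ha⟩; simp [succSnd, Prod.ext_iff] at ha)

theorem inner_mulZ1 (f g : HardyBidisk) : inner ℂ (mulZ1 f) (mulZ1 g) = inner ℂ f g :=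
  (coeffExtend succFst).inner_map_map f g

theorem inner_mulZ2 (f g : HardyBidisk) : inner ℂ (mulZ2 f) (mulZ2 g) = inner ℂ f g :=
  (coeffExtend succSnd).inner_map_map f g

theorem mulZ1_mulZ2 (f : HardyBidisk) : mulZ1 (mulZ2 f) = mulZ2 (mulZ1 f) := by
  ext ⟨i, j⟩
  cases i <;> cases j <;> simp

/-- Multiplication by the monomial `z₁ⁱ z₂ʲ`. -/
def monomialMul (i j : ℕ) : HardyBidisk →L[ℂ] HardyBidisk := mulZ1 ^ i * mulZ2 ^ j

theorem commute_mulZ : Commute mulZ1 mulZ2 := by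
  ext1 f; exact mulZ1_mulZ2 f

theorem monomialMul_add (i j k l : ℕ) :
    monomialMul (i + k) (j + l) = monomialMul i j * monomialMul k l := by
  unfold monomialMul
  rw [pow_add, pow_add, mul_assoc, mul_assoc, ← mul_assoc (mulZ1 ^ k) (mulZ2 ^ j),
    (commute_mulZ.pow_pow k j).eq, mul_assoc]

theorem monomialMul_add_apply (i j k l : ℕ) (f : HardyBidisk) :
    monomialMul (i + k) (j + l) f = monomialMul i j (monomialMul k l f) := by
  rw [monomialMul_add]; rfl

@[simp] theorem monomialMul_zero_zero (f : HardyBidisk) : monomialMul 0 0 f = f := by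
  simp [monomialMul]

theorem monomialMul_succ_left (i j : ℕ) (f : HardyBidisk) :
    monomialMul (i + 1) j f = mulZ1 (monomialMul i j f) := by
  have := monomialMul_add_apply 1 0 i j f
  rw [zero_add, add_comm 1 i] at this
  rw [this]; simp [monomialMul]

theorem monomialMul_succ_right (i j : ℕ) (f : HardyBidisk) :
    monomialMul i (j + 1) f = mulZ2 (monomialMul i j f) := by
  have := monomialMul_add_apply 0 1 i j f
  rw [zero_add, add_comm 1 j] at this
  rw [this]; simp [monomialMul]

theorem inner_monomialMul (i j : ℕ) (f g : HardyBidisk) :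
    inner ℂ (monomialMul i j f) (monomialMul i j g) = inner ℂ f g := by
  induction i with
  | zero =>
    induction j with
    | zero => simp
    | succ j ih => rw [monomialMul_succ_right, monomialMul_succ_right, inner_mulZ2, ih]
  | succ i ih => rw [monomialMul_succ_left, monomialMul_succ_left, inner_mulZ1, ih]

theorem norm_monomialMul (i j : ℕ) (f : HardyBidisk) : ‖monomialMul i j f‖ = ‖f‖ := by
  rw [norm_eq_sqrt_re_inner (𝕜 := ℂ), norm_eq_sqrt_re_inner (𝕜 := ℂ), inner_monomialMul]

/-! ### Formal power series -/

/-- The formal power series of a function, as a power series in `z₁` over power series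
in `z₂`. -/
def toSeries : HardyBidisk →ₗ[ℂ] PowerSeries (PowerSeries ℂ) where
  toFun f := PowerSeries.mk fun i => PowerSeries.mk fun j => f (i, j)
  map_add' f g := by ext i j; simp
  map_smul' c f := by ext i j; simp

@[simp] theorem coeff_toSeries (f : HardyBidisk) (i j : ℕ) :
    PowerSeries.coeff j (PowerSeries.coeff i (toSeries f)) = f (i, j) := by
  simp [toSeries]

theorem toSeries_injective : Function.Injective toSeries := by
  intro f g h
  ext ⟨i, j⟩
  rw [← coeff_toSeries, h, coeff_toSeries]

theorem toSeries_mulZ1 (f : HardyBidisk) : toSeries (mulZ1 f) = PowerSeries.X * toSeries f := by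
  ext i j
  rw [coeff_toSeries]
  cases i <;> simp [PowerSeries.coeff_succ_X_mul]

theorem toSeries_mulZ2 (f : HardyBidisk) :
    toSeries (mulZ2 f) = PowerSeries.C PowerSeries.X * toSeries f := by
  ext i j
  cases j <;> simp [PowerSeries.coeff_succ_X_mul]

theorem toSeries_monomialMul (i j : ℕ) (f : HardyBidisk) : toSeries (monomialMul i j f) =
    PowerSeries.X ^ i * PowerSeries.C PowerSeries.X ^ j * toSeries f := by
  induction i with
  | zero =>
    induction j with
    | zero => simp
    | succ j ih => rw [monomialMul_succ_right, toSeries_mulZ2, ih]; ring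
  | succ i ih => rw [monomialMul_succ_left, toSeries_mulZ1, ih]; ring

/-- The formal power series of a polynomial. -/
def polySeries : MvPolynomial (Fin 2) ℂ →ₐ[ℂ] PowerSeries (PowerSeries ℂ) :=
  MvPolynomial.aeval ![PowerSeries.X, PowerSeries.C PowerSeries.X]

theorem algebraMap_series (c : ℂ) :
    algebraMap ℂ (PowerSeries (PowerSeries ℂ)) c = PowerSeries.C (PowerSeries.C c) := by
  ext i j
  simp [PowerSeries.algebraMap_apply]

/-- Multiplication by a polynomial on `H²(𝔻²)`. -/
def mulPoly (q : MvPolynomial (Fin 2) ℂ) : HardyBidisk →L[ℂ] HardyBidisk :=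
  ∑ d ∈ q.support, q.coeff d • monomialMul (d 0) (d 1)

theorem mulPoly_apply (q : MvPolynomial (Fin 2) ℂ) (f : HardyBidisk) :
    mulPoly q f = ∑ d ∈ q.support, q.coeff d • monomialMul (d 0) (d 1) f := by
  simp [mulPoly]

theorem polySeries_eq_sum (q : MvPolynomial (Fin 2) ℂ) : polySeries q =
    ∑ d ∈ q.support, q.coeff d • (PowerSeries.X ^ d 0 * PowerSeries.C PowerSeries.X ^ d 1) := by
  rw [polySeries, MvPolynomial.aeval_def, MvPolynomial.eval₂_eq']
  simp [Algebra.smul_def, Fin.prod_univ_two]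

theorem toSeries_mulPoly (q : MvPolynomial (Fin 2) ℂ) (f : HardyBidisk) :
    toSeries (mulPoly q f) = polySeries q * toSeries f := by
  rw [mulPoly_apply, map_sum, polySeries_eq_sum, Finset.sum_mul]
  refine Finset.sum_congr rfl fun d _ => ?_
  rw [map_smul, toSeries_monomialMul, smul_mul_assoc]

theorem mulPoly_mul (q r : MvPolynomial (Fin 2) ℂ) (f : HardyBidisk) :
    mulPoly (q * r) f = mulPoly q (mulPoly r f) := by
  apply toSeries_injective
  rw [toSeries_mulPoly, toSeries_mulPoly, toSeries_mulPoly, map_mul, mul_assoc]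

theorem mulPoly_add (q r : MvPolynomial (Fin 2) ℂ) (f : HardyBidisk) :
    mulPoly (q + r) f = mulPoly q f + mulPoly r f := by
  apply toSeries_injective
  rw [map_add, toSeries_mulPoly, toSeries_mulPoly, toSeries_mulPoly, map_add, add_mul]

theorem mulPoly_C (c : ℂ) (f : HardyBidisk) : mulPoly (MvPolynomial.C c) f = c • f := by
  apply toSeries_injective
  rw [toSeries_mulPoly, map_smul, ← MvPolynomial.algebraMap_eq, AlgHom.commutes, Algebra.smul_def]

theorem mulPoly_X0 (f : HardyBidisk) : mulPoly (MvPolynomial.X 0) f = mulZ1 f := by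
  apply toSeries_injective
  rw [toSeries_mulPoly, toSeries_mulZ1]; simp [polySeries]

theorem mulPoly_X1 (f : HardyBidisk) : mulPoly (MvPolynomial.X 1) f = mulZ2 f := by
  apply toSeries_injective
  rw [toSeries_mulPoly, toSeries_mulZ2]; simp [polySeries]

theorem mulPoly_comm (q r : MvPolynomial (Fin 2) ℂ) (f : HardyBidisk) :
    mulPoly q (mulPoly r f) = mulPoly r (mulPoly q f) := by
  rw [← mulPoly_mul, mul_comm, mulPoly_mul]

theorem mulPoly_mulZ2 (q : MvPolynomial (Fin 2) ℂ) (f : HardyBidisk) :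
    mulPoly q (mulZ2 f) = mulZ2 (mulPoly q f) := by
  rw [← mulPoly_X1, ← mulPoly_X1, mulPoly_comm]

theorem polySeries_injective : Function.Injective polySeries := by
  rw [injective_iff_map_eq_zero]
  intro q hq
  have key : ∀ d : Fin 2 →₀ ℕ,
      PowerSeries.coeff (d 1) (PowerSeries.coeff (d 0) (polySeries q)) = q.coeff d := by
    intro d
    rw [polySeries_eq_sum, map_sum, map_sum]
    have : ∀ e : Fin 2 →₀ ℕ, PowerSeries.coeff (d 1) (PowerSeries.coeff (d 0) (q.coeff e •
        (PowerSeries.X ^ e 0 * PowerSeries.C (PowerSeries.X : PowerSeries ℂ) ^ e 1))) =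
        if e = d then q.coeff e else 0 := by
      intro e
      rw [← map_pow, mul_comm]
      simp only [PowerSeries.coeff_smul, PowerSeries.coeff_C_mul, PowerSeries.coeff_X_pow]
      by_cases h : e = d
      · subst h; simp
      · rw [if_neg h]
        by_cases h0 : d 0 = e 0
        · have h1 : d 1 ≠ e 1 := by
            intro h1
            apply h
            ext i
            fin_cases i
            · exact h0.symm
            · exact h1.symm
          simp [h0, PowerSeries.coeff_X_pow, h1]
        · simp [h0]
    rw [Finset.sum_congr rfl fun e _ => this e, Finset.sum_ite_eq']
    split_ifs with h
    · rfl
    · simpa [eq_comm] using h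
  ext d
  rw [← key, hq]
  simp

/-- Formal power series over a domain form a domain, so cancellation needs no information on the
zeros of `q`. -/
theorem mulPoly_left_cancel {q : MvPolynomial (Fin 2) ℂ} (hq : q ≠ 0) {f g : HardyBidisk}
    (h : mulPoly q f = mulPoly q g) : f = g := by
  apply toSeries_injective
  have := congrArg toSeries h
  rw [toSeries_mulPoly, toSeries_mulPoly] at this
  exact mul_left_cancel₀ ((map_ne_zero_iff _ polySeries_injective).2 hq) this

/-! ### Point evaluations -/

theorem summable_monomials {z : ℂ × ℂ} (hz : z ∈ bidisk) :
    Summable fun a : ℕ × ℕ => ‖z.1 ^ a.1 * z.2 ^ a.2‖ := by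
  have h1 := summable_geometric_of_lt_one (norm_nonneg z.1) hz.1
  have h2 := summable_geometric_of_lt_one (norm_nonneg z.2) hz.2
  simpa using h1.mul_of_nonneg h2 (fun _ => by positivity) (fun _ => by positivity)

theorem norm_coeff_le {α : Type} (f : lp (fun _ : α => ℂ) 2) (a : α) : ‖f a‖ ≤ ‖f‖ :=
  lp.norm_apply_le_norm (by norm_num) f a

theorem summable_bidiskEval (f : HardyBidisk) {z : ℂ × ℂ} (hz : z ∈ bidisk) :
    Summable fun a : ℕ × ℕ => ‖f a * (z.1 ^ a.1 * z.2 ^ a.2)‖ := by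
  refine Summable.of_nonneg_of_le (fun _ => norm_nonneg _) (fun a => ?_)
    ((summable_monomials hz).mul_left ‖f‖)
  rw [norm_mul]
  exact mul_le_mul_of_nonneg_right (norm_coeff_le f a) (norm_nonneg _)

/-- Evaluation at a point of the bidisk as a bounded functional. -/
def evalAt (z : ℂ × ℂ) (hz : z ∈ bidisk) : HardyBidisk →L[ℂ] ℂ :=
  LinearMap.mkContinuous
    { toFun := fun f => bidiskEval f z
      map_add' := fun f g => by
        unfold bidiskEval
        rw [← (summable_bidiskEval f hz).of_norm.tsum_add (summable_bidiskEval g hz).of_norm]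
        exact tsum_congr fun a => by simp [add_mul]
      map_smul' := fun c f => by
        unfold bidiskEval
        rw [RingHom.id_apply, smul_eq_mul, ← tsum_mul_left]
        exact tsum_congr fun a => by simp [mul_assoc] }
    (∑' a : ℕ × ℕ, ‖z.1 ^ a.1 * z.2 ^ a.2‖) (fun f => by
      change ‖bidiskEval f z‖ ≤ _
      unfold bidiskEval
      refine (norm_tsum_le_tsum_norm (summable_bidiskEval f hz)).trans ?_
      rw [← tsum_mul_right]
      refine (summable_bidiskEval f hz).tsum_le_tsum (fun a => ?_)
        ((summable_monomials hz).mul_right ‖f‖)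
      rw [norm_mul, mul_comm]
      exact mul_le_mul_of_nonneg_left (norm_coeff_le f a) (norm_nonneg _))

@[simp] theorem evalAt_apply (z : ℂ × ℂ) (hz : z ∈ bidisk) (f : HardyBidisk) :
    evalAt z hz f = bidiskEval f z := rfl

theorem bidiskEval_monomialMul (i j : ℕ) (f : HardyBidisk) (z : ℂ × ℂ) :
    bidiskEval (monomialMul i j f) z = z.1 ^ i * z.2 ^ j * bidiskEval f z := by
  induction i with
  | zero =>
    induction j with
    | zero => simp
    | succ j ih => rw [monomialMul_succ_right, bidiskEval_mulZ2, ih]; ring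
  | succ i ih => rw [monomialMul_succ_left, bidiskEval_mulZ1, ih]; ring

theorem bidiskEval_mulPoly (q : MvPolynomial (Fin 2) ℂ) (f : HardyBidisk) {z : ℂ × ℂ}
    (hz : z ∈ bidisk) : bidiskEval (mulPoly q f) z = polyEval q z * bidiskEval f z := by
  rw [mulPoly_apply, ← evalAt_apply z hz, map_sum, polyEval, MvPolynomial.eval_eq',
    Finset.sum_mul]
  refine Finset.sum_congr rfl fun d _ => ?_
  rw [map_smul, evalAt_apply, bidiskEval_monomialMul]
  simp [mul_assoc, Fin.prod_univ_two]

/-- A power series with bounded coefficients that vanishes on the disk is zero. -/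
theorem coeff_eq_zero_of_tsum_eq_zero {c : ℕ → ℂ} {C : ℝ} (hc : ∀ k, ‖c k‖ ≤ C)
    (h : ∀ z : ℂ, ‖z‖ < 1 → ∑' k, c k * z ^ k = 0) (k : ℕ) : c k = 0 := by
  have hs : HasFPowerSeriesAt (0 : ℂ → ℂ)
      (FormalMultilinearSeries.ofScalars ℂ c : FormalMultilinearSeries ℂ ℂ ℂ) 0 := by
    rw [hasFPowerSeriesAt_iff]
    filter_upwards [Metric.ball_mem_nhds (0 : ℂ) one_pos] with z hz
    have hz' : ‖z‖ < 1 := by simpa using hz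
    have hsum : Summable fun k => c k * z ^ k := by
      refine Summable.of_norm_bounded
        ((summable_geometric_of_lt_one (norm_nonneg z) hz').mul_left C) (fun k => ?_)
      rw [norm_mul, norm_pow]
      exact mul_le_mul_of_nonneg_right (hc k) (by positivity)
    have := hsum.hasSum
    rw [h z hz'] at this
    simpa [mul_comm, FormalMultilinearSeries.coeff_ofScalars] using this
  have : (FormalMultilinearSeries.ofScalars ℂ c : FormalMultilinearSeries ℂ ℂ ℂ).coeff k = 0 := by
    rw [hs.eq_zero]; rfl
  simpa [FormalMultilinearSeries.coeff_ofScalars] using this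

/-- The one-variable identity theorem is applied twice: in `z₁` with `z₂ = w` frozen, then in `w` to
each row. -/
theorem eq_zero_of_bidiskEval_eq_zero {f : HardyBidisk}
    (h : ∀ z ∈ bidisk, bidiskEval f z = 0) : f = 0 := by
  have row : ∀ w : ℂ, ‖w‖ < 1 → ∀ i, ∑' j, f (i, j) * w ^ j = 0 := by
    intro w hw i
    have hgeo := summable_geometric_of_lt_one (norm_nonneg w) hw
    refine coeff_eq_zero_of_tsum_eq_zero (c := fun i => ∑' j, f (i, j) * w ^ j)
      (C := ∑' j, ‖f‖ * ‖w‖ ^ j) (fun i => ?_) (fun z hz => ?_) i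
    · have hb : ∀ j, ‖f (i, j) * w ^ j‖ ≤ ‖f‖ * ‖w‖ ^ j := fun j => by
        rw [norm_mul, norm_pow]
        exact mul_le_mul_of_nonneg_right (norm_coeff_le f _) (by positivity)
      exact tsum_of_norm_bounded (hgeo.mul_left _).hasSum hb
    · have hmem : ((z, w) : ℂ × ℂ) ∈ bidisk := ⟨hz, hw⟩
      have := h _ hmem
      rw [bidiskEval, (summable_bidiskEval f hmem).of_norm.tsum_prod] at this
      rw [← this]
      refine tsum_congr fun i => ?_
      rw [← tsum_mul_right]
      exact tsum_congr fun j => by ring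
  ext ⟨i, j⟩
  exact coeff_eq_zero_of_tsum_eq_zero (c := fun j => f (i, j)) (C := ‖f‖)
    (fun j => norm_coeff_le f _) (fun w hw => row w hw i) j

theorem eq_of_bidiskEval_eq {f g : HardyBidisk}
    (h : ∀ z ∈ bidisk, bidiskEval f z = bidiskEval g z) : f = g := by
  rw [← sub_eq_zero]
  refine eq_zero_of_bidiskEval_eq_zero fun z hz => ?_
  rw [← evalAt_apply z hz, map_sub, evalAt_apply, evalAt_apply, h z hz, sub_self]

/-! ### Monomials -/

/-- The monomial `z₁ⁱ z₂ʲ` as an element of `H²(𝔻²)`. -/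
def monomialVec (a : ℕ × ℕ) : HardyBidisk := lp.single 2 a 1

theorem monomialVec_apply (a b : ℕ × ℕ) : monomialVec a b = if b = a then 1 else 0 := by
  simp [monomialVec, lp.single_apply, Pi.single_apply]

theorem inner_monomialVec (a : ℕ × ℕ) (f : HardyBidisk) : inner ℂ (monomialVec a) f = f a := by
  simp [monomialVec, lp.inner_single_left]

theorem monomialMul_apply_add (i j k l : ℕ) (f : HardyBidisk) :
    monomialMul i j f (i + k, j + l) = f (k, l) := by
  induction i with
  | zero =>
    induction j with
    | zero => simp
    | succ j ih => rw [monomialMul_succ_right, add_right_comm j 1 l, mulZ2_succ, ih]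
  | succ i ih => rw [monomialMul_succ_left, add_right_comm i 1 k, mulZ1_succ, ih]

theorem mulZ1_monomialVec (i j : ℕ) : mulZ1 (monomialVec (i, j)) = monomialVec (i + 1, j) := by
  ext ⟨k, l⟩
  cases k <;> simp [monomialVec_apply]

theorem mulZ2_monomialVec (i j : ℕ) : mulZ2 (monomialVec (i, j)) = monomialVec (i, j + 1) := by
  ext ⟨k, l⟩
  cases l <;> simp [monomialVec_apply]

theorem monomialMul_monomialVec (i j k l : ℕ) :
    monomialMul i j (monomialVec (k, l)) = monomialVec (i + k, j + l) := by
  induction i with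
  | zero =>
    induction j with
    | zero => simp
    | succ j ih => rw [monomialMul_succ_right, ih, mulZ2_monomialVec, add_right_comm j 1 l]
  | succ i ih => rw [monomialMul_succ_left, ih, mulZ1_monomialVec, add_right_comm i 1 k]

theorem mulPoly_monomialVec_zero (q : MvPolynomial (Fin 2) ℂ) :
    mulPoly q (monomialVec (0, 0)) = ∑ d ∈ q.support, q.coeff d • monomialVec (d 0, d 1) := by
  simp [mulPoly_apply, monomialMul_monomialVec]

theorem mulPoly_monomialVec_zero_apply (q : MvPolynomial (Fin 2) ℂ) (d : Fin 2 →₀ ℕ) :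
    mulPoly q (monomialVec (0, 0)) (d 0, d 1) = q.coeff d := by
  have hinj : ∀ e : Fin 2 →₀ ℕ, ((d 0, d 1) = (e 0, e 1)) ↔ d = e := by
    intro e
    rw [Prod.mk.injEq]
    constructor
    · rintro ⟨h0, h1⟩
      ext i
      fin_cases i
      · exact h0
      · exact h1
    · rintro rfl; simp
  rw [← inner_monomialVec, mulPoly_monomialVec_zero, inner_sum]
  simp only [inner_smul_right, inner_monomialVec, monomialVec_apply, hinj, mul_ite, mul_one,
    mul_zero, Finset.sum_ite_eq]
  split_ifs with h
  · rfl
  · simpa [eq_comm] using h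

/-! ### The reflected polynomial -/

theorem mulPoly_sum {ι : Type*} (s : Finset ι) (q : ι → MvPolynomial (Fin 2) ℂ)
    (f : HardyBidisk) : mulPoly (∑ i ∈ s, q i) f = ∑ i ∈ s, mulPoly (q i) f := by
  apply toSeries_injective
  rw [toSeries_mulPoly, map_sum, map_sum, Finset.sum_mul]
  exact Finset.sum_congr rfl fun i _ => (toSeries_mulPoly _ _).symm

theorem mulPoly_X_pow (i j : ℕ) (f : HardyBidisk) :
    mulPoly (MvPolynomial.X 0 ^ i * MvPolynomial.X 1 ^ j) f = monomialMul i j f := by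
  apply toSeries_injective
  rw [toSeries_mulPoly, toSeries_monomialMul]
  simp [polySeries]

theorem mulPoly_reflection (m n : ℕ) (p : MvPolynomial (Fin 2) ℂ) (f : HardyBidisk) :
    mulPoly (reflection m n p) f =
      ∑ d ∈ p.support, conj (p.coeff d) • monomialMul (m - d 0) (n - d 1) f := by
  rw [reflection, mulPoly_sum]
  refine Finset.sum_congr rfl fun d _ => ?_
  rw [mulPoly_mul, mulPoly_C, mulPoly_X_pow]

section Reflection

variable {m n : ℕ} {p : MvPolynomial (Fin 2) ℂ}

/-- This is `|p̃| = |p|` on the torus, without boundary values. After expansion, the term of the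
pair `(d, e)` on the left is the term of `(e, d)` on the right, since monomials act isometrically.
-/
theorem inner_mulPoly_reflection (h0 : p.degreeOf 0 ≤ m) (h1 : p.degreeOf 1 ≤ n)
    (u v : HardyBidisk) :
    inner ℂ (mulPoly (reflection m n p) u) (mulPoly (reflection m n p) v) =
      inner ℂ (mulPoly p u) (mulPoly p v) := by
  simp only [mulPoly_reflection, mulPoly_apply p, sum_inner, inner_sum, inner_smul_left,
    inner_smul_right, Finset.mul_sum]
  rw [Finset.sum_comm]
  refine Finset.sum_congr rfl fun d hd => Finset.sum_congr rfl fun e he => ?_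
  have hd0 := (MvPolynomial.degreeOf_le_iff.1 h0) d hd
  have hd1 := (MvPolynomial.degreeOf_le_iff.1 h1) d hd
  have he0 := (MvPolynomial.degreeOf_le_iff.1 h0) e he
  have he1 := (MvPolynomial.degreeOf_le_iff.1 h1) e he
  have key : inner ℂ (monomialMul (m - d 0) (n - d 1) u) (monomialMul (m - e 0) (n - e 1) v) =
      inner ℂ (monomialMul (e 0) (e 1) u) (monomialMul (d 0) (d 1) v) := by
    rw [← inner_monomialMul (d 0 + e 0) (d 1 + e 1), ← monomialMul_add_apply,
      ← monomialMul_add_apply, ← inner_monomialMul m n (monomialMul (e 0) (e 1) u),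
      ← monomialMul_add_apply, ← monomialMul_add_apply]
    congr 3 <;> omega
  rw [key]
  simp
  ring

theorem norm_mulPoly_reflection (h0 : p.degreeOf 0 ≤ m) (h1 : p.degreeOf 1 ≤ n)
    (u : HardyBidisk) : ‖mulPoly (reflection m n p) u‖ = ‖mulPoly p u‖ := by
  rw [norm_eq_sqrt_re_inner (𝕜 := ℂ), norm_eq_sqrt_re_inner (𝕜 := ℂ),
    inner_mulPoly_reflection h0 h1]

/-- The adjoint of multiplication by `p̃` is thus `p` followed by the backward shift by `(m, n)`;
this is what translates orthogonality to `Θ H²` into vanishing coefficients. -/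
theorem inner_mulPoly_reflection_monomialVec (h0 : p.degreeOf 0 ≤ m) (h1 : p.degreeOf 1 ≤ n)
    (f : HardyBidisk) (i j : ℕ) :
    inner ℂ (mulPoly (reflection m n p) (monomialVec (i, j))) f = mulPoly p f (m + i, n + j) := by
  rw [← inner_monomialVec (m + i, n + j), mulPoly_reflection, mulPoly_apply, sum_inner, inner_sum]
  refine Finset.sum_congr rfl fun d hd => ?_
  have hd0 := (MvPolynomial.degreeOf_le_iff.1 h0) d hd
  have hd1 := (MvPolynomial.degreeOf_le_iff.1 h1) d hd
  rw [inner_smul_left, inner_smul_right, monomialMul_monomialVec, inner_monomialVec,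
    inner_monomialVec, Complex.conj_conj]
  congr 1
  have := monomialMul_apply_add (d 0) (d 1) (m - d 0 + i) (n - d 1 + j) f
  rw [show d 0 + (m - d 0 + i) = m + i by omega,
    show d 1 + (n - d 1 + j) = n + j by omega] at this
  exact this.symm

end Reflection

/-! ### A polynomial without zeros in the bidisk is cyclic -/

/-- The polynomial `q (c z)`. -/
def dilate (c : ℂ) : MvPolynomial (Fin 2) ℂ →ₐ[ℂ] MvPolynomial (Fin 2) ℂ :=
  MvPolynomial.aeval fun i => MvPolynomial.C c * MvPolynomial.X i

theorem coeff_dilate (c : ℂ) (q : MvPolynomial (Fin 2) ℂ) (d : Fin 2 →₀ ℕ) :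
    (dilate c q).coeff d = c ^ (d 0 + d 1) * q.coeff d := by
  have h : dilate c q =
      ∑ e ∈ q.support, MvPolynomial.monomial e (c ^ (e 0 + e 1) * q.coeff e) := by
    rw [dilate, MvPolynomial.aeval_def, MvPolynomial.eval₂_eq']
    refine Finset.sum_congr rfl fun e _ => ?_
    rw [MvPolynomial.monomial_eq, Finsupp.prod_fintype _ _ (by simp)]
    simp [Fin.prod_univ_two, mul_pow, pow_add]
    ring
  rw [h, MvPolynomial.coeff_sum]
  simp only [MvPolynomial.coeff_monomial, Finset.sum_ite_eq']
  split_ifs with hd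
  · rfl
  · rw [MvPolynomial.notMem_support_iff.1 hd, mul_zero]

theorem dilate_dilate (c c' : ℂ) (q : MvPolynomial (Fin 2) ℂ) :
    dilate c (dilate c' q) = dilate (c * c') q := by
  ext d
  simp only [coeff_dilate, mul_pow]
  ring

theorem dilate_one (q : MvPolynomial (Fin 2) ℂ) : dilate 1 q = q := by
  ext d
  simp [coeff_dilate]

theorem polyEval_dilate (c : ℂ) (q : MvPolynomial (Fin 2) ℂ) (z : ℂ × ℂ) :
    polyEval (dilate c q) z = polyEval q (c * z.1, c * z.2) := by
  have : ((MvPolynomial.eval ![z.1, z.2]).comp (dilate c).toRingHom) =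
      MvPolynomial.eval ![c * z.1, c * z.2] := by
    apply MvPolynomial.ringHom_ext
    · intro a; simp [dilate]
    · intro i; fin_cases i <;> simp [dilate]
  exact congrArg (fun φ => φ q) this

/-- The product of the rotations of `p` by the `k`-th roots of unity. -/
def rotationProduct (k : ℕ) (p : MvPolynomial (Fin 2) ℂ) : MvPolynomial (Fin 2) ℂ :=
  ∏ ζ ∈ Polynomial.nthRootsFinset k (1 : ℂ), dilate ζ p

theorem dvd_rotationProduct {k : ℕ} (hk : 0 < k) (p : MvPolynomial (Fin 2) ℂ) :
    p ∣ rotationProduct k p := by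
  have h : (1 : ℂ) ∈ Polynomial.nthRootsFinset k (1 : ℂ) := by
    simp [Polynomial.mem_nthRootsFinset hk]
  have := Finset.dvd_prod_of_mem (fun ζ => dilate ζ p) h
  rwa [dilate_one] at this

theorem dilate_rotationProduct {k : ℕ} (hk : 0 < k) (p : MvPolynomial (Fin 2) ℂ) {ω : ℂ}
    (hω : ω ^ k = 1) : dilate ω (rotationProduct k p) = rotationProduct k p := by
  have hω0 : ω ≠ 0 := by rintro rfl; simp [hk.ne'] at hω
  rw [rotationProduct, map_prod]
  refine Finset.prod_nbij' (fun ζ => ω * ζ) (fun ζ => ω⁻¹ * ζ) ?_ ?_ ?_ ?_ ?_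
  · intro ζ hζ
    simp only [Polynomial.mem_nthRootsFinset hk] at hζ ⊢
    rw [mul_pow, hω, hζ, one_mul]
  · intro ζ hζ
    simp only [Polynomial.mem_nthRootsFinset hk] at hζ ⊢
    rw [mul_pow, inv_pow, hω, hζ, inv_one, one_mul]
  · intro ζ _; field_simp
  · intro ζ _; field_simp
  · intro ζ _; rw [dilate_dilate]

/-- Invariance under a primitive `k`-th root of unity kills every homogeneous part whose degree is
not a multiple of `k`. -/
theorem coeff_rotationProduct_eq_zero {k : ℕ} (p : MvPolynomial (Fin 2) ℂ) {d : Fin 2 →₀ ℕ}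
    (h0 : d 0 + d 1 ≠ 0) (hd : d 0 + d 1 < k) : (rotationProduct k p).coeff d = 0 := by
  have hk : 0 < k := by omega
  have hprim := Complex.isPrimitiveRoot_exp k hk.ne'
  have h := congrArg (MvPolynomial.coeff d) (dilate_rotationProduct hk p hprim.pow_eq_one)
  rw [coeff_dilate] at h
  by_contra hne
  exact hprim.pow_ne_one_of_pos_of_lt h0 hd (mul_right_cancel₀ hne (h.trans (one_mul _).symm))

theorem card_nthRootsFinset_one {k : ℕ} (hk : 0 < k) :
    (Polynomial.nthRootsFinset k (1 : ℂ)).card = k :=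
  (Complex.isPrimitiveRoot_exp k hk.ne').card_nthRootsFinset

theorem polyEval_rotationProduct (k : ℕ) (p : MvPolynomial (Fin 2) ℂ) (z : ℂ × ℂ) :
    polyEval (rotationProduct k p) z =
      ∏ ζ ∈ Polynomial.nthRootsFinset k (1 : ℂ), polyEval p (ζ * z.1, ζ * z.2) := by
  rw [rotationProduct, polyEval, map_prod]
  exact Finset.prod_congr rfl fun ζ _ => polyEval_dilate ζ p z

theorem polyEval_zero (q : MvPolynomial (Fin 2) ℂ) : polyEval q (0, 0) = q.coeff 0 := by
  have : (![0, 0] : Fin 2 → ℂ) = 0 := by ext i; fin_cases i <;> rfl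
  rw [polyEval, this, ← MvPolynomial.constantCoeff_eq, MvPolynomial.constantCoeff_eq,
    MvPolynomial.eval_eq', Finset.sum_eq_single 0]
  · simp
  · intro d _ hd
    obtain ⟨i, hi⟩ := Finsupp.ne_iff.1 hd
    rw [Finset.prod_eq_zero (Finset.mem_univ i), mul_zero]
    simpa using hi
  · intro h
    simpa using h

theorem coeff_zero_rotationProduct {k : ℕ} (hk : 0 < k) (p : MvPolynomial (Fin 2) ℂ) :
    (rotationProduct k p).coeff 0 = p.coeff 0 ^ k := by
  rw [← polyEval_zero, ← polyEval_zero, polyEval_rotationProduct]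
  simp [card_nthRootsFinset_one hk]

/-- Each root `a` contributes `|aᵏ - 1|` on the left against `|a|ᵏ` on the right, and `|a| ≥ 1`
costs only a factor `2`, whatever `k` is. -/
theorem norm_prod_roots_le {k : ℕ} (hk : 0 < k) (c : ℂ) (s : Multiset ℂ)
    (hs : ∀ a ∈ s, 1 ≤ ‖a‖) :
    ‖∏ ζ ∈ Polynomial.nthRootsFinset k (1 : ℂ), (c * (s.map fun a => ζ - a).prod)‖ ≤
      2 ^ s.card * ‖c * (s.map fun a => 0 - a).prod‖ ^ k := by
  induction s using Multiset.induction_on with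
  | empty => simp [card_nthRootsFinset_one hk]
  | cons a s ih =>
    have ih := ih fun b hb => hs b (Multiset.mem_cons_of_mem hb)
    have ha := hs a (Multiset.mem_cons_self a s)
    have h1 : ‖∏ ζ ∈ Polynomial.nthRootsFinset k (1 : ℂ), (ζ - a)‖ ≤ 2 * ‖a‖ ^ k := by
      have := (Complex.isPrimitiveRoot_exp k hk.ne').pow_sub_pow_eq_prod_sub_mul a 1 hk
      have h2 : ‖∏ ζ ∈ Polynomial.nthRootsFinset k (1 : ℂ), (ζ - a)‖ = ‖a ^ k - 1 ^ k‖ := by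
        rw [this, norm_prod, norm_prod]
        exact Finset.prod_congr rfl fun ζ _ => by rw [mul_one, norm_sub_rev]
      rw [h2]
      refine (norm_sub_le _ _).trans ?_
      have := one_le_pow₀ ha (n := k)
      simp only [norm_pow, one_pow, norm_one]
      linarith
    have h3 : ∀ ζ : ℂ, c * ((a ::ₘ s).map fun a => ζ - a).prod =
        (ζ - a) * (c * (s.map fun a => ζ - a).prod) := by
      intro ζ; simp; ring
    simp only [h3]
    rw [Finset.prod_mul_distrib, norm_mul, norm_mul (0 - a), zero_sub, norm_neg, mul_pow,
      Multiset.card_cons, pow_succ]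
    calc _ ≤ (2 * ‖a‖ ^ k) * (2 ^ s.card * ‖c * (s.map fun a => 0 - a).prod‖ ^ k) := by gcongr
      _ = _ := by ring

theorem norm_prod_eval_roots_le {k : ℕ} (hk : 0 < k) (P : Polynomial ℂ)
    (hP : ∀ s : ℂ, ‖s‖ < 1 → P.eval s ≠ 0) :
    ‖∏ ζ ∈ Polynomial.nthRootsFinset k (1 : ℂ), P.eval ζ‖ ≤ 2 ^ P.natDegree * ‖P.eval 0‖ ^ k := by
  have hfac := (IsAlgClosed.splits P).eq_prod_roots
  have hev : ∀ x, P.eval x = P.leadingCoeff * (P.roots.map fun a => x - a).prod := by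
    intro x
    conv_lhs => rw [hfac]
    simp [Polynomial.eval_multiset_prod, Multiset.map_map]
  simp only [hev]
  refine (norm_prod_roots_le hk _ _ fun a ha => ?_).trans ?_
  · by_contra hlt
    exact hP a (not_le.1 hlt) (Polynomial.isRoot_of_mem_roots ha)
  · gcongr
    · norm_num
    · exact Polynomial.card_roots' P

/-- The restriction `s ↦ p (s z)` of a polynomial to a complex line. -/
def slice (z : ℂ × ℂ) : MvPolynomial (Fin 2) ℂ →ₐ[ℂ] Polynomial ℂ :=
  MvPolynomial.aeval ![Polynomial.C z.1 * Polynomial.X, Polynomial.C z.2 * Polynomial.X]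

theorem eval_slice (z : ℂ × ℂ) (p : MvPolynomial (Fin 2) ℂ) (s : ℂ) :
    (slice z p).eval s = polyEval p (s * z.1, s * z.2) := by
  have : ((Polynomial.evalRingHom s).comp (slice z).toRingHom) =
      MvPolynomial.eval ![s * z.1, s * z.2] := by
    apply MvPolynomial.ringHom_ext
    · intro a; simp [slice]
    · intro i; fin_cases i <;> simp [slice] <;> ring
  exact congrArg (fun φ => φ p) this

theorem natDegree_slice_le (z : ℂ × ℂ) (p : MvPolynomial (Fin 2) ℂ) :
    (slice z p).natDegree ≤ p.totalDegree := by
  rw [slice, MvPolynomial.aeval_def, MvPolynomial.eval₂_eq']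
  refine Polynomial.natDegree_sum_le_of_forall_le _ _ fun d hd => ?_
  have hd' : d 0 + d 1 ≤ p.totalDegree := by
    have := MvPolynomial.le_totalDegree hd
    rwa [Finsupp.sum_fintype _ _ (by simp), Fin.sum_univ_two] at this
  refine le_trans ?_ hd'
  simp only [Fin.prod_univ_two, Matrix.cons_val_zero, Matrix.cons_val_one, mul_pow,
    Polynomial.algebraMap_eq, ← Polynomial.C_pow]
  calc _ = (Polynomial.C (p.coeff d * z.1 ^ d 0 * z.2 ^ d 1) *
        Polynomial.X ^ (d 0 + d 1)).natDegree := by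
        congr 1
        simp only [Polynomial.C_mul, Polynomial.C_pow]
        ring
    _ ≤ _ := Polynomial.natDegree_C_mul_X_pow_le _ _

/-- On the complex line through a point of the closed bidisk, `p` is a one-variable polynomial
without zeros in the open disk. The factor `2 ^ p.totalDegree` does not depend on `k`, which is what
the density argument exploits. -/
theorem norm_polyEval_rotationProduct_le {k : ℕ} (hk : 0 < k) {p : MvPolynomial (Fin 2) ℂ}
    (hp : ∀ z ∈ bidisk, polyEval p z ≠ 0) {z : ℂ × ℂ} (h1 : ‖z.1‖ ≤ 1) (h2 : ‖z.2‖ ≤ 1) :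
    ‖polyEval (rotationProduct k p) z‖ ≤ 2 ^ p.totalDegree * ‖polyEval p (0, 0)‖ ^ k := by
  have h := norm_prod_eval_roots_le hk (slice z p) fun s hs => by
    rw [eval_slice]
    refine hp _ ⟨?_, ?_⟩
    · rw [norm_mul]; nlinarith [norm_nonneg s, norm_nonneg z.1]
    · rw [norm_mul]; nlinarith [norm_nonneg s, norm_nonneg z.2]
  simp only [eval_slice, zero_mul] at h
  rw [polyEval_rotationProduct]
  refine h.trans ?_
  gcongr
  · norm_num
  · exact natDegree_slice_le z p

/-- For a probability measure the `L²` norm is at most the supremum norm. -/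
theorem norm_sum_smul_toLp_le {X : Type*} [TopologicalSpace X] [CompactSpace X]
    [MeasurableSpace X] [BorelSpace X] [SecondCountableTopologyEither X ℂ] (μ : Measure X)
    [IsProbabilityMeasure μ] {ι : Type*} (s : Finset ι) (c : ι → ℂ) (G : ι → C(X, ℂ)) {C : ℝ}
    (hC : 0 ≤ C) (h : ∀ x, ‖∑ i ∈ s, c i * G i x‖ ≤ C) :
    ‖∑ i ∈ s, c i • ContinuousMap.toLp (E := ℂ) 2 μ ℂ (G i)‖ ≤ C := by
  have hL : ∑ i ∈ s, c i • ContinuousMap.toLp (E := ℂ) 2 μ ℂ (G i) =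
      ContinuousMap.toLp (E := ℂ) 2 μ ℂ (∑ i ∈ s, c i • G i) := by
    rw [map_sum]
    exact Finset.sum_congr rfl fun d _ => (map_smul _ _ _).symm
  rw [hL]
  refine (ContinuousLinearMap.le_of_opNorm_le _ (ContinuousMap.toLp_norm_le _) _).trans ?_
  have hm : (measureUnivNNReal μ : ℝ) = 1 := by simp [measureUnivNNReal]
  rw [hm, Real.one_rpow, one_mul, ContinuousMap.norm_le _ hC]
  intro x
  simpa using h x

/-- The `H²` norm of a polynomial is at most its supremum on the torus. -/
theorem norm_mulPoly_monomialVec_zero_le (q : MvPolynomial (Fin 2) ℂ) {C : ℝ} (hC : 0 ≤ C)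
    (h : ∀ z : ℂ × ℂ, ‖z.1‖ = 1 → ‖z.2‖ = 1 → ‖polyEval q z‖ ≤ C) :
    ‖mulPoly q (monomialVec (0, 0))‖ ≤ C := by
  have horth : Orthonormal ℂ fun d : Fin 2 →₀ ℕ => monomialVec (d 0, d 1) := by
    rw [orthonormal_iff_ite]
    intro d e
    rw [inner_monomialVec, monomialVec_apply]
    congr 1
    rw [Prod.mk.injEq, eq_iff_iff]
    constructor
    · rintro ⟨h0, h1⟩
      ext i
      fin_cases i
      · exact h0
      · exact h1
    · rintro rfl; simp
  have hinj : Function.Injective fun (d : Fin 2 →₀ ℕ) (i : Fin 2) => (d i : ℤ) := by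
    intro d e hde
    ext i
    simpa using congrFun hde i
  have horth' := UnitAddTorus.orthonormal_mFourier.comp _ hinj
  -- The same coefficients are summed against two orthonormal families, so the norms agree and the
  -- estimate can be made on the torus.
  have hnorm : ‖mulPoly q (monomialVec (0, 0))‖ =
      ‖∑ d ∈ q.support, q.coeff d • UnitAddTorus.mFourierLp 2 (fun i : Fin 2 => (d i : ℤ))‖ := by
    rw [mulPoly_monomialVec_zero, norm_eq_sqrt_re_inner (𝕜 := ℂ), norm_eq_sqrt_re_inner (𝕜 := ℂ),
      horth.inner_sum]
    have := horth'.inner_sum (fun d => q.coeff d) (fun d => q.coeff d) q.support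
    simp only [Function.comp_def] at this
    rw [this]
  rw [hnorm]
  refine norm_sum_smul_toLp_le
    (Measure.pi fun _ : Fin 2 => (AddCircle.haarAddCircle : Measure UnitAddCircle)) q.support (fun d => q.coeff d)
    (fun d => UnitAddTorus.mFourier (fun i : Fin 2 => (d i : ℤ))) hC ?_
  intro x
  have := h ((x 0).toCircle, (x 1).toCircle) (Circle.norm_coe _) (Circle.norm_coe _)
  rw [polyEval, MvPolynomial.eval_eq'] at this
  simpa [Fin.prod_univ_two, UnitAddTorus.mFourier, fourier_apply, AddCircle.toCircle_nsmul]
    using this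

/-- The rotation products lie in `p H²`. Divided by `p(0, 0)ᵏ`, they are bounded in norm uniformly
in `k`, have constant term `1`, and have no other coefficient of total degree below `k`. They
converge weakly to `1`, so `1` is in the closure of the range; shifts then give everything. -/
theorem dense_range_mulPoly {p : MvPolynomial (Fin 2) ℂ} (hp : ∀ z ∈ bidisk, polyEval p z ≠ 0) :
    (LinearMap.range (mulPoly p : HardyBidisk →ₗ[ℂ] HardyBidisk)).topologicalClosure = ⊤ := by
  have hp0 : polyEval p (0, 0) ≠ 0 := hp _ (by simp [bidisk])
  have hzero : ∀ F : HardyBidisk, (∀ x, inner ℂ (mulPoly p x) F = 0) → F (0, 0) = 0 := by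
    intro F hF
    rw [← norm_le_zero_iff]
    refine le_of_forall_pos_le_add fun ε hε => ?_
    rw [zero_add]
    set C : ℝ := 2 ^ p.totalDegree with hCdef
    have hCpos : 0 < C := by positivity
    obtain ⟨s, hs0, hs⟩ : ∃ s : Finset (ℕ × ℕ), (0, 0) ∈ s ∧
        ‖F - ∑ a ∈ s, lp.single 2 a (F a)‖ < ε / C := by
      have h1 := lp.hasSum_single (E := fun _ : ℕ × ℕ => ℂ) (p := 2) (by norm_num) F
      have h2 := (Metric.tendsto_nhds.1 h1 (ε / C) (by positivity)).and
        (Filter.eventually_ge_atTop {(0, 0)})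
      obtain ⟨s, h3, h4⟩ := h2.exists
      refine ⟨s, h4 (by simp), ?_⟩
      rw [dist_comm, dist_eq_norm] at h3
      exact h3
    -- With `k` beyond all total degrees occurring in `s`, the product `G` meets the truncation of
    -- `F` only in the constant term.
    obtain ⟨k, hk0, hk⟩ : ∃ k, 0 < k ∧ ∀ a ∈ s, a.1 + a.2 < k :=
      ⟨s.sup (fun a => a.1 + a.2) + 1, by omega, fun a ha =>
        Nat.lt_succ_of_le (Finset.le_sup (f := fun a : ℕ × ℕ => a.1 + a.2) ha)⟩
    set G := mulPoly (rotationProduct k p) (monomialVec (0, 0)) with hG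
    have hGF : inner ℂ G F = 0 := by
      obtain ⟨r, hr⟩ := dvd_rotationProduct hk0 p
      rw [hG, hr, mulPoly_mul]
      exact hF _
    have hGn : ‖G‖ ≤ C * ‖polyEval p (0, 0)‖ ^ k :=
      norm_mulPoly_monomialVec_zero_le _ (by positivity) fun z h1 h2 =>
        norm_polyEval_rotationProduct_le hk0 hp h1.le h2.le
    have hcoeff : ∀ a : ℕ × ℕ, ∃ d : Fin 2 →₀ ℕ, a = (d 0, d 1) := fun a =>
      ⟨Finsupp.equivFunOnFinite.symm ![a.1, a.2], by simp⟩
    have hGs : ∀ a ∈ s, a ≠ (0, 0) → G a = 0 := by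
      intro a ha hne
      obtain ⟨d, rfl⟩ := hcoeff a
      rw [hG, mulPoly_monomialVec_zero_apply]
      refine coeff_rotationProduct_eq_zero p (fun h => hne ?_) (hk _ ha)
      rw [Prod.mk.injEq]; omega
    have hG0 : ‖G (0, 0)‖ = ‖polyEval p (0, 0)‖ ^ k := by
      have := mulPoly_monomialVec_zero_apply (rotationProduct k p) 0
      simp only [Finsupp.coe_zero, Pi.zero_apply] at this
      rw [hG, this, coeff_zero_rotationProduct hk0, norm_pow]
      rw [polyEval_zero]
    have hin : inner ℂ G (∑ a ∈ s, lp.single (E := fun _ : ℕ × ℕ => ℂ) 2 a (F a)) =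
        conj (G (0, 0)) * F (0, 0) := by
      rw [inner_sum, Finset.sum_eq_single (0, 0)]
      · rw [lp.inner_single_right]; simp [mul_comm]
      · intro a ha hne
        rw [lp.inner_single_right, hGs a ha hne, inner_zero_left]
      · intro h; exact absurd hs0 h
    have hest : ‖G (0, 0)‖ * ‖F (0, 0)‖ ≤ C * ‖polyEval p (0, 0)‖ ^ k * (ε / C) := by
      calc ‖G (0, 0)‖ * ‖F (0, 0)‖ = ‖conj (G (0, 0)) * F (0, 0)‖ := by
            rw [norm_mul, RCLike.norm_conj]
        _ = ‖inner ℂ G (F - ∑ a ∈ s, lp.single (E := fun _ : ℕ × ℕ => ℂ) 2 a (F a))‖ := by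
            rw [inner_sub_right, hGF, hin, zero_sub, norm_neg]
        _ ≤ ‖G‖ * ‖F - ∑ a ∈ s, lp.single (E := fun _ : ℕ × ℕ => ℂ) 2 a (F a)‖ :=
            norm_inner_le_norm _ _
        _ ≤ _ := mul_le_mul hGn hs.le (norm_nonneg _) (by positivity)
    rw [hG0] at hest
    have hpk : 0 < ‖polyEval p (0, 0)‖ ^ k := by positivity
    have : C * ‖polyEval p (0, 0)‖ ^ k * (ε / C) = ‖polyEval p (0, 0)‖ ^ k * ε := by
      field_simp
    rw [this] at hest
    exact le_of_mul_le_mul_left hest hpk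
  rw [Submodule.topologicalClosure_eq_top_iff, Submodule.eq_bot_iff]
  intro F hF
  have hF' : ∀ x, inner ℂ (mulPoly p x) F = 0 := fun x =>
    (Submodule.mem_orthogonal _ _).1 hF _ ⟨x, rfl⟩
  ext ⟨i, j⟩
  -- The orthogonal complement of the range is stable under backward shifts, so the statement on the
  -- constant term reaches all coefficients.
  have h := hzero (ContinuousLinearMap.adjoint (monomialMul i j) F) fun x => by
    rw [ContinuousLinearMap.adjoint_inner_right, ← mulPoly_X_pow, mulPoly_comm]
    exact hF' _
  rw [← inner_monomialVec, ContinuousLinearMap.adjoint_inner_right, monomialMul_monomialVec,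
    inner_monomialVec] at h
  simpa using h

/-! ### The model space in terms of coefficients -/

section Model

variable {m n : ℕ} {p : MvPolynomial (Fin 2) ℂ}

theorem IsRationalInner.degreeOf_fst_le (hp : IsRationalInner m n p) : p.degreeOf 0 ≤ m :=
  (le_max_left _ _).trans hp.degree_fst.le

theorem IsRationalInner.degreeOf_snd_le (hp : IsRationalInner m n p) : p.degreeOf 1 ≤ n :=
  (le_max_left _ _).trans hp.degree_snd.le

theorem IsRationalInner.polynomial_ne_zero (hp : IsRationalInner m n p) : p ≠ 0 := by
  rintro rfl
  exact hp.ne_zero (0, 0) (by simp [bidisk]) (by simp [polyEval])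

theorem eval_eq_theta_mul_iff (hp : IsRationalInner m n p) (h g : HardyBidisk) :
    (∀ z ∈ bidisk, bidiskEval h z = theta m n p z * bidiskEval g z) ↔
      mulPoly p h = mulPoly (reflection m n p) g := by
  constructor
  · intro H
    refine eq_of_bidiskEval_eq fun z hz => ?_
    have := hp.ne_zero z hz
    rw [bidiskEval_mulPoly _ _ hz, bidiskEval_mulPoly _ _ hz, H z hz, theta]
    field_simp
  · intro H z hz
    have := hp.ne_zero z hz
    have h2 := congrArg (fun f => bidiskEval f z) H
    simp only [bidiskEval_mulPoly _ _ hz] at h2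
    rw [theta]
    field_simp
    rw [mul_comm]
    exact h2

/-- Choose `u k` with `p u k → g`. Since `‖p̃ u‖ = ‖p u‖`, the sequence `p̃ u k` is Cauchy, and its
limit plays the role of `Θ g`. Its membership in the closure of the range of `p̃` is as important as
its existence. -/
theorem exists_theta_mul (hp : IsRationalInner m n p) (g : HardyBidisk) :
    ∃ h ∈ (LinearMap.range
        (mulPoly (reflection m n p) : HardyBidisk →ₗ[ℂ] HardyBidisk)).topologicalClosure,
      mulPoly p h = mulPoly (reflection m n p) g := by
  have hg : g ∈ closure (Set.range (mulPoly p)) := by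
    have : g ∈ (LinearMap.range (mulPoly p : HardyBidisk →ₗ[ℂ] HardyBidisk)).topologicalClosure := by
      rw [dense_range_mulPoly hp.ne_zero]; trivial
    rw [← SetLike.mem_coe, Submodule.topologicalClosure_coe] at this
    exact this
  obtain ⟨x, hx, hlim⟩ := mem_closure_iff_seq_limit.1 hg
  choose u hu using hx
  have hc : CauchySeq fun k => mulPoly (reflection m n p) (u k) := by
    have h1 := hlim.cauchySeq
    rw [Metric.cauchySeq_iff] at h1 ⊢
    intro ε hε
    obtain ⟨N, hN⟩ := h1 ε hε
    refine ⟨N, fun a ha b hb => ?_⟩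
    rw [dist_eq_norm, ← map_sub,
      norm_mulPoly_reflection hp.degreeOf_fst_le hp.degreeOf_snd_le, map_sub, hu, hu,
      ← dist_eq_norm]
    exact hN a ha b hb
  obtain ⟨h, hh⟩ := cauchySeq_tendsto_of_complete hc
  refine ⟨h, ?_, ?_⟩
  · rw [← SetLike.mem_coe, Submodule.topologicalClosure_coe]
    exact mem_closure_of_tendsto hh (Filter.Eventually.of_forall fun k => ⟨u k, rfl⟩)
  · have h1 := ((mulPoly p).continuous.tendsto h).comp hh
    have h2 := ((mulPoly (reflection m n p)).continuous.tendsto g).comp hlim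
    refine tendsto_nhds_unique h1 (h2.congr fun k => ?_)
    rw [Function.comp_apply, Function.comp_apply, ← hu, mulPoly_comm]

/-- Forward, `p̃ zᵃ = Θ (p zᵃ)` is one of the spanning vectors. Backward, the vanishing coefficients
say that `f` is orthogonal to the range of `p̃`, hence to its closure, which contains `Θ H²`. -/
theorem mem_modelSpace_iff (hp : IsRationalInner m n p) (f : HardyBidisk) :
    f ∈ modelSpace (theta m n p) ↔ ∀ i j, mulPoly p f (m + i, n + j) = 0 := by
  rw [modelSpace, Submodule.mem_orthogonal]
  constructor
  · intro h i j
    rw [← inner_mulPoly_reflection_monomialVec hp.degreeOf_fst_le hp.degreeOf_snd_le]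
    refine h _ (Submodule.subset_span ⟨mulPoly p (monomialVec (i, j)), ?_⟩)
    rw [eval_eq_theta_mul_iff hp, mulPoly_comm]
  · intro h u hu
    have h0 : ContinuousLinearMap.adjoint (mulPoly (reflection m n p)) f = 0 := by
      ext ⟨i, j⟩
      rw [← inner_monomialVec, ContinuousLinearMap.adjoint_inner_right,
        inner_mulPoly_reflection_monomialVec hp.degreeOf_fst_le hp.degreeOf_snd_le, h]
      rfl
    have h1 : (LinearMap.range (mulPoly (reflection m n p) :
        HardyBidisk →ₗ[ℂ] HardyBidisk)).topologicalClosure ≤ (ℂ ∙ f)ᗮ := by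
      refine Submodule.topologicalClosure_minimal _ ?_ (Submodule.isClosed_orthogonal _)
      rintro _ ⟨x, rfl⟩
      rw [Submodule.mem_orthogonal_singleton_iff_inner_left]
      change inner ℂ (mulPoly (reflection m n p) x) f = 0
      rw [← ContinuousLinearMap.adjoint_inner_right, h0, inner_zero_right]
    induction hu using Submodule.span_induction with
    | mem u hu =>
      obtain ⟨g, hg⟩ := hu
      rw [eval_eq_theta_mul_iff hp] at hg
      obtain ⟨h', hh', he⟩ := exists_theta_mul hp g
      rw [mulPoly_left_cancel hp.polynomial_ne_zero (hg.trans he.symm)]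
      exact (Submodule.mem_orthogonal_singleton_iff_inner_left).1 (h1 hh')
    | zero => exact inner_zero_left _
    | add x y _ _ hx hy => rw [inner_add_left, hx, hy, add_zero]
    | smul c x _ hx => rw [inner_smul_left, hx, mul_zero]

/-- The largest `z₂`-invariant subspace of the model space. -/
def maxSnd (m : ℕ) (p : MvPolynomial (Fin 2) ℂ) : Submodule ℂ HardyBidisk where
  carrier := {f | ∀ i j, mulPoly p f (m + i, j) = 0}
  add_mem' {f g} hf hg i j := by simp [hf i j, hg i j]
  zero_mem' i j := by simp
  smul_mem' c f hf i j := by simp [hf i j]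

theorem maxSnd_le (hp : IsRationalInner m n p) : maxSnd m p ≤ modelSpace (theta m n p) :=
  fun f hf => (mem_modelSpace_iff hp f).2 fun i j => hf i (n + j)

theorem mulZ2_mem_maxSnd {f : HardyBidisk} (hf : f ∈ maxSnd m p) : mulZ2 f ∈ maxSnd m p := by
  intro i j
  rw [mulPoly_mulZ2]
  cases j with
  | zero => simp
  | succ j => rw [mulZ2_succ]; exact hf i j

theorem monomialMul_snd_mem {S : Submodule ℂ HardyBidisk} (hS : ∀ f ∈ S, mulZ2 f ∈ S)
    {f : HardyBidisk} (hf : f ∈ S) (k : ℕ) : monomialMul 0 k f ∈ S := by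
  induction k with
  | zero => simpa using hf
  | succ k ih => rw [monomialMul_succ_right]; exact hS _ ih

theorem monomialMul_fst_mem {S : Submodule ℂ HardyBidisk} (hS : ∀ f ∈ S, mulZ1 f ∈ S)
    {f : HardyBidisk} (hf : f ∈ S) (k : ℕ) : monomialMul k 0 f ∈ S := by
  induction k with
  | zero => simpa using hf
  | succ k ih => rw [monomialMul_succ_left]; exact hS _ ih

theorem mulPoly_monomialMul (q : MvPolynomial (Fin 2) ℂ) (i j : ℕ) (f : HardyBidisk) :
    mulPoly q (monomialMul i j f) = monomialMul i j (mulPoly q f) := by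
  rw [← mulPoly_X_pow, ← mulPoly_X_pow, mulPoly_comm]

/-! ### The summands of a shift decomposition: degree bounds and backward shifts. -/

variable {S₁ S₂ : Submodule ℂ HardyBidisk}

theorem IsShiftDecomposition.fst_le {K : Submodule ℂ HardyBidisk}
    (hS : IsShiftDecomposition K S₁ S₂) : S₁ ≤ K := hS.sum_eq ▸ le_sup_left

theorem IsShiftDecomposition.snd_le {K : Submodule ℂ HardyBidisk}
    (hS : IsShiftDecomposition K S₁ S₂) : S₂ ≤ K := hS.sum_eq ▸ le_sup_right

/-- Apply the coefficient criterion to `z₂ⁿ f`, which is still in the model space: the shift by `n`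
removes the restriction on the second index. -/
theorem IsShiftDecomposition.le_maxSnd (hp : IsRationalInner m n p)
    (hS : IsShiftDecomposition (modelSpace (theta m n p)) S₁ S₂) : S₂ ≤ maxSnd m p := by
  intro f hf i j
  have h := (mem_modelSpace_iff hp _).1
    (hS.snd_le (monomialMul_snd_mem hS.invariant_snd hf n)) i j
  rw [mulPoly_monomialMul] at h
  have h2 := monomialMul_apply_add 0 n (m + i) j (mulPoly p f)
  rw [zero_add] at h2
  rw [← h2, h]

theorem IsShiftDecomposition.coeff_fst_eq_zero (hp : IsRationalInner m n p)
    (hS : IsShiftDecomposition (modelSpace (theta m n p)) S₁ S₂) {f : HardyBidisk} (hf : f ∈ S₁)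
    (i j : ℕ) : mulPoly p f (i, n + j) = 0 := by
  have h := (mem_modelSpace_iff hp _).1
    (hS.fst_le (monomialMul_fst_mem hS.invariant_fst hf m)) i j
  rw [mulPoly_monomialMul] at h
  have h2 := monomialMul_apply_add m 0 i (n + j) (mulPoly p f)
  rw [zero_add] at h2
  rw [← h2, h]

theorem IsShiftDecomposition.mem_snd_of_orthogonal {K : Submodule ℂ HardyBidisk}
    (hS : IsShiftDecomposition K S₁ S₂) {f : HardyBidisk} (hf : f ∈ K)
    (h : ∀ g ∈ S₁, inner ℂ g f = 0) : f ∈ S₂ := by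
  rw [← hS.sum_eq] at hf
  obtain ⟨x, hx, y, hy, rfl⟩ := Submodule.mem_sup.1 hf
  have h1 := h x hx
  rw [inner_add_right, Submodule.isOrtho_iff_inner_eq.1 hS.orthogonal x hx y hy, add_zero,
    inner_self_eq_zero] at h1
  rw [h1, zero_add]
  exact hy

theorem IsShiftDecomposition.mem_fst_of_orthogonal {K : Submodule ℂ HardyBidisk}
    (hS : IsShiftDecomposition K S₁ S₂) {f : HardyBidisk} (hf : f ∈ K)
    (h : ∀ g ∈ S₂, inner ℂ g f = 0) : f ∈ S₁ := by
  rw [← hS.sum_eq] at hf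
  obtain ⟨x, hx, y, hy, rfl⟩ := Submodule.mem_sup.1 hf
  have h1 := h y hy
  rw [inner_add_right, Submodule.isOrtho_iff_inner_eq.1 hS.orthogonal.symm y hy x hx, zero_add,
    inner_self_eq_zero] at h1
  rw [h1, add_zero]
  exact hx

/-- The backward shift in `z₁`. -/
def backShift1 : HardyBidisk →L[ℂ] HardyBidisk := ContinuousLinearMap.adjoint mulZ1

/-- The backward shift in `z₂`. -/
def backShift2 : HardyBidisk →L[ℂ] HardyBidisk := ContinuousLinearMap.adjoint mulZ2

theorem backShift1_apply (f : HardyBidisk) (i j : ℕ) : backShift1 f (i, j) = f (i + 1, j) := by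
  rw [← inner_monomialVec, backShift1, ContinuousLinearMap.adjoint_inner_right, mulZ1_monomialVec,
    inner_monomialVec]

theorem backShift2_apply (f : HardyBidisk) (i j : ℕ) : backShift2 f (i, j) = f (i, j + 1) := by
  rw [← inner_monomialVec, backShift2, ContinuousLinearMap.adjoint_inner_right, mulZ2_monomialVec,
    inner_monomialVec]

/-- A multiplication operator preserves `Θ H²`, so its adjoint preserves the orthogonal complement.
-/
theorem adjoint_mem_modelSpace {T : HardyBidisk →L[ℂ] HardyBidisk} {t : ℂ × ℂ → ℂ}
    (hT : ∀ f z, bidiskEval (T f) z = t z * bidiskEval f z) {Θ : ℂ × ℂ → ℂ} {f : HardyBidisk}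
    (hf : f ∈ modelSpace Θ) : ContinuousLinearMap.adjoint T f ∈ modelSpace Θ := by
  rw [modelSpace, Submodule.mem_orthogonal] at hf ⊢
  intro u hu
  induction hu using Submodule.span_induction with
  | mem u hu =>
    obtain ⟨g, hg⟩ := hu
    rw [ContinuousLinearMap.adjoint_inner_right]
    refine hf _ (Submodule.subset_span ⟨T g, fun z hz => ?_⟩)
    rw [hT, hT, hg z hz]
    ring
  | zero => exact inner_zero_left _
  | add x y _ _ hx hy => rw [inner_add_left, hx, hy, add_zero]
  | smul c x _ hx => rw [inner_smul_left, hx, mul_zero]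

theorem backShift1_mem_modelSpace {Θ : ℂ × ℂ → ℂ} {f : HardyBidisk} (hf : f ∈ modelSpace Θ) :
    backShift1 f ∈ modelSpace Θ :=
  adjoint_mem_modelSpace bidiskEval_mulZ1 hf

theorem backShift2_mem_modelSpace {Θ : ℂ × ℂ → ℂ} {f : HardyBidisk} (hf : f ∈ modelSpace Θ) :
    backShift2 f ∈ modelSpace Θ :=
  adjoint_mem_modelSpace bidiskEval_mulZ2 hf

/-- The backward shift stays in the model space, and it is orthogonal to `S₁` because `z₁ S₁ ⊆ S₁ ⟂
S₂`. -/
theorem IsShiftDecomposition.backShift1_mem {Θ : ℂ × ℂ → ℂ}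
    (hS : IsShiftDecomposition (modelSpace Θ) S₁ S₂) {f : HardyBidisk} (hf : f ∈ S₂) :
    backShift1 f ∈ S₂ := by
  refine hS.mem_snd_of_orthogonal (backShift1_mem_modelSpace (hS.snd_le hf)) fun g hg => ?_
  rw [backShift1, ContinuousLinearMap.adjoint_inner_right]
  exact Submodule.isOrtho_iff_inner_eq.1 hS.orthogonal _ (hS.invariant_fst g hg) f hf

theorem inner_mulZ2_wandering {S : Submodule ℂ HardyBidisk} {f g : HardyBidisk}
    (hf : f ∈ wandering S) (hg : g ∈ S) : inner ℂ (mulZ2 g) f = 0 :=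
  (Submodule.mem_orthogonal _ _).1 hf.2 _ ⟨g, hg, rfl⟩

/-- Orthogonality of `f` to `z₂ S₂` is orthogonality of its backward shift to `S₂`, which leaves
only `S₁` inside the model space. -/
theorem IsShiftDecomposition.backShift2_mem {Θ : ℂ × ℂ → ℂ}
    (hS : IsShiftDecomposition (modelSpace Θ) S₁ S₂) {f : HardyBidisk} (hf : f ∈ wandering S₂) :
    backShift2 f ∈ S₁ := by
  refine hS.mem_fst_of_orthogonal (backShift2_mem_modelSpace (hS.snd_le hf.1)) fun g hg => ?_
  rw [backShift2, ContinuousLinearMap.adjoint_inner_right]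
  exact inner_mulZ2_wandering hf hg

theorem mulPoly_apply_eq_zero_of_snd (h1 : p.degreeOf 1 ≤ n) {f : HardyBidisk}
    (hf : ∀ i j, f (i, j + 1) = 0) (i j : ℕ) : mulPoly p f (i, n + j + 1) = 0 := by
  have key : ∀ k l : ℕ, l ≤ n → monomialMul k l f (i, n + j + 1) = 0 := by
    intro k l hl
    by_cases hk : k ≤ i
    · obtain ⟨i', rfl⟩ := Nat.exists_eq_add_of_le hk
      have := monomialMul_apply_add k l i' (n - l + j + 1) f
      rw [show l + (n - l + j + 1) = n + j + 1 by omega] at this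
      rw [this, hf]
    · have : ∀ k i j, i < k → monomialMul k l f (i, j) = 0 := by
        intro k
        induction k with
        | zero => intro i j h; omega
        | succ k ih =>
          intro i j h
          rw [monomialMul_succ_left]
          cases i with
          | zero => simp
          | succ i => rw [mulZ1_succ]; exact ih i j (by omega)
      exact this k i _ (by omega)
  rw [mulPoly_apply, ← inner_monomialVec, inner_sum]
  refine Finset.sum_eq_zero fun d hd => ?_
  rw [inner_smul_right, inner_monomialVec, key _ _ (MvPolynomial.degreeOf_le_iff.1 h1 d hd),
    mul_zero]

/-- For `f ∈ S₂ ⊖ z₂ S₂`, the function `p f` is a polynomial of degree at most `n` in `z₂`. -/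
theorem IsShiftDecomposition.coeff_wandering_eq_zero (hp : IsRationalInner m n p)
    (hS : IsShiftDecomposition (modelSpace (theta m n p)) S₁ S₂) {f : HardyBidisk}
    (hf : f ∈ wandering S₂) (i j : ℕ) : mulPoly p f (i, n + j + 1) = 0 := by
  -- Split `f` into `f(z₁, 0)`, whose product with `p` has `z₂`-degree at most `n`, and `z₂` times
  -- an element of `S₁`, where the degree is below `n` before the factor `z₂`.
  have h1 : mulPoly p (f - mulZ2 (backShift2 f)) (i, n + j + 1) = 0 := by
    refine mulPoly_apply_eq_zero_of_snd hp.degreeOf_snd_le (fun i j => ?_) i j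
    simp [backShift2_apply]
  have h2 : mulPoly p (mulZ2 (backShift2 f)) (i, n + j + 1) = 0 := by
    rw [mulPoly_mulZ2, mulZ2_succ]
    exact hS.coeff_fst_eq_zero hp (hS.backShift2_mem hf) i j
  rw [map_sub] at h1
  simpa [h2] using h1

end Model

/-! ### Elimination of `z₁` -/

open Polynomial in
/-- Two coprime polynomials over a domain, of degree at most `m` and not both less than `m`,
have nonzero resultant. -/
theorem resultant_ne_zero_of_isRelPrime {R : Type*} [CommRing R] [IsDomain R]
    [DecompositionMonoid R[X]] {f g : R[X]} {m : ℕ} (hm : m ≠ 0) (h : IsRelPrime f g)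
    (hf : f.natDegree ≤ m) (hg : g.natDegree ≤ m) (hmax : f.natDegree = m ∨ g.natDegree = m) :
    f.resultant g m m ≠ 0 := by
  intro h0
  -- A null vector of the Sylvester matrix encodes cofactors of degree below `m` with `f Q + g P =
  -- 0`.
  obtain ⟨v, hv0, hv⟩ := Matrix.exists_mulVec_eq_zero_iff.2 h0
  let b₁ := ((degreeLT.basis R m).prod (degreeLT.basis R m)).reindex finSumFinEquiv
  let b₂ := degreeLT.basis R (m + m)
  have hinj : ∀ x, sylvesterMap f g hf hg x = 0 → x = 0 := by
    rintro ⟨P, Q⟩ hx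
    have hx : f * Q.1 + g * P.1 = 0 := congrArg Subtype.val hx
    have hP := Polynomial.mem_degreeLT.1 P.2
    have hQ := Polynomial.mem_degreeLT.1 Q.2
    -- Coprimality makes the polynomial of exact degree `m` divide a cofactor of smaller degree. It
    -- is stated symmetrically because either of the two may have degree `m`.
    have aux : ∀ {f g A B : R[X]}, IsRelPrime f g → f.natDegree = m → A.degree < m →
        f * B + g * A = 0 → A = 0 ∧ B = 0 := by
      intro f g A B h hf hA hx
      have hf0 : f ≠ 0 := by rintro rfl; simp at hf; exact hm hf.symm
      have hd : f ∣ g * A := ⟨-B, by linear_combination hx⟩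
      have hA0 : A = 0 := by
        by_contra hA0
        have := Polynomial.degree_le_of_dvd (h.dvd_of_dvd_mul_left hd) hA0
        rw [Polynomial.degree_eq_natDegree hf0, hf] at this
        exact absurd hA (not_lt.2 this)
      refine ⟨hA0, ?_⟩
      rw [hA0, mul_zero, add_zero] at hx
      exact (mul_eq_zero.1 hx).resolve_left hf0
    rcases hmax with hfm | hgm
    · obtain ⟨hA, hB⟩ := aux h hfm hP hx
      exact Prod.ext (Subtype.ext hA) (Subtype.ext hB)
    · obtain ⟨hA, hB⟩ := aux h.symm hgm hQ ((add_comm _ _).trans hx)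
      exact Prod.ext (Subtype.ext hB) (Subtype.ext hA)
  have h1 : (sylvesterMap f g hf hg) (b₁.equivFun.symm v) = 0 := by
    apply b₂.equivFun.injective
    have := LinearMap.toMatrix_mulVec_repr b₁ b₂ (sylvesterMap f g hf hg) (b₁.equivFun.symm v)
    rw [toMatrix_sylvesterMap'] at this
    rw [map_zero, Module.Basis.equivFun_apply, ← this]
    have h2 : ⇑(b₁.repr (b₁.equivFun.symm v)) = v := by
      rw [← Module.Basis.equivFun_apply, LinearEquiv.apply_symm_apply]
    rw [h2]
    exact hv
  have h2 := hinj _ h1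
  rw [LinearEquiv.map_eq_zero_iff] at h2
  exact hv0 h2

/-- The resultant with respect to `z₁` (the variable singled out by `finSuccEquiv`) is a combination
of `p` and `p̃`, depends on `z₂` only, and is nonzero because they are coprime and one of them
attains degree `m`. -/
theorem exists_elimination {m n : ℕ} {p : MvPolynomial (Fin 2) ℂ} (hp : IsRationalInner m n p)
    (hm : m ≠ 0) : ∃ a c D : MvPolynomial (Fin 2) ℂ, D ≠ 0 ∧ D.degreeOf 0 = 0 ∧
      p * a + reflection m n p * c = D := by
  let e := MvPolynomial.finSuccEquiv ℂ 1
  have hrel : IsRelPrime (e p) (e (reflection m n p)) := by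
    intro d h1 h2
    have h1' := map_dvd e.symm h1
    have h2' := map_dvd e.symm h2
    rw [AlgEquiv.symm_apply_apply] at h1' h2'
    have := (hp.no_common_factor h1' h2').map e
    rwa [AlgEquiv.apply_symm_apply] at this
  have hdeg := hp.degree_fst
  rw [← MvPolynomial.natDegree_finSuccEquiv, ← MvPolynomial.natDegree_finSuccEquiv] at hdeg
  have h1 : (e p).natDegree ≤ m := (le_max_left _ _).trans hdeg.le
  have h2 : (e (reflection m n p)).natDegree ≤ m := (le_max_right _ _).trans hdeg.le
  have hmax : (e p).natDegree = m ∨ (e (reflection m n p)).natDegree = m := by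
    rcases max_choice (e p).natDegree (e (reflection m n p)).natDegree with h | h
    · exact Or.inl (h.symm.trans hdeg)
    · exact Or.inr (h.symm.trans hdeg)
  have hres := resultant_ne_zero_of_isRelPrime hm hrel h1 h2 hmax
  obtain ⟨a, c, -, -, hac⟩ :=
    Polynomial.exists_mul_add_mul_eq_C_resultant (e p) (e (reflection m n p)) h1 h2 (Or.inl hm)
  refine ⟨e.symm a, e.symm c, e.symm (Polynomial.C
    ((e p).resultant (e (reflection m n p)) m m)), ?_, ?_, ?_⟩
  · rw [Ne, map_eq_zero_iff _ e.symm.injective, Polynomial.C_eq_zero]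
    exact hres
  · rw [← MvPolynomial.natDegree_finSuccEquiv]
    change (e (e.symm _)).natDegree = 0
    rw [AlgEquiv.apply_symm_apply, Polynomial.natDegree_C]
  · rw [← hac, map_add, map_mul, map_mul, AlgEquiv.symm_apply_apply, AlgEquiv.symm_apply_apply]

/-! ### The Wold decomposition of a `z₂`-invariant subspace -/

section Wold

variable {r : ℕ} {S : Submodule ℂ HardyBidisk}

theorem monomialMul_snd_add (k l : ℕ) (f : HardyBidisk) :
    monomialMul 0 (k + l) f = monomialMul 0 k (monomialMul 0 l f) :=
  monomialMul_add_apply 0 k 0 l f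

theorem monomialMul_snd_succ (k : ℕ) (f : HardyBidisk) :
    monomialMul 0 (k + 1) f = monomialMul 0 k (mulZ2 f) := by
  rw [monomialMul_snd_add]
  congr 1

theorem inner_monomialMul_snd_wandering (hinv : ∀ f ∈ S, mulZ2 f ∈ S) {f g : HardyBidisk}
    (hf : f ∈ wandering S) (hg : g ∈ S) {k : ℕ} (hk : k ≠ 0) :
    inner ℂ (monomialMul 0 k g) f = 0 := by
  obtain ⟨k, rfl⟩ := Nat.exists_eq_succ_of_ne_zero hk
  rw [Nat.succ_eq_add_one, monomialMul_succ_right]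
  exact inner_mulZ2_wandering hf (monomialMul_snd_mem hinv hg k)

/-- The functions `z₂ᵏ bᵢ`. -/
def woldVec (b : OrthonormalBasis (Fin r) ℂ (wandering S)) (a : Fin r × ℕ) : HardyBidisk :=
  monomialMul 0 a.2 (b a.1)

theorem woldVec_mem (hinv : ∀ f ∈ S, mulZ2 f ∈ S) (b : OrthonormalBasis (Fin r) ℂ (wandering S))
    (a : Fin r × ℕ) : woldVec b a ∈ S :=
  monomialMul_snd_mem hinv (b a.1).2.1 a.2

theorem inner_woldVec (hinv : ∀ f ∈ S, mulZ2 f ∈ S)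
    (b : OrthonormalBasis (Fin r) ℂ (wandering S)) (x y : Fin r × ℕ) :
    inner ℂ (woldVec b x) (woldVec b y) = if x = y then 1 else 0 := by
  obtain ⟨i, k⟩ := x
  obtain ⟨j, l⟩ := y
  simp only [woldVec]
  rcases lt_trichotomy k l with h | h | h
  · obtain ⟨t, rfl⟩ := Nat.exists_eq_add_of_lt h
    rw [add_assoc, monomialMul_snd_add, inner_monomialMul, ← inner_conj_symm,
      inner_monomialMul_snd_wandering hinv (b i).2 (b j).2.1 (Nat.succ_ne_zero t), map_zero,
      if_neg (by simp)]
  · subst h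
    rw [inner_monomialMul, ← Submodule.coe_inner, orthonormal_iff_ite.1 b.orthonormal]
    simp
  · obtain ⟨t, rfl⟩ := Nat.exists_eq_add_of_lt h
    rw [add_assoc, monomialMul_snd_add, inner_monomialMul,
      inner_monomialMul_snd_wandering hinv (b j).2 (b i).2.1 (Nat.succ_ne_zero t),
      if_neg (by simp)]

/-- Multiplication by `z₂` is isometric, so `z₂ S` is closed and can be projected onto. The
remainder of `f` is wandering, hence orthogonal both to `f` and to the projection, hence zero. -/
theorem exists_mulZ2_of_orthogonal_wandering (hclosed : IsClosed (S : Set HardyBidisk))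
    (hinv : ∀ f ∈ S, mulZ2 f ∈ S) {f : HardyBidisk} (hf : f ∈ S)
    (h : ∀ g ∈ wandering S, inner ℂ g f = 0) : ∃ g ∈ S, f = mulZ2 g := by
  set T : Submodule ℂ HardyBidisk := S.map (mulZ2 : HardyBidisk →ₗ[ℂ] HardyBidisk) with hT
  have hTc : IsClosed (T : Set HardyBidisk) := by
    have := ((coeffExtend succSnd).isometry.isClosedEmbedding.isClosedMap) _ hclosed
    exact this
  have : CompleteSpace T := hTc.completeSpace_coe
  have h1 : f - T.starProjection f ∈ wandering S := by
    refine ⟨S.sub_mem hf ?_, Submodule.sub_starProjection_mem_orthogonal f⟩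
    obtain ⟨g, hg, he⟩ := Submodule.starProjection_apply_mem T f
    rw [← he]
    exact hinv g hg
  have h2 : inner ℂ (f - T.starProjection f) (f - T.starProjection f) = 0 := by
    rw [inner_sub_right, h _ h1, zero_sub, neg_eq_zero, ← inner_conj_symm]
    rw [(Submodule.mem_orthogonal T _).1 h1.2 _ (Submodule.starProjection_apply_mem T f), map_zero]
  rw [inner_self_eq_zero, sub_eq_zero] at h2
  obtain ⟨g, hg, he⟩ := Submodule.starProjection_apply_mem T f
  exact ⟨g, hg, h2.trans he.symm⟩

/-- Shifts have no unitary part: peeling off one factor at a time puts `f` in `z₂ᵏ S` for every `k`,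
which annihilates all coefficients. -/
theorem eq_zero_of_inner_woldVec (hclosed : IsClosed (S : Set HardyBidisk))
    (hinv : ∀ f ∈ S, mulZ2 f ∈ S) (b : OrthonormalBasis (Fin r) ℂ (wandering S))
    {f : HardyBidisk} (hf : f ∈ S) (h : ∀ a, inner ℂ (woldVec b a) f = 0) : f = 0 := by
  have key : ∀ k : ℕ, ∃ g ∈ S, f = monomialMul 0 k g := by
    intro k
    induction k with
    | zero => exact ⟨f, hf, by simp⟩
    | succ k ih =>
      obtain ⟨g, hg, rfl⟩ := ih
      obtain ⟨g', hg', rfl⟩ := exists_mulZ2_of_orthogonal_wandering hclosed hinv hg (by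
        intro w hw
        have : ∀ i, inner ℂ (b i : HardyBidisk) g = 0 := fun i => by
          have := h (i, k)
          rwa [woldVec, inner_monomialMul] at this
        have hw' := congrArg Subtype.val (b.sum_repr ⟨w, hw⟩)
        rw [← show _ = w from hw', Submodule.coe_sum, sum_inner]
        refine Finset.sum_eq_zero fun i _ => ?_
        rw [Submodule.coe_smul, inner_smul_left, this, mul_zero])
      exact ⟨g', hg', (monomialMul_snd_succ k g').symm⟩
  ext ⟨i, j⟩
  obtain ⟨g, -, hg⟩ := key (j + 1)
  have hz : ∀ k j, j < k → monomialMul 0 k g (i, j) = 0 := by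
    intro k
    induction k with
    | zero => intro j h; omega
    | succ k ih =>
      intro j hj
      rw [monomialMul_succ_right]
      cases j with
      | zero => simp
      | succ j => rw [mulZ2_succ]; exact ih j (by omega)
  rw [hg, hz _ _ (Nat.lt_succ_self j)]
  rfl

/-- The Hilbert basis `z₂ᵏ bᵢ` of `S`. -/
def woldBasis (hclosed : IsClosed (S : Set HardyBidisk)) (hinv : ∀ f ∈ S, mulZ2 f ∈ S)
    (b : OrthonormalBasis (Fin r) ℂ (wandering S)) : HilbertBasis (Fin r × ℕ) ℂ S :=
  have : CompleteSpace S := hclosed.completeSpace_coe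
  HilbertBasis.mkOfOrthogonalEqBot (v := fun a => (⟨woldVec b a, woldVec_mem hinv b a⟩ : S))
    (orthonormal_iff_ite.2 fun x y => inner_woldVec hinv b x y) (by
      rw [Submodule.eq_bot_iff]
      intro f hf
      rw [Submodule.mem_orthogonal] at hf
      exact Subtype.ext (eq_zero_of_inner_woldVec hclosed hinv b f.2 fun a =>
        hf _ (Submodule.subset_span ⟨a, rfl⟩)))

theorem woldBasis_apply (hclosed : IsClosed (S : Set HardyBidisk))
    (hinv : ∀ f ∈ S, mulZ2 f ∈ S) (b : OrthonormalBasis (Fin r) ℂ (wandering S))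
    (a : Fin r × ℕ) : (woldBasis hclosed hinv b a : HardyBidisk) = woldVec b a := by
  have : CompleteSpace S := hclosed.completeSpace_coe
  simp [woldBasis, HilbertBasis.coe_mkOfOrthogonalEqBot]

/-- The injection `k ↦ (i, k)`. -/
def prodMkEmb (i : Fin r) : ℕ ↪ Fin r × ℕ := ⟨fun k => (i, k), fun _ _ h => (Prod.mk.inj h).2⟩

theorem coeffExtend_prodMkEmb (i j : Fin r) (f : HardyDisk) (k : ℕ) :
    coeffExtend (prodMkEmb i) f (j, k) = if i = j then f k else 0 := by
  split_ifs with h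
  · subst h; exact coeffExtend_apply (prodMkEmb i) f k
  · refine coeffExtend_apply' _ _ ?_
    rintro ⟨a, ha⟩
    exact h (Prod.mk.inj ha).1

theorem inner_coeffExtend_prodMkEmb (i j : Fin r) (f g : HardyDisk) :
    inner ℂ (coeffExtend (prodMkEmb i) f) (coeffExtend (prodMkEmb j) g) =
      if i = j then inner ℂ f g else 0 := by
  split_ifs with h
  · subst h; exact (coeffExtend (prodMkEmb i)).inner_map_map f g
  · rw [lp.inner_eq_tsum]
    refine (tsum_congr fun a => ?_).trans tsum_zero
    obtain ⟨l, k⟩ := a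
    rw [coeffExtend_prodMkEmb, coeffExtend_prodMkEmb]
    split_ifs with h1 h2
    · exact absurd (h1.trans h2.symm) h
    all_goals simp

/-- The coefficient isometry `H²(𝔻)^r ≃ ℓ²(r × ℕ)`. -/
def vecCoeff (r : ℕ) : HardyDiskVec r ≃ₗᵢ[ℂ] lp (fun _ : Fin r × ℕ => ℂ) 2 :=
  LinearIsometryEquiv.ofSurjective
    (LinearMap.isometryOfInner
      (∑ i, (coeffExtend (prodMkEmb i)).toLinearMap ∘ₗ
        (PiLp.proj 2 (fun _ : Fin r => HardyDisk) i : HardyDiskVec r →L[ℂ] HardyDisk).toLinearMap)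
      (fun f g => by
        simp only [LinearMap.sum_apply, LinearMap.comp_apply, sum_inner, inner_sum]
        rw [PiLp.inner_apply]
        refine Finset.sum_congr rfl fun i _ => ?_
        rw [Finset.sum_eq_single i]
        · exact (inner_coeffExtend_prodMkEmb i i _ _).trans (if_pos rfl)
        · intro j _ hj
          first
          | exact (inner_coeffExtend_prodMkEmb i j _ _).trans (if_neg (Ne.symm hj))
          | exact (inner_coeffExtend_prodMkEmb j i _ _).trans (if_neg hj)
        · intro h; exact absurd (Finset.mem_univ i) h))
    (fun x => by
      have hmem : ∀ i : Fin r, Memℓp (fun k : ℕ => x (i, k)) 2 := fun i => by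
        refine memℓp_gen ?_
        exact ((lp.memℓp x).summable (by norm_num)).comp_injective (prodMkEmb i).injective
      refine ⟨WithLp.toLp 2 fun i => (⟨fun k => x (i, k), hmem i⟩ : HardyDisk), ?_⟩
      ext ⟨j, k⟩
      simp only [LinearMap.coe_isometryOfInner, LinearMap.sum_apply, LinearMap.comp_apply]
      rw [lp.coeFn_sum, Finset.sum_apply, Finset.sum_eq_single j]
      · exact (coeffExtend_prodMkEmb j j _ k).trans (if_pos rfl)
      · intro i _ hi
        exact (coeffExtend_prodMkEmb i j _ k).trans (if_neg hi)
      · intro h; exact absurd (Finset.mem_univ j) h)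

theorem vecCoeff_apply (f : HardyDiskVec r) (a : Fin r × ℕ) : vecCoeff r f a = f a.1 a.2 := by
  obtain ⟨j, k⟩ := a
  change (∑ i, (coeffExtend (prodMkEmb i)).toLinearMap ∘ₗ
        (PiLp.proj 2 (fun _ : Fin r => HardyDisk) i : HardyDiskVec r →L[ℂ] HardyDisk).toLinearMap :
        HardyDiskVec r →ₗ[ℂ] lp (fun _ : Fin r × ℕ => ℂ) 2) f (j, k) = _
  simp only [LinearMap.sum_apply, LinearMap.comp_apply]
  rw [lp.coeFn_sum, Finset.sum_apply, Finset.sum_eq_single j]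
  · exact (coeffExtend_prodMkEmb j j _ k).trans (if_pos rfl)
  · intro i _ hi
    exact (coeffExtend_prodMkEmb i j _ k).trans (if_neg hi)
  · intro h; exact absurd (Finset.mem_univ j) h

/-- The unitary operator `(f₁, …, f_r) ↦ ∑ bᵢ(z₁, z₂) fᵢ(z₂)` onto `S`. -/
def woldEquiv (hclosed : IsClosed (S : Set HardyBidisk)) (hinv : ∀ f ∈ S, mulZ2 f ∈ S)
    (b : OrthonormalBasis (Fin r) ℂ (wandering S)) : HardyDiskVec r ≃ₗᵢ[ℂ] S :=
  (vecCoeff r).trans (woldBasis hclosed hinv b).repr.symm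

variable (hclosed : IsClosed (S : Set HardyBidisk)) (hinv : ∀ f ∈ S, mulZ2 f ∈ S)
  (b : OrthonormalBasis (Fin r) ℂ (wandering S))

/-- A general functional `φ` serves both point evaluations and coefficient functionals. -/
theorem hasSum_woldEquiv (φ : HardyBidisk →L[ℂ] ℂ) (f : HardyDiskVec r) :
    HasSum (fun a : Fin r × ℕ => f a.1 a.2 * φ (woldVec b a))
      (φ (woldEquiv hclosed hinv b f)) := by
  have h := (woldBasis hclosed hinv b).hasSum_repr_symm (vecCoeff r f)
  have h2 := h.mapL (φ ∘L S.subtypeL)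
  convert h2 using 1
  · ext a
    simp only [vecCoeff_apply, map_smul, ContinuousLinearMap.comp_apply,
      Submodule.subtypeL_apply, woldBasis_apply, smul_eq_mul]
  · rfl

theorem bidiskEval_woldEquiv (f : HardyDiskVec r) {z : ℂ × ℂ} (hz : z ∈ bidisk) :
    bidiskEval (woldEquiv hclosed hinv b f : HardyBidisk) z =
      ∑ i, bidiskEval (b i : HardyBidisk) z * diskEval (f i) z.2 := by
  have h := hasSum_woldEquiv hclosed hinv b (evalAt z hz) f
  rw [← evalAt_apply z hz, ← h.tsum_eq, h.summable.tsum_prod, tsum_fintype]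
  refine Finset.sum_congr rfl fun i _ => ?_
  rw [diskEval, ← tsum_mul_left]
  refine tsum_congr fun k => ?_
  rw [woldVec, evalAt_apply, bidiskEval_monomialMul]
  ring

/-- The formal power series of an element of `H²(𝔻)`. -/
def diskSeries (f : HardyDisk) : PowerSeries ℂ := PowerSeries.mk f

theorem monomialMul_snd_apply (k : ℕ) (f : HardyBidisk) (i j : ℕ) :
    monomialMul 0 k f (i, j) = if k ≤ j then f (i, j - k) else 0 := by
  split_ifs with h
  · have := monomialMul_apply_add 0 k i (j - k) f
    rwa [zero_add, Nat.add_sub_cancel' h] at this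
  · induction k generalizing j with
    | zero => omega
    | succ k ih =>
      rw [monomialMul_succ_right]
      cases j with
      | zero => simp
      | succ j => rw [mulZ2_succ]; exact ih j (by omega)

theorem toSeries_woldEquiv (f : HardyDiskVec r) :
    toSeries (woldEquiv hclosed hinv b f : HardyBidisk) =
      ∑ i, toSeries (b i : HardyBidisk) * PowerSeries.C (diskSeries (f i)) := by
  ext a l
  have h := hasSum_woldEquiv hclosed hinv b (innerSL ℂ (monomialVec (a, l))) f
  simp only [innerSL_apply_apply, inner_monomialVec] at h
  rw [coeff_toSeries, ← h.tsum_eq, h.summable.tsum_prod, tsum_fintype, map_sum, map_sum]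
  refine Finset.sum_congr rfl fun i _ => ?_
  rw [PowerSeries.coeff_mul_C, mul_comm, PowerSeries.coeff_mul,
    Finset.Nat.sum_antidiagonal_eq_sum_range_succ_mk, tsum_eq_sum (s := Finset.range (l + 1))]
  · refine Finset.sum_congr rfl fun k hk => ?_
    have : k ≤ l := by simpa [Nat.lt_succ_iff] using hk
    rw [woldVec, monomialMul_snd_apply, if_pos this]
    simp [diskSeries]
  · intro k hk
    have : ¬ k ≤ l := by simpa [Nat.lt_succ_iff] using hk
    rw [woldVec, monomialMul_snd_apply, if_neg this, mul_zero]

/-- A polynomial as an element of `H²(𝔻)`. -/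
def polyDisk (P : Polynomial ℂ) : HardyDisk :=
  ⟨fun k => P.coeff k, memℓp_gen (summable_of_hasFiniteSupport (P.support.finite_toSet.subset
    fun k hk => by
      simp only [Function.mem_support] at hk
      simp only [Finset.mem_coe, Polynomial.mem_support_iff]
      intro h
      rw [h] at hk
      simp at hk))⟩

theorem diskSeries_polyDisk (P : Polynomial ℂ) : diskSeries (polyDisk P) = P := by
  ext k
  simp [diskSeries, polyDisk]

end Wold

/-! ### The dimension of the wandering subspace -/

/-- Padding with zero columns gives a singular square matrix, so a dimension count works over a
domain. -/
theorem exists_vecMul_eq_zero_of_lt {R : Type*} [CommRing R] [IsDomain R] {M N : ℕ} (h : M < N)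
    (A : Matrix (Fin N) (Fin M) R) : ∃ v ≠ 0, Matrix.vecMul v A = 0 := by
  let B : Matrix (Fin N) (Fin N) R := Matrix.of fun i j =>
    if h : (j : ℕ) < M then A i ⟨j, h⟩ else 0
  have hB : B.det = 0 := Matrix.det_eq_zero_of_column_eq_zero ⟨M, h⟩ fun i => by simp [B]
  obtain ⟨v, hv0, hv⟩ := Matrix.exists_vecMul_eq_zero_iff.2 hB
  refine ⟨v, hv0, ?_⟩
  ext j
  have := congrFun hv ⟨j, j.2.trans h⟩
  simpa [Matrix.vecMul, dotProduct, B] using this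

section Dimension

variable {m n : ℕ} {p : MvPolynomial (Fin 2) ℂ} {S₁ S₂ : Submodule ℂ HardyBidisk}

theorem eq_zero_of_mulPoly_coeff (hp : p ≠ 0) {f : HardyBidisk} (h : ∀ i j, mulPoly p f (i, j) = 0) :
    f = 0 := by
  refine mulPoly_left_cancel hp ?_
  rw [map_zero]
  ext ⟨i, j⟩
  exact h i j

/-- Multiplication by `p` is injective, so finitely many coefficients of `p f` determine `f`. -/
theorem finiteDimensional_of_coeff (hp : p ≠ 0) (T : Submodule ℂ HardyBidisk) (M N : ℕ)
    (h : ∀ f ∈ T, ∀ i j, ¬ (i < M ∧ j < N) → mulPoly p f (i, j) = 0) : FiniteDimensional ℂ T := by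
  let L : T →ₗ[ℂ] (Fin M × Fin N → ℂ) :=
    { toFun := fun f a => mulPoly p f (a.1, a.2)
      map_add' := fun f g => by ext; simp
      map_smul' := fun c f => by ext; simp }
  refine Module.Finite.of_injective L ?_
  rw [injective_iff_map_eq_zero]
  intro f hf
  refine Subtype.ext (eq_zero_of_mulPoly_coeff hp fun i j => ?_)
  by_cases hij : i < M ∧ j < N
  · exact congrFun hf (⟨i, hij.1⟩, ⟨j, hij.2⟩)
  · exact h f f.2 i j hij

theorem IsShiftDecomposition.mulPoly_wandering_eq_zero (hp : IsRationalInner m n p)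
    (hS : IsShiftDecomposition (modelSpace (theta m n p)) S₁ S₂) {f : HardyBidisk}
    (hf : f ∈ wandering S₂) (i j : ℕ) (hij : ¬ (i < m ∧ j < n + 1)) :
    mulPoly p f (i, j) = 0 := by
  by_cases hi : i < m
  · have hj : n + 1 ≤ j := by
      by_contra h
      exact hij ⟨hi, by omega⟩
    have := hS.coeff_wandering_eq_zero hp hf i (j - (n + 1))
    rwa [show n + (j - (n + 1)) + 1 = j by omega] at this
  · have := hS.le_maxSnd hp hf.1 (i - m) j
    rwa [Nat.add_sub_cancel' (not_lt.1 hi)] at this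

theorem IsShiftDecomposition.finiteDimensional_wandering (hp : IsRationalInner m n p)
    (hS : IsShiftDecomposition (modelSpace (theta m n p)) S₁ S₂) :
    FiniteDimensional ℂ (wandering S₂) :=
  finiteDimensional_of_coeff hp.polynomial_ne_zero _ m (n + 1) fun _ hf =>
    hS.mulPoly_wandering_eq_zero hp hf

/-- The coefficient of `z₁ᵏ` in `p f`, as a polynomial in `z₂`. -/
def rowPoly (p : MvPolynomial (Fin 2) ℂ) (n : ℕ) (f : HardyBidisk) (k : ℕ) : Polynomial ℂ :=
  PowerSeries.trunc (n + 1) (PowerSeries.coeff k (toSeries (mulPoly p f)))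

/-- On the wandering subspace the truncation at `n + 1` loses nothing, since `p f` has `z₂`-degree
at most `n`. -/
theorem IsShiftDecomposition.coe_rowPoly (hp : IsRationalInner m n p)
    (hS : IsShiftDecomposition (modelSpace (theta m n p)) S₁ S₂) {f : HardyBidisk}
    (hf : f ∈ wandering S₂) (k : ℕ) :
    (rowPoly p n f k : PowerSeries ℂ) = PowerSeries.coeff k (toSeries (mulPoly p f)) := by
  ext j
  rw [Polynomial.coeff_coe, rowPoly, PowerSeries.coeff_trunc]
  split_ifs with h
  · rfl
  · rw [coeff_toSeries, hS.mulPoly_wandering_eq_zero hp hf k j (fun h' => h h'.2)]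

theorem IsShiftDecomposition.rowPoly_eq_zero (hp : IsRationalInner m n p)
    (hS : IsShiftDecomposition (modelSpace (theta m n p)) S₁ S₂) {f : HardyBidisk}
    (hf : f ∈ wandering S₂) {k : ℕ} (hk : m ≤ k) : rowPoly p n f k = 0 := by
  ext j
  rw [rowPoly, PowerSeries.coeff_trunc]
  split_ifs with h
  · rw [coeff_toSeries, hS.mulPoly_wandering_eq_zero hp hf k j (fun h' => by omega)]
    simp
  · simp

variable {r : ℕ}

theorem IsShiftDecomposition.coeff_mulPoly_woldEquiv (hp : IsRationalInner m n p)
    (hS : IsShiftDecomposition (modelSpace (theta m n p)) S₁ S₂)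
    (b : OrthonormalBasis (Fin r) ℂ (wandering S₂)) (f : HardyDiskVec r) (k : ℕ) :
    PowerSeries.coeff k
      (toSeries (mulPoly p (woldEquiv hS.closed_snd hS.invariant_snd b f : HardyBidisk))) =
      ∑ i, (rowPoly p n (b i) k : PowerSeries ℂ) * diskSeries (f i) := by
  rw [toSeries_mulPoly, toSeries_woldEquiv, Finset.mul_sum, map_sum]
  refine Finset.sum_congr rfl fun i _ => ?_
  rw [← mul_assoc, PowerSeries.coeff_mul_C, ← toSeries_mulPoly, hS.coe_rowPoly hp (b i).2]

/-- The matrix of coefficients of the polynomials `p bᵢ`. -/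
def rowMatrix (p : MvPolynomial (Fin 2) ℂ) (m n : ℕ)
    (b : OrthonormalBasis (Fin r) ℂ (wandering S₂)) : Matrix (Fin r) (Fin m) (Polynomial ℂ) :=
  Matrix.of fun i k => rowPoly p n (b i) k

/-- A polynomial relation between the rows says `p ∑ vᵢ(z₂) bᵢ = 0`; injectivity of the Wold unitary
then gives `v = 0`. -/
theorem IsShiftDecomposition.eq_zero_of_vecMul_rowMatrix (hp : IsRationalInner m n p)
    (hS : IsShiftDecomposition (modelSpace (theta m n p)) S₁ S₂)
    (b : OrthonormalBasis (Fin r) ℂ (wandering S₂)) {v : Fin r → Polynomial ℂ}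
    (hv : Matrix.vecMul v (rowMatrix p m n b) = 0) : v = 0 := by
  have h0 : (woldEquiv hS.closed_snd hS.invariant_snd b
      (WithLp.toLp 2 fun i => polyDisk (v i)) : HardyBidisk) = 0 := by
    refine mulPoly_left_cancel hp.polynomial_ne_zero (toSeries_injective ?_)
    rw [map_zero, map_zero]
    ext1 k
    rw [hS.coeff_mulPoly_woldEquiv hp]
    simp only [diskSeries_polyDisk, ← Polynomial.coe_mul, map_zero]
    by_cases hk : k < m
    · have := congrFun hv ⟨k, hk⟩
      simp only [Matrix.vecMul, dotProduct, rowMatrix, Matrix.of_apply, Pi.zero_apply] at this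
      have h2 := congrArg (Polynomial.coeToPowerSeries.ringHom (R := ℂ)) this
      rw [map_sum, map_zero] at h2
      rw [← h2]
      refine Finset.sum_congr rfl fun i _ => ?_
      rw [mul_comm]
      rfl
    · refine Finset.sum_eq_zero fun i _ => ?_
      rw [hS.rowPoly_eq_zero hp (b i).2 (not_lt.1 hk), zero_mul, Polynomial.coe_zero]
  have h1 : (WithLp.toLp 2 fun i => polyDisk (v i) : HardyDiskVec r) = 0 := by
    apply (woldEquiv hS.closed_snd hS.invariant_snd b).injective
    rw [map_zero]
    exact Subtype.ext h0
  ext1 i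
  have h2 : polyDisk (v i) = 0 := congrArg (fun f : HardyDiskVec r => f i) h1
  have h3 := diskSeries_polyDisk (v i)
  rw [h2] at h3
  ext k
  have h4 := congrArg (PowerSeries.coeff k) h3
  rw [diskSeries, PowerSeries.coeff_mk, Polynomial.coeff_coe] at h4
  exact h4.symm

theorem IsShiftDecomposition.card_le (hp : IsRationalInner m n p)
    (hS : IsShiftDecomposition (modelSpace (theta m n p)) S₁ S₂)
    (b : OrthonormalBasis (Fin r) ℂ (wandering S₂)) : r ≤ m := by
  by_contra h
  obtain ⟨v, hv0, hv⟩ := exists_vecMul_eq_zero_of_lt (not_le.1 h) (rowMatrix p m n b)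
  exact hv0 (hS.eq_zero_of_vecMul_rowMatrix hp b hv)

/-! #### The lower bound -/

theorem toSeries_aeval_mulZ2 (P : Polynomial ℂ) (f : HardyBidisk) :
    toSeries (Polynomial.aeval mulZ2 P f) =
      PowerSeries.C (P : PowerSeries ℂ) * toSeries f := by
  induction P using Polynomial.induction_on' with
  | add P Q hP hQ =>
    rw [map_add, add_apply, map_add, hP, hQ, Polynomial.coe_add, map_add,
      add_mul]
  | monomial k c =>
    have h1 : (Polynomial.aeval mulZ2 (Polynomial.monomial k c) : HardyBidisk →L[ℂ] HardyBidisk) f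
        = c • monomialMul 0 k f := by
      simp [Polynomial.aeval_monomial, monomialMul, Algebra.algebraMap_eq_smul_one]
    have h2 : PowerSeries.monomial k c = PowerSeries.C c * PowerSeries.X ^ k := by
      ext j
      simp [PowerSeries.coeff_monomial, PowerSeries.coeff_X_pow]
    rw [h1, map_smul, toSeries_monomialMul, Polynomial.coe_monomial, h2, map_mul, map_pow, pow_zero, one_mul,
      ← algebraMap_series, Algebra.smul_def, mul_assoc]

theorem polySeries_eq_C {D : MvPolynomial (Fin 2) ℂ} (hD : D.degreeOf 0 = 0) :
    ∃ δ : PowerSeries ℂ, polySeries D = PowerSeries.C δ := by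
  refine ⟨∑ d ∈ D.support, D.coeff d • PowerSeries.X ^ d 1, ?_⟩
  rw [polySeries_eq_sum, map_sum]
  refine Finset.sum_congr rfl fun d hd => ?_
  have h0 : d 0 = 0 := Nat.le_zero.1 ((MvPolynomial.degreeOf_le_iff.1 hD.le) d hd)
  rw [h0, pow_zero, one_mul, Algebra.smul_def, Algebra.smul_def, map_mul, map_pow,
    algebraMap_series]
  rfl

theorem toSeries_monomialVec_zero : toSeries (monomialVec (0, 0)) = 1 := by
  ext i j
  rw [coeff_toSeries, monomialVec_apply]
  by_cases hi : i = 0 <;> by_cases hj : j = 0 <;>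
    simp [hi, hj, PowerSeries.coeff_one]

/-- The witness is `z₁ᵏ (a + c Θ)`, with `a` and `c` from the elimination: `p` times it is `z₁ᵏ (p a
+ p̃ c)`, the resultant times `z₁ᵏ`. -/
theorem exists_mem_maxSnd (hp : IsRationalInner m n p) : ∃ δ : PowerSeries ℂ, δ ≠ 0 ∧
    ∀ k < m, ∃ e ∈ maxSnd m p, toSeries (mulPoly p e) = PowerSeries.X ^ k * PowerSeries.C δ := by
  rcases Nat.eq_zero_or_pos m with rfl | hm
  · exact ⟨1, one_ne_zero, fun k hk => by omega⟩
  obtain ⟨a, c, D, hD0, hD, hac⟩ := exists_elimination hp hm.ne'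
  obtain ⟨δ, hδ⟩ := polySeries_eq_C hD
  refine ⟨δ, ?_, fun k hk => ?_⟩
  · rintro rfl
    rw [map_zero] at hδ
    exact hD0 (polySeries_injective (hδ.trans (map_zero _).symm))
  obtain ⟨θ, -, hθ⟩ := exists_theta_mul hp (monomialVec (0, 0))
  have key : toSeries (mulPoly p
      (monomialMul k 0 (mulPoly a (monomialVec (0, 0)) + mulPoly c θ))) =
      PowerSeries.X ^ k * PowerSeries.C δ := by
    rw [mulPoly_monomialMul, toSeries_monomialMul, map_add, mulPoly_comm p c, hθ, map_add,
      ← mulPoly_mul, ← mulPoly_mul, ← map_add, ← mulPoly_add, mul_comm c, hac, toSeries_mulPoly,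
      hδ, toSeries_monomialVec_zero]
    simp
  refine ⟨_, fun i j => ?_, key⟩
  rw [← coeff_toSeries, key, PowerSeries.coeff_mul_C, PowerSeries.coeff_X_pow,
    if_neg (by omega), zero_mul, map_zero]

/-- If `r < m`, some nonzero `v` in `ℂ[z₂]^m` annihilates the `z₁`-coefficients of every `p bᵢ`,
hence of `p f` for every `f ∈ S₂`. But `S₂` contains, for each `k`, a function with `p f = z₁ᵏ P(z₂)
δ(z₂)`, which forces `v k = 0`. -/
theorem IsShiftDecomposition.le_card (hp : IsRationalInner m n p) [S₂.HasOrthogonalProjection]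
    (hS : IsShiftDecomposition (modelSpace (theta m n p)) S₁ S₂)
    (b : OrthonormalBasis (Fin r) ℂ (wandering S₂)) : m ≤ r := by
  by_contra hlt
  obtain ⟨v, hv0, hv⟩ := exists_vecMul_eq_zero_of_lt (not_le.1 hlt) (rowMatrix p m n b).transpose
  obtain ⟨δ, hδ0, hδ⟩ := exists_mem_maxSnd hp
  -- Here `p f` has degree below `m` in `z₁` and below `n` in `z₂`.
  have : FiniteDimensional ℂ (S₁ ⊓ maxSnd m p : Submodule ℂ HardyBidisk) := by
    refine finiteDimensional_of_coeff hp.polynomial_ne_zero _ m n fun f hf i j hij => ?_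
    by_cases hi : i < m
    · have hj : n ≤ j := by
        by_contra h
        exact hij ⟨hi, by omega⟩
      have := hS.coeff_fst_eq_zero hp hf.1 i (j - n)
      rwa [Nat.add_sub_cancel' hj] at this
    · have := hf.2 (i - m) j
      rwa [Nat.add_sub_cancel' (not_lt.1 hi)] at this
  apply hv0
  ext1 k
  obtain ⟨e, he, hes⟩ := hδ k k.2
  have hPe : ∀ P : Polynomial ℂ, Polynomial.aeval mulZ2 P e ∈ maxSnd m p := by
    intro P
    induction P using Polynomial.induction_on' with
    | add P Q hP hQ =>
      rw [map_add, add_apply]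
      exact Submodule.add_mem _ hP hQ
    | monomial k c =>
      have h1 : (Polynomial.aeval mulZ2 (Polynomial.monomial k c) :
          HardyBidisk →L[ℂ] HardyBidisk) e = c • monomialMul 0 k e := by
        simp [Polynomial.aeval_monomial, monomialMul, Algebra.algebraMap_eq_smul_one]
      rw [h1]
      exact Submodule.smul_mem _ _ (monomialMul_snd_mem (fun _ => mulZ2_mem_maxSnd) he k)
  have hproj : ∀ f ∈ maxSnd m p, f - S₂.starProjection f ∈ S₁ ⊓ maxSnd m p := by
    intro f hf
    have h1 : f - S₂.starProjection f ∈ maxSnd m p :=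
      Submodule.sub_mem _ hf (hS.le_maxSnd hp (Submodule.starProjection_apply_mem S₂ f))
    exact ⟨hS.mem_fst_of_orthogonal (maxSnd_le hp h1)
      ((Submodule.mem_orthogonal _ _).1 (Submodule.sub_starProjection_mem_orthogonal f)), h1⟩
  let L : Polynomial ℂ →ₗ[ℂ] (S₁ ⊓ maxSnd m p : Submodule ℂ HardyBidisk) :=
    { toFun := fun P => ⟨_, hproj _ (hPe P)⟩
      map_add' := fun P Q => Subtype.ext (by
        simp only [map_add, add_apply, Submodule.coe_add]
        abel)
      map_smul' := fun c P => Subtype.ext (by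
        simp [smul_sub]) }
  -- The `S₁`-component of `P(z₂) e` ranges over a finite-dimensional space while `P` ranges over an
  -- infinite-dimensional one, so it vanishes for some `P ≠ 0`.
  obtain ⟨P, hP0, hP⟩ : ∃ P : Polynomial ℂ, P ≠ 0 ∧ L P = 0 := by
    by_contra hcon
    push Not at hcon
    have hinj : Function.Injective L := by
      rw [injective_iff_map_eq_zero]
      intro P hP
      by_contra h0
      exact hcon P h0 hP
    exact Polynomial.not_finite (R := ℂ) (Module.Finite.of_injective L hinj)
  have hPmem : Polynomial.aeval mulZ2 P e ∈ S₂ := by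
    have h1 : Polynomial.aeval mulZ2 P e - S₂.starProjection (Polynomial.aeval mulZ2 P e) = 0 :=
      congrArg Subtype.val hP
    rw [sub_eq_zero] at h1
    rw [h1]
    exact Submodule.starProjection_apply_mem _ _
  obtain ⟨g, hg⟩ := (woldEquiv hS.closed_snd hS.invariant_snd b).surjective ⟨_, hPmem⟩
  have hrow : ∀ l : ℕ, ∑ i, (rowPoly p n (b i) l : PowerSeries ℂ) * diskSeries (g i) =
      if l = k then (P : PowerSeries ℂ) * δ else 0 := by
    intro l
    rw [← hS.coeff_mulPoly_woldEquiv hp, hg, toSeries_mulPoly, toSeries_aeval_mulZ2,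
      mul_left_comm, ← toSeries_mulPoly, hes, PowerSeries.coeff_C_mul, PowerSeries.coeff_mul_C,
      PowerSeries.coeff_X_pow]
    split_ifs <;> simp
  have hfinal : (v k : PowerSeries ℂ) * ((P : PowerSeries ℂ) * δ) = 0 := by
    have h1 : ∑ l : Fin m, (v l : PowerSeries ℂ) *
        ∑ i, (rowPoly p n (b i) l : PowerSeries ℂ) * diskSeries (g i) = 0 := by
      simp only [Finset.mul_sum]
      rw [Finset.sum_comm]
      refine Finset.sum_eq_zero fun i _ => ?_
      have h2 := congrArg (Polynomial.coeToPowerSeries.ringHom (R := ℂ)) (congrFun hv i)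
      simp only [Matrix.vecMul, dotProduct, rowMatrix, Matrix.transpose_apply, Matrix.of_apply,
        Pi.zero_apply, map_sum, map_zero, map_mul,
        Polynomial.coeToPowerSeries.ringHom_apply] at h2
      simp only [← mul_assoc]
      rw [← Finset.sum_mul, h2, zero_mul]
    rw [← h1, Finset.sum_eq_single k]
    · rw [hrow, if_pos rfl]
    · intro l _ hl
      rw [hrow, if_neg (fun h => hl (Fin.ext h)), mul_zero]
    · intro h; exact absurd (Finset.mem_univ k) h
  have hP' : (P : PowerSeries ℂ) ≠ 0 := by simpa using hP0
  have := (mul_eq_zero.1 hfinal).resolve_right (mul_ne_zero hP' hδ0)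
  simpa using this

theorem IsShiftDecomposition.nonempty_orthonormalBasis (hp : IsRationalInner m n p)
    [S₂.HasOrthogonalProjection]
    (hS : IsShiftDecomposition (modelSpace (theta m n p)) S₁ S₂) :
    Nonempty (OrthonormalBasis (Fin m) ℂ (wandering S₂)) := by
  have := hS.finiteDimensional_wandering hp
  have b := stdOrthonormalBasis ℂ (wandering S₂)
  exact ⟨b.reindex (finCongr (le_antisymm (hS.card_le hp b) (hS.le_card hp b)))⟩

end Dimension

/-! ### Reproducing kernels of the disk -/

/-- The Szegő kernel `∑ conj λᵏ zᵏ` at a point of the disk. -/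
def szego (z : ℂ) (hz : ‖z‖ < 1) : HardyDisk :=
  ⟨fun k => conj z ^ k, memℓp_gen (by
    have : ∀ k : ℕ, ‖conj z ^ k‖ ^ (2 : ℝ≥0∞).toReal = (‖z‖ ^ 2) ^ k := fun k => by
      simp [← pow_mul, mul_comm]
    simp only [this]
    exact summable_geometric_of_lt_one (by positivity) (by nlinarith [norm_nonneg z]))⟩

theorem szego_apply (z : ℂ) (hz : ‖z‖ < 1) (k : ℕ) : szego z hz k = conj z ^ k := rfl

theorem inner_szego (z : ℂ) (hz : ‖z‖ < 1) (f : HardyDisk) :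
    inner ℂ (szego z hz) f = diskEval f z := by
  rw [lp.inner_eq_tsum, diskEval]
  refine tsum_congr fun k => ?_
  simp [szego_apply]

theorem hasSum_diskEval {z : ℂ} (hz : ‖z‖ < 1) (f : HardyDisk) :
    HasSum (fun k => f k * z ^ k) (diskEval f z) := by
  rw [← inner_szego z hz]
  have h : (fun k => f k * z ^ k) = fun k => inner ℂ (szego z hz k) (f k) := by
    ext k
    simp [szego_apply]
  rw [h]
  exact lp.hasSum_inner (szego z hz) f

theorem norm_szego_sq (z : ℂ) (hz : ‖z‖ < 1) : ‖szego z hz‖ ^ 2 = (1 - ‖z‖ ^ 2)⁻¹ := by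
  have h : inner ℂ (szego z hz) (szego z hz) = (((1 - ‖z‖ ^ 2)⁻¹ : ℝ) : ℂ) := by
    rw [inner_szego, diskEval]
    have : ∀ k : ℕ, szego z hz k * z ^ k = (((‖z‖ ^ 2) ^ k : ℝ) : ℂ) := fun k => by
      rw [szego_apply, ← mul_pow, Complex.conj_mul']
      push_cast
      rfl
    simp only [this]
    rw [← Complex.ofReal_tsum, tsum_geometric_of_lt_one (by positivity)
      (by nlinarith [norm_nonneg z])]
  rw [← inner_self_eq_norm_sq (𝕜 := ℂ), h]
  exact Complex.ofReal_re _

theorem norm_diskEval_sq_le {z : ℂ} (hz : ‖z‖ < 1) (f : HardyDisk) :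
    ‖diskEval f z‖ ^ 2 ≤ ‖f‖ ^ 2 * (1 - ‖z‖ ^ 2)⁻¹ := by
  rw [← inner_szego z hz, ← norm_szego_sq z hz, ← mul_pow, mul_comm ‖f‖]
  exact pow_le_pow_left₀ (norm_nonneg _) (norm_inner_le_norm _ _) 2

/-! ### Rational functions in the Hardy space -/

theorem diskEval_mul_of_series {f g : HardyDisk} {B : Polynomial ℂ}
    (h : (B : PowerSeries ℂ) * diskSeries f = diskSeries g) {z : ℂ} (hz : ‖z‖ < 1) :
    B.eval z * diskEval f z = diskEval g z := by
  have h1 : Summable fun k => ‖B.coeff k * z ^ k‖ :=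
    summable_of_hasFiniteSupport (B.support.finite_toSet.subset fun k hk => by
      simp only [Function.mem_support] at hk
      simp only [Finset.mem_coe, Polynomial.mem_support_iff]
      intro h
      rw [h] at hk
      simp at hk)
  have h2 : Summable fun k => ‖f k * z ^ k‖ := (hasSum_diskEval hz f).summable.norm
  have h3 : B.eval z = ∑' k, B.coeff k * z ^ k := by
    rw [Polynomial.eval_eq_sum, Polynomial.sum, tsum_eq_sum]
    intro k hk
    rw [Polynomial.notMem_support_iff.1 hk, zero_mul]
  rw [h3, diskEval, tsum_mul_tsum_eq_tsum_sum_antidiagonal_of_summable_norm h1 h2, diskEval]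
  refine tsum_congr fun k => ?_
  have h4 := congrArg (PowerSeries.coeff k) h
  rw [PowerSeries.coeff_mul] at h4
  simp only [diskSeries, PowerSeries.coeff_mk, Polynomial.coeff_coe] at h4
  rw [← h4, Finset.sum_mul]
  refine Finset.sum_congr rfl fun x hx => ?_
  rw [← Finset.HasAntidiagonal.mem_antidiagonal.1 hx, pow_add]
  ring

theorem diskEval_polyDisk (P : Polynomial ℂ) (z : ℂ) : diskEval (polyDisk P) z = P.eval z := by
  rw [Polynomial.eval_eq_sum, Polynomial.sum, diskEval, tsum_eq_sum]
  · rfl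
  · intro k hk
    change P.coeff k * z ^ k = 0
    rw [Polynomial.notMem_support_iff.1 hk, zero_mul]

/-- A rational function in `H²(𝔻)` has no poles in the closed disk. -/
theorem exists_rational_without_poles {f : HardyDisk} {A B : Polynomial ℂ} (hB : B ≠ 0)
    (h : (B : PowerSeries ℂ) * diskSeries f = A) :
    ∃ A' B' : Polynomial ℂ, (∀ z, ‖z‖ ≤ 1 → B'.eval z ≠ 0) ∧
      ∀ z, ‖z‖ < 1 → B'.eval z * diskEval f z = A'.eval z := by
  obtain ⟨A', hA'⟩ := EuclideanDomain.gcd_dvd_left A B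
  obtain ⟨B', hB'⟩ := EuclideanDomain.gcd_dvd_right A B
  set d := EuclideanDomain.gcd A B with hd
  have hd0 : d ≠ 0 := by
    intro h0
    rw [h0, zero_mul] at hB'
    exact hB hB'
  have hcop : IsCoprime A' B' := by
    have := EuclideanDomain.gcd_eq_gcd_ab A B
    rw [← hd] at this
    refine ⟨EuclideanDomain.gcdA A B, EuclideanDomain.gcdB A B, mul_left_cancel₀ hd0 ?_⟩
    calc d * (EuclideanDomain.gcdA A B * A' + EuclideanDomain.gcdB A B * B')
        = d * A' * EuclideanDomain.gcdA A B + d * B' * EuclideanDomain.gcdB A B := by ring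
      _ = A * EuclideanDomain.gcdA A B + B * EuclideanDomain.gcdB A B := by rw [← hA', ← hB']
      _ = d * 1 := by rw [mul_one]; exact this.symm
  have heval : ∀ z, ‖z‖ < 1 → B'.eval z * diskEval f z = A'.eval z := by
    intro z hz
    rw [← diskEval_polyDisk A']
    refine diskEval_mul_of_series ?_ hz
    rw [diskSeries_polyDisk]
    have hd' : (d : PowerSeries ℂ) ≠ 0 := by simpa using hd0
    apply mul_left_cancel₀ hd'
    rw [← mul_assoc, ← Polynomial.coe_mul, ← Polynomial.coe_mul, ← hA', ← hB', h]
  have hroot : ∀ z, B'.eval z = 0 → A'.eval z ≠ 0 := by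
    intro z hz h0
    obtain ⟨a, c, hac⟩ := hcop
    have := congrArg (Polynomial.eval z) hac
    simp [hz, h0] at this
  refine ⟨A', B', fun w hw hw0 => ?_, heval⟩
  -- A zero of `B'` inside the disk is at once a zero of `A' = B' f`, contradicting coprimality; on
  -- the circle the growth of `f` has to be controlled.
  rcases hw.lt_or_eq with hlt | heq
  · refine hroot w hw0 ?_
    rw [← heval w hlt, hw0, zero_mul]
  obtain ⟨B₁, hB₁⟩ := Polynomial.dvd_iff_isRoot.2 hw0
  obtain ⟨C, hC⟩ := (isCompact_closedBall (0 : ℂ) 1).exists_bound_of_continuousOn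
    (f := fun z => B₁.eval z) B₁.continuous.continuousOn
  have hC0 : 0 ≤ C := (norm_nonneg _).trans (hC 0 (by simp))
  have hbound : ∀ r : ℝ, 0 ≤ r → r < 1 → ‖A'.eval ((r : ℂ) * w)‖ ^ 2 ≤
      (C * ‖f‖) ^ 2 * (1 - r) := by
    intro r hr0 hr1
    have hn : ‖(r : ℂ) * w‖ = r := by
      rw [norm_mul, heq, mul_one, Complex.norm_real, Real.norm_of_nonneg hr0]
    have hz : ‖(r : ℂ) * w‖ < 1 := by rw [hn]; exact hr1
    rw [← heval _ hz, hB₁, Polynomial.eval_mul, norm_mul, norm_mul]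
    have h1 : ‖(Polynomial.X - Polynomial.C w).eval ((r : ℂ) * w)‖ = 1 - r := by
      rw [Polynomial.eval_sub, Polynomial.eval_X, Polynomial.eval_C,
        show (r : ℂ) * w - w = ((r - 1 : ℝ) : ℂ) * w by push_cast; ring, norm_mul, heq, mul_one,
        Complex.norm_real, Real.norm_of_nonpos (by linarith)]
      ring
    have h2 : ‖B₁.eval ((r : ℂ) * w)‖ ≤ C := hC _ (by simpa using hz.le)
    have h3 := norm_diskEval_sq_le hz f
    rw [hn] at h3
    -- The zero of `B'` gains `(1 - r)²` against the growth `(1 - r²)⁻¹` of `|f|²`, and one power of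
    -- `1 - r` survives.
    have h4 : (1 - r) ^ 2 * (1 - r ^ 2)⁻¹ ≤ 1 - r := by
      rw [← div_eq_mul_inv, div_le_iff₀ (by nlinarith)]
      nlinarith [mul_nonneg hr0 (sub_nonneg.2 hr1.le)]
    rw [h1]
    calc ((1 - r) * ‖B₁.eval ((r : ℂ) * w)‖ * ‖diskEval f ((r : ℂ) * w)‖) ^ 2
        = ‖B₁.eval ((r : ℂ) * w)‖ ^ 2 * ((1 - r) ^ 2 * ‖diskEval f ((r : ℂ) * w)‖ ^ 2) := by ring
      _ ≤ C ^ 2 * ((1 - r) ^ 2 * (‖f‖ ^ 2 * (1 - r ^ 2)⁻¹)) := by gcongr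
      _ = (C * ‖f‖) ^ 2 * ((1 - r) ^ 2 * (1 - r ^ 2)⁻¹) := by ring
      _ ≤ _ := by gcongr
  refine hroot w hw0 ?_
  have hlim1 : Filter.Tendsto (fun r : ℝ => ‖A'.eval ((r : ℂ) * w)‖ ^ 2) (nhdsWithin 1 (Set.Iio 1))
      (nhds (‖A'.eval w‖ ^ 2)) := by
    have hcont : Continuous fun r : ℝ => ‖A'.eval ((r : ℂ) * w)‖ ^ 2 := by fun_prop
    have := (hcont.tendsto 1).mono_left (nhdsWithin_le_nhds (s := Set.Iio 1))
    simpa using this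
  have hlim2 : Filter.Tendsto (fun r : ℝ => (C * ‖f‖) ^ 2 * (1 - r)) (nhdsWithin 1 (Set.Iio 1))
      (nhds 0) := by
    have hcont : Continuous fun r : ℝ => (C * ‖f‖) ^ 2 * (1 - r) := by fun_prop
    have := (hcont.tendsto 1).mono_left (nhdsWithin_le_nhds (s := Set.Iio 1))
    simpa using this
  have hle := le_of_tendsto_of_tendsto hlim1 hlim2 (by
    filter_upwards [Ioo_mem_nhdsLT (zero_lt_one' ℝ)] with r hr
    exact hbound r hr.1.le hr.2)
  have : ‖A'.eval w‖ = 0 := by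
    have := sq_nonneg ‖A'.eval w‖
    exact pow_eq_zero_iff (two_ne_zero) |>.1 (le_antisymm hle this)
  exact norm_eq_zero.1 this

/-! ### The symbol -/

section Symbol

variable {m n : ℕ} {p : MvPolynomial (Fin 2) ℂ} {S₁ S₂ : Submodule ℂ HardyBidisk}

theorem exists_poly_coeff_polySeries (q : MvPolynomial (Fin 2) ℂ) (k : ℕ) :
    ∃ P : Polynomial ℂ, PowerSeries.coeff k (polySeries q) = P := by
  refine ⟨∑ d ∈ q.support, if k = d 0 then Polynomial.C (q.coeff d) * Polynomial.X ^ d 1 else 0, ?_⟩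
  rw [polySeries_eq_sum, map_sum]
  have : ∀ (s : Finset (Fin 2 →₀ ℕ)) (F : (Fin 2 →₀ ℕ) → Polynomial ℂ),
      ((∑ d ∈ s, F d : Polynomial ℂ) : PowerSeries ℂ) = ∑ d ∈ s, (F d : PowerSeries ℂ) :=
    fun s F => map_sum (Polynomial.coeToPowerSeries.ringHom (R := ℂ)) F s
  rw [this]
  refine Finset.sum_congr rfl fun d _ => ?_
  rw [← map_pow, Algebra.smul_def, algebraMap_series, PowerSeries.coeff_C_mul,
    PowerSeries.coeff_mul_C, PowerSeries.coeff_X_pow]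
  split_ifs <;> simp

/-- The coordinates of the backward shift of `bᵢ` in `S₂ ≅ H²(𝔻)^m`. -/
def symbolVec (hS : IsShiftDecomposition (modelSpace (theta m n p)) S₁ S₂)
    (b : OrthonormalBasis (Fin m) ℂ (wandering S₂)) (i : Fin m) : HardyDiskVec m :=
  (woldEquiv hS.closed_snd hS.invariant_snd b).symm ⟨backShift1 (b i), hS.backShift1_mem (b i).2.1⟩

theorem woldEquiv_symbolVec (hS : IsShiftDecomposition (modelSpace (theta m n p)) S₁ S₂)
    (b : OrthonormalBasis (Fin m) ℂ (wandering S₂)) (i : Fin m) :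
    (woldEquiv hS.closed_snd hS.invariant_snd b (symbolVec hS b i) : HardyBidisk) =
      backShift1 (b i) := by
  rw [symbolVec, LinearIsometryEquiv.apply_symm_apply]

/-- Comparing `z₁`-coefficients in `p` times the backward shift of `bᵢ` gives a square linear system
over `ℂ[z₂]` for the coordinates. Its determinant is nonzero by independence of the rows, and the
adjugate solves it. -/
theorem exists_symbolVec_rational (hp : IsRationalInner m n p)
    (hS : IsShiftDecomposition (modelSpace (theta m n p)) S₁ S₂)
    (b : OrthonormalBasis (Fin m) ℂ (wandering S₂)) (i j : Fin m) :
    ∃ A B : Polynomial ℂ, B ≠ 0 ∧ (B : PowerSeries ℂ) * diskSeries (symbolVec hS b i j) = A := by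
  choose P hP using exists_poly_coeff_polySeries p
  set Q := rowMatrix p m n b with hQ
  have hP0 : P 0 ≠ 0 := by
    intro h0
    have h1 := mulPoly_monomialVec_zero_apply p 0
    rw [← coeff_toSeries, toSeries_mulPoly, toSeries_monomialVec_zero, mul_one] at h1
    simp only [Finsupp.coe_zero, Pi.zero_apply] at h1
    rw [hP 0, h0, ← polyEval_zero] at h1
    exact hp.ne_zero (0, 0) (by simp [bidisk]) (by simpa using h1.symm)
  have hdet : Q.det ≠ 0 := by
    intro h0
    obtain ⟨v, hv0, hv⟩ := Matrix.exists_vecMul_eq_zero_iff.2 h0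
    exact hv0 (hS.eq_zero_of_vecMul_rowMatrix hp b hv)
  -- The right-hand side involves `bᵢ(0, z₂)`, which need not be a polynomial; multiplying by `P 0 =
  -- p(0, z₂)` turns it into row `0` of `p bᵢ`.
  set R : Fin m → Polynomial ℂ := fun k =>
    P 0 * rowPoly p n (b i) (k + 1) - P (k + 1) * rowPoly p n (b i) 0 with hR
  have hrel : ∀ k : Fin m, (P 0 : PowerSeries ℂ) *
      ∑ j, (Q j k : PowerSeries ℂ) * diskSeries (symbolVec hS b i j) = R k := by
    intro k
    have h1 := hS.coeff_mulPoly_woldEquiv hp b (symbolVec hS b i) k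
    rw [woldEquiv_symbolVec] at h1
    have h2 : (PowerSeries.X : PowerSeries (PowerSeries ℂ)) * toSeries (backShift1 (b i)) =
        toSeries (b i : HardyBidisk) -
          PowerSeries.C (PowerSeries.coeff 0 (toSeries (b i : HardyBidisk))) := by
      ext a l
      cases a with
      | zero => simp
      | succ a =>
        rw [PowerSeries.coeff_succ_X_mul, coeff_toSeries, backShift1_apply, map_sub,
          PowerSeries.coeff_C, if_neg (Nat.succ_ne_zero a), sub_zero, coeff_toSeries]
    have h3 : PowerSeries.coeff (k : ℕ) (toSeries (mulPoly p (backShift1 (b i)))) =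
        (rowPoly p n (b i) (k + 1) : PowerSeries ℂ) - P (k + 1) *
          PowerSeries.coeff 0 (toSeries (b i : HardyBidisk)) := by
      rw [toSeries_mulPoly, ← PowerSeries.coeff_succ_X_mul, mul_left_comm, h2, mul_sub, map_sub,
        PowerSeries.coeff_mul_C, ← toSeries_mulPoly, hS.coe_rowPoly hp (b i).2, hP]
    have h4 : (P 0 : PowerSeries ℂ) * PowerSeries.coeff 0 (toSeries (b i : HardyBidisk)) =
        (rowPoly p n (b i) 0 : PowerSeries ℂ) := by
      rw [hS.coe_rowPoly hp (b i).2, toSeries_mulPoly, ← hP]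
      simp
    have h5 : ∑ j, (Q j k : PowerSeries ℂ) * diskSeries (symbolVec hS b i j) =
        (rowPoly p n (b i) (k + 1) : PowerSeries ℂ) - P (k + 1) *
          PowerSeries.coeff 0 (toSeries (b i : HardyBidisk)) := by
      rw [← h3, h1]
      rfl
    rw [h5, mul_sub, mul_left_comm, h4]
    simp only [hR, Polynomial.coe_sub, Polynomial.coe_mul]
  have hadj : ∀ l : Fin m, ∑ k, Q l k * Q.adjugate k j = if l = j then Q.det else 0 := by
    intro l
    have := congrFun (congrFun (Matrix.mul_adjugate Q) l) j
    simpa [Matrix.mul_apply, Matrix.one_apply] using this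
  refine ⟨∑ k, R k * Q.adjugate k j, P 0 * Q.det, mul_ne_zero hP0 hdet, ?_⟩
  have hcoe : ∀ (F : Fin m → Polynomial ℂ),
      ((∑ d, F d : Polynomial ℂ) : PowerSeries ℂ) = ∑ d, (F d : PowerSeries ℂ) :=
    fun F => map_sum (Polynomial.coeToPowerSeries.ringHom (R := ℂ)) F Finset.univ
  rw [hcoe]
  simp only [Polynomial.coe_mul, ← hrel]
  have h6 : ∀ k : Fin m, (P 0 : PowerSeries ℂ) *
      (∑ l, (Q l k : PowerSeries ℂ) * diskSeries (symbolVec hS b i l)) *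
        (Q.adjugate k j : PowerSeries ℂ) = ∑ l, (P 0 : PowerSeries ℂ) *
          (((Q l k * Q.adjugate k j : Polynomial ℂ) : PowerSeries ℂ) *
            diskSeries (symbolVec hS b i l)) := by
    intro k
    rw [mul_assoc, Finset.sum_mul, Finset.mul_sum]
    refine Finset.sum_congr rfl fun l _ => ?_
    rw [Polynomial.coe_mul]
    ring
  rw [Finset.sum_congr rfl fun k _ => h6 k, Finset.sum_comm, Finset.sum_eq_single j]
  · rw [← Finset.mul_sum, ← Finset.sum_mul, ← hcoe, hadj, if_pos rfl, mul_assoc]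
  · intro l _ hl
    rw [← Finset.mul_sum, ← Finset.sum_mul, ← hcoe, hadj, if_neg hl]
    simp
  · intro h; exact absurd (Finset.mem_univ j) h

theorem inner_woldVec_woldEquiv {S : Submodule ℂ HardyBidisk}
    (hclosed : IsClosed (S : Set HardyBidisk)) (hinv : ∀ f ∈ S, mulZ2 f ∈ S)
    (b : OrthonormalBasis (Fin m) ℂ (wandering S)) (f : HardyDiskVec m) (a : Fin m × ℕ) :
    inner ℂ (woldVec b a) (woldEquiv hclosed hinv b f : HardyBidisk) = f a.1 a.2 := by
  have h := (woldBasis hclosed hinv b).repr_apply_apply (woldEquiv hclosed hinv b f) a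
  rw [Submodule.coe_inner, woldBasis_apply] at h
  rw [← h, woldEquiv, LinearIsometryEquiv.trans_apply, LinearIsometryEquiv.apply_symm_apply,
    vecCoeff_apply]

theorem symbolVec_apply (hS : IsShiftDecomposition (modelSpace (theta m n p)) S₁ S₂)
    (b : OrthonormalBasis (Fin m) ℂ (wandering S₂)) (i j : Fin m) (l : ℕ) :
    symbolVec hS b i j l = conj (inner ℂ (b i : HardyBidisk) (mulZ1 (woldVec b (j, l)))) := by
  rw [inner_conj_symm, ← inner_woldVec_woldEquiv hS.closed_snd hS.invariant_snd b
    (symbolVec hS b i) (j, l), woldEquiv_symbolVec, backShift1,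
    ContinuousLinearMap.adjoint_inner_right]

theorem mulZ1_monomialMul (k l : ℕ) (f : HardyBidisk) :
    mulZ1 (monomialMul k l f) = monomialMul k l (mulZ1 f) := by
  rw [← mulPoly_X0, ← mulPoly_X0, mulPoly_monomialMul]

/-- The matrix of the compression of `M_{z₁}` in the basis `z₂ᵏ bᵢ`. -/
theorem inner_woldVec_mulZ1 (hS : IsShiftDecomposition (modelSpace (theta m n p)) S₁ S₂)
    (b : OrthonormalBasis (Fin m) ℂ (wandering S₂)) (i j : Fin m) (k l : ℕ) :
    inner ℂ (woldVec b (i, k)) (mulZ1 (woldVec b (j, l))) =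
      if k ≤ l then conj (symbolVec hS b i j (l - k)) else 0 := by
  split_ifs with h
  · obtain ⟨t, rfl⟩ := Nat.exists_eq_add_of_le h
    rw [symbolVec_apply, Complex.conj_conj, Nat.add_sub_cancel_left]
    simp only [woldVec]
    rw [monomialMul_snd_add, mulZ1_monomialMul, inner_monomialMul]
  -- Below the diagonal, the backward shift in `z₁` commutes with `z₂`, so the left vector lies in
  -- `z₂^(t+1) S₂`, which is orthogonal to `bⱼ`.
  · obtain ⟨t, rfl⟩ := Nat.exists_eq_add_of_lt (not_le.1 h)
    simp only [woldVec]
    rw [add_assoc, monomialMul_snd_add, mulZ1_monomialMul, inner_monomialMul,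
      ← ContinuousLinearMap.adjoint_inner_left]
    change inner ℂ (backShift1 _) _ = _
    have : backShift1 (monomialMul 0 (t + 1) (b i : HardyBidisk)) =
        monomialMul 0 (t + 1) (backShift1 (b i)) := by
      ext ⟨x, y⟩
      rw [backShift1_apply, monomialMul_snd_apply, monomialMul_snd_apply, backShift1_apply]
    rw [this]
    exact inner_monomialMul_snd_wandering hS.invariant_snd (b j).2
      (hS.backShift1_mem (b i).2.1) (Nat.succ_ne_zero t)

end Symbol

/-! ### Fourier coefficients of boundary functions -/

theorem toCircle_mem_closedBall (t : AddCircle (1 : ℝ)) :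
    (AddCircle.toCircle t : ℂ) ∈ Metric.closedBall (0 : ℂ) 1 := by
  rw [mem_closedBall_zero_iff, Circle.norm_coe]

theorem continuous_comp_toCircle {G : ℂ → ℂ} (hG : ContinuousOn G (Metric.closedBall 0 1)) :
    Continuous fun t : AddCircle (1 : ℝ) => G (AddCircle.toCircle t : ℂ) :=
  hG.comp_continuous (continuous_subtype_val.comp AddCircle.continuous_toCircle)
    toCircle_mem_closedBall

/-- For `r < 1` the series converges absolutely and uniformly and is integrated termwise. The
exponent `k.natAbs` is harmless for negative `k`, where the coefficient is zero. -/
theorem fourierCoeff_dilation (g : HardyDisk) {r : ℝ} (hr0 : 0 ≤ r) (hr1 : r < 1) (k : ℤ) :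
    fourierCoeff (fun t : AddCircle (1 : ℝ) => diskEval g (r * (AddCircle.toCircle t : ℂ))) k =
      coeffExtend Nat.castEmbedding g k * (r : ℂ) ^ k.natAbs := by
  have hn : ∀ t : AddCircle (1 : ℝ), ‖(r : ℂ) * (AddCircle.toCircle t : ℂ)‖ < 1 := fun t => by
    rw [norm_mul, Circle.norm_coe, mul_one, Complex.norm_real, Real.norm_of_nonneg hr0]
    exact hr1
  let F : ℕ → AddCircle (1 : ℝ) → ℂ := fun l t =>
    fourier (-k) t • ((g l * (r : ℂ) ^ l) * fourier (l : ℤ) t)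
  have hF : ∀ l, F l = fun t => (g l * (r : ℂ) ^ l) * fourier ((l : ℤ) - k) t := by
    intro l
    ext t
    simp only [F, smul_eq_mul]
    rw [sub_eq_add_neg, fourier_add]
    ring
  have hcont : ∀ l, Continuous (F l) := fun l => by
    rw [hF]
    exact continuous_const.mul (fourier _).continuous
  have hnorm : ∀ l t, ‖F l t‖ ≤ ‖g‖ * r ^ l := by
    intro l t
    rw [hF, norm_mul, norm_mul, norm_pow, Complex.norm_real, Real.norm_of_nonneg hr0,
      fourier_apply, Circle.norm_coe, mul_one]
    exact mul_le_mul_of_nonneg_right (norm_coeff_le g l) (by positivity)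
  have hint : ∀ l, Integrable (F l) (AddCircle.haarAddCircle (T := (1 : ℝ))) := fun l =>
    Integrable.of_bound (hcont l).aestronglyMeasurable (‖g‖ * r ^ l)
      (Filter.Eventually.of_forall (hnorm l))
  have hsum : Summable fun l => ∫ t, ‖F l t‖ ∂(AddCircle.haarAddCircle (T := (1 : ℝ))) := by
    refine Summable.of_nonneg_of_le (fun l => integral_nonneg fun t => norm_nonneg _)
      (fun l => ?_) ((summable_geometric_of_lt_one hr0 hr1).mul_left ‖g‖)
    refine (integral_mono (hint l).norm (integrable_const _) (hnorm l)).trans ?_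
    simp
  have h1 := hasSum_integral_of_summable_integral_norm hint hsum
  have h2 : ∀ t, ∑' l, F l t =
      fourier (-k) t • diskEval g (r * (AddCircle.toCircle t : ℂ)) := by
    intro t
    have := (hasSum_diskEval (hn t) g).mul_left (fourier (-k) t)
    rw [smul_eq_mul, ← this.tsum_eq]
    refine tsum_congr fun l => ?_
    simp only [F, smul_eq_mul, mul_pow, fourier_apply, natCast_zsmul, AddCircle.toCircle_nsmul,
      Circle.coe_pow]
    ring
  simp only [h2] at h1
  have h3 : ∀ l : ℕ, ∫ t, F l t ∂(AddCircle.haarAddCircle (T := (1 : ℝ))) =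
      if (l : ℤ) = k then g l * (r : ℂ) ^ l else 0 := by
    intro l
    have h4 : fourierCoeff (fun t : AddCircle (1 : ℝ) =>
        (g l * (r : ℂ) ^ l) * fourier (l : ℤ) t) k = ∫ t, F l t ∂AddCircle.haarAddCircle := rfl
    rw [← h4, fourierCoeff.const_mul, fourierCoeff_fourier]
    by_cases h : (l : ℤ) = k
    · simp [h]
    · rw [if_neg h, Pi.single_eq_of_ne (Ne.symm h), mul_zero]
  simp only [h3] at h1
  rw [fourierCoeff]
  by_cases hk : ∃ l : ℕ, (l : ℤ) = k
  · obtain ⟨l, rfl⟩ := hk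
    have h5 : coeffExtend Nat.castEmbedding g (l : ℤ) = g l :=
      coeffExtend_apply Nat.castEmbedding g l
    have h6 : (fun l' : ℕ => if (l' : ℤ) = (l : ℤ) then g l' * (r : ℂ) ^ l' else 0) =
        fun l' => if l' = l then g l * (r : ℂ) ^ l else 0 := by
      ext l'
      by_cases h : l' = l
      · subst h; simp
      · simp [h]
    rw [h6] at h1
    rw [h5, Int.natAbs_natCast]
    exact h1.unique (hasSum_ite_eq l _)
  · have h6 : (fun l' : ℕ => if (l' : ℤ) = k then g l' * (r : ℂ) ^ l' else 0) = fun _ => 0 := by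
      ext l'
      exact if_neg fun h => hk ⟨l', h⟩
    rw [h6] at h1
    rw [coeffExtend_apply' Nat.castEmbedding g (by simpa using hk), zero_mul]
    exact h1.unique hasSum_zero

/-- Dominated convergence along radii tending to `1`; the continuous extension `G` supplies both the
bound and the pointwise limit. -/
theorem fourierCoeff_boundary {g : HardyDisk} {G : ℂ → ℂ}
    (hG : ContinuousOn G (Metric.closedBall 0 1)) (hGg : ∀ z, ‖z‖ < 1 → G z = diskEval g z)
    (k : ℤ) : fourierCoeff (fun t : AddCircle (1 : ℝ) => G (AddCircle.toCircle t : ℂ)) k =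
      coeffExtend Nat.castEmbedding g k := by
  let r : ℕ → ℝ := fun N => 1 - 1 / ((N : ℝ) + 1)
  have hr0 : ∀ N, 0 ≤ r N := fun N => by
    have : 1 / ((N : ℝ) + 1) ≤ 1 := by
      rw [div_le_one (by positivity)]
      linarith [(Nat.cast_nonneg N : (0 : ℝ) ≤ N)]
    simp only [r]; linarith
  have hr1 : ∀ N, r N < 1 := fun N => by
    have : 0 < 1 / ((N : ℝ) + 1) := by positivity
    simp only [r]; linarith
  have hr : Filter.Tendsto r Filter.atTop (nhds 1) := by
    have := (tendsto_const_nhds (x := (1 : ℝ))).sub tendsto_one_div_add_atTop_nhds_zero_nat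
    simpa [r] using this
  have hmem : ∀ N (t : AddCircle (1 : ℝ)),
      (r N : ℂ) * (AddCircle.toCircle t : ℂ) ∈ Metric.closedBall (0 : ℂ) 1 := fun N t => by
    rw [mem_closedBall_zero_iff, norm_mul, Circle.norm_coe, mul_one, Complex.norm_real,
      Real.norm_of_nonneg (hr0 N)]
    exact (hr1 N).le
  obtain ⟨C, hC⟩ := (isCompact_closedBall (0 : ℂ) 1).exists_bound_of_continuousOn hG
  have hlim1 : Filter.Tendsto (fun N => fourierCoeff (fun t : AddCircle (1 : ℝ) =>
      diskEval g (r N * (AddCircle.toCircle t : ℂ))) k) Filter.atTop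
      (nhds (fourierCoeff (fun t : AddCircle (1 : ℝ) => G (AddCircle.toCircle t : ℂ)) k)) := by
    have heq : ∀ N, (fun t : AddCircle (1 : ℝ) =>
        diskEval g (r N * (AddCircle.toCircle t : ℂ))) = fun t =>
        G (r N * (AddCircle.toCircle t : ℂ)) := fun N => by
      ext t
      rw [hGg]
      rw [norm_mul, Circle.norm_coe, mul_one, Complex.norm_real, Real.norm_of_nonneg (hr0 N)]
      exact hr1 N
    refine Filter.Tendsto.congr (fun N => congrArg (fun φ => fourierCoeff φ k) (heq N).symm) ?_
    simp only [fourierCoeff]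
    refine tendsto_integral_of_dominated_convergence (fun _ => C) (fun N => ?_)
      (integrable_const C) (fun N => Filter.Eventually.of_forall fun t => ?_)
      (Filter.Eventually.of_forall fun t => ?_)
    · have h1 : Continuous fun t : AddCircle (1 : ℝ) => G (r N * (AddCircle.toCircle t : ℂ)) :=
        hG.comp_continuous (continuous_const.mul
          (continuous_subtype_val.comp AddCircle.continuous_toCircle)) (hmem N)
      have h2 : Continuous fun t : AddCircle (1 : ℝ) =>
          fourier (-k) t • G (r N * (AddCircle.toCircle t : ℂ)) :=
        (fourier (-k)).continuous.smul h1
      exact h2.aestronglyMeasurable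
    · rw [norm_smul, fourier_apply, Circle.norm_coe, one_mul]
      exact hC _ (hmem N t)
    · refine Filter.Tendsto.const_smul ?_ _
      have h1 := hG _ (toCircle_mem_closedBall t)
      refine h1.tendsto.comp (tendsto_nhdsWithin_iff.2
        ⟨?_, Filter.Eventually.of_forall fun N => hmem N t⟩)
      have h2 := ((Complex.continuous_ofReal.tendsto 1).comp hr).mul_const
        (AddCircle.toCircle t : ℂ)
      simpa using h2
  have hlim2 : Filter.Tendsto (fun N => fourierCoeff (fun t : AddCircle (1 : ℝ) =>
      diskEval g (r N * (AddCircle.toCircle t : ℂ))) k) Filter.atTop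
      (nhds (coeffExtend Nat.castEmbedding g k)) := by
    simp only [fun N => fourierCoeff_dilation g (hr0 N) (hr1 N) k]
    have h2 := (((Complex.continuous_ofReal.tendsto 1).comp hr).pow k.natAbs).const_mul
      (coeffExtend Nat.castEmbedding g k)
    simpa using h2
  exact tendsto_nhds_unique hlim1 hlim2

theorem fourierCoeff_conj (f : AddCircle (1 : ℝ) → ℂ) (k : ℤ) :
    fourierCoeff (fun t => conj (f t)) k = conj (fourierCoeff f (-k)) := by
  rw [fourierCoeff, fourierCoeff, ← integral_conj]
  refine integral_congr_ae (Filter.Eventually.of_forall fun t => ?_)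
  simp only [smul_eq_mul, map_mul, ← fourier_neg, neg_neg]

/-! ### Toeplitz operators -/

theorem memLp_top_of_continuous {φ : AddCircle (1 : ℝ) → ℂ} (hφ : Continuous φ) :
    MemLp φ ∞ (AddCircle.haarAddCircle (T := (1 : ℝ))) := by
  obtain ⟨C, hC⟩ := isCompact_univ.exists_bound_of_continuousOn hφ.continuousOn
  exact memLp_top_of_bound hφ.aestronglyMeasurable C
    (Filter.Eventually.of_forall fun t => hC t (Set.mem_univ t))

theorem coeFn_mulL2 {φ : AddCircle (1 : ℝ) → ℂ} (hφ : Continuous φ) (g : CircleL2) :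
    mulL2 φ g =ᵐ[AddCircle.haarAddCircle] fun t => φ t * g t := by
  have h := memLp_top_of_continuous hφ
  rw [mulL2, dif_pos h]
  have h1 := ContinuousLinearMap.coeFn_holder (r := 2) (ContinuousLinearMap.mul ℂ ℂ) (h.toLp φ) g
  filter_upwards [h1, h.coeFn_toLp] with t ht1 ht2
  exact ht1.trans (by rw [ht2]; rfl)

theorem inner_mulL2 {φ : AddCircle (1 : ℝ) → ℂ} (hφ : Continuous φ) (f g : CircleL2) :
    inner ℂ f (mulL2 φ g) = ∫ t, conj (f t) * (φ t * g t) ∂AddCircle.haarAddCircle := by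
  rw [L2.inner_def]
  refine integral_congr_ae ?_
  filter_upwards [coeFn_mulL2 hφ g] with t ht
  rw [ht, RCLike.inner_apply, mul_comm]

theorem integrable_mulL2 {φ : AddCircle (1 : ℝ) → ℂ} (hφ : Continuous φ) (f g : CircleL2) :
    Integrable (fun t => conj (f t) * (φ t * g t)) AddCircle.haarAddCircle := by
  refine (L2.integrable_inner (𝕜 := ℂ) f (mulL2 φ g)).congr ?_
  filter_upwards [coeFn_mulL2 hφ g] with t ht
  rw [ht, RCLike.inner_apply, mul_comm]

theorem boundaryValue_single (k : ℕ) :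
    boundaryValue (lp.single 2 k 1) = fourierLp (T := (1 : ℝ)) 2 (k : ℤ) := by
  have h : coeffExtend Nat.castEmbedding (lp.single 2 k 1 : HardyDisk) =
      lp.single 2 (k : ℤ) 1 := by
    ext l
    by_cases hl : ∃ a : ℕ, (a : ℤ) = l
    · obtain ⟨a, rfl⟩ := hl
      refine (coeffExtend_apply Nat.castEmbedding _ a).trans ?_
      simp [lp.single_apply, Pi.single_apply]
    · rw [coeffExtend_apply' _ _ (by simpa using hl)]
      have : l ≠ k := fun h => hl ⟨k, h.symm⟩
      simp [lp.single_apply, this]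
  change fourierBasis.repr.symm (coeffExtend Nat.castEmbedding (lp.single 2 k 1 : HardyDisk)) = _
  rw [h, HilbertBasis.repr_symm_single, coe_fourierBasis]

theorem inner_fourierLp_mulL2 {φ : AddCircle (1 : ℝ) → ℂ} (hφ : Continuous φ) (k l : ℤ) :
    inner ℂ (fourierLp (T := (1 : ℝ)) 2 k) (mulL2 φ (fourierLp (T := (1 : ℝ)) 2 l)) =
      fourierCoeff φ (k - l) := by
  rw [inner_mulL2 hφ, fourierCoeff]
  refine integral_congr_ae ?_
  filter_upwards [coeFn_fourierLp (T := (1 : ℝ)) 2 k, coeFn_fourierLp (T := (1 : ℝ)) 2 l]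
    with t ht1 ht2
  rw [ht1, ht2, ← fourier_neg, smul_eq_mul, neg_sub, sub_eq_add_neg, fourier_add]
  ring

section Toeplitz

variable {m : ℕ}

/-- Continuity of all the entries of a symbol on the unit circle. -/
def ContinuousSymbol (F : ℂ → Matrix (Fin m) (Fin m) ℂ) : Prop :=
  ∀ i j, Continuous fun t : AddCircle (1 : ℝ) => F (AddCircle.toCircle t : ℂ) i j

/-- The Riesz projection, being the adjoint of the inclusion, disappears from the quadratic form. -/
theorem inner_toeplitz (F : ℂ → Matrix (Fin m) (Fin m) ℂ) (f g : HardyDiskVec m) :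
    inner ℂ f (toeplitz F g) = ∑ i, ∑ j, inner ℂ (boundaryValue (f i))
      (mulL2 (fun t => F (AddCircle.toCircle t : ℂ) i j) (boundaryValue (g j))) := by
  rw [PiLp.inner_apply]
  refine Finset.sum_congr rfl fun i _ => ?_
  have h : (toeplitz F g).ofLp i = rieszProjection (∑ j,
      mulL2 (fun t => F (AddCircle.toCircle t : ℂ) i j) (boundaryValue (g j))) := by
    simp [toeplitz]
  rw [h, rieszProjection, ContinuousLinearMap.adjoint_inner_right, inner_sum]
  rfl

/-- The vector with one nonzero component `zᵏ`. -/
def vecBasis (a : Fin m × ℕ) : HardyDiskVec m := (vecCoeff m).symm (lp.single 2 a 1)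

theorem inner_vecBasis (a : Fin m × ℕ) (f : HardyDiskVec m) :
    inner ℂ (vecBasis a) f = f a.1 a.2 := by
  rw [← (vecCoeff m).inner_map_map, vecBasis, LinearIsometryEquiv.apply_symm_apply,
    lp.inner_single_left, vecCoeff_apply]
  simp

theorem vecBasis_apply (i j : Fin m) (k : ℕ) :
    vecBasis (i, k) j = if i = j then (lp.single 2 k 1 : HardyDisk) else 0 := by
  ext l
  have h := vecCoeff_apply (vecBasis (i, k)) (j, l)
  rw [vecBasis, LinearIsometryEquiv.apply_symm_apply] at h
  rw [vecBasis, ← h]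
  by_cases hij : i = j
  · subst hij
    simp [lp.single_apply, Pi.single_apply]
  · have : ¬ j = i := fun h => hij h.symm
    simp [lp.single_apply, hij, this]

theorem inner_vecBasis_toeplitz {F : ℂ → Matrix (Fin m) (Fin m) ℂ} (hF : ContinuousSymbol F)
    (i j : Fin m) (k l : ℕ) : inner ℂ (vecBasis (i, k)) (toeplitz F (vecBasis (j, l))) =
      fourierCoeff (fun t : AddCircle (1 : ℝ) => F (AddCircle.toCircle t : ℂ) i j)
        ((k : ℤ) - l) := by
  rw [inner_toeplitz, Finset.sum_eq_single i, Finset.sum_eq_single j]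
  · rw [vecBasis_apply, vecBasis_apply, if_pos rfl, if_pos rfl, boundaryValue_single,
      boundaryValue_single, inner_fourierLp_mulL2 (hF i j)]
  · intro b _ hb
    rw [vecBasis_apply j, if_neg (Ne.symm hb), map_zero, map_zero, inner_zero_right]
  · intro h; exact absurd (Finset.mem_univ j) h
  · intro b _ hb
    refine Finset.sum_eq_zero fun c _ => ?_
    rw [vecBasis_apply i, if_neg (Ne.symm hb), map_zero, inner_zero_left]
  · intro h; exact absurd (Finset.mem_univ i) h

theorem hasSum_vecBasis (f : HardyDiskVec m) :
    HasSum (fun a : Fin m × ℕ => f a.1 a.2 • vecBasis a) f := by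
  have h1 := lp.hasSum_single (E := fun _ : Fin m × ℕ => ℂ) (p := 2) (by norm_num) (vecCoeff m f)
  have h2 := h1.mapL (vecCoeff m).symm.toContinuousLinearEquiv.toContinuousLinearMap
  have h3 : (vecCoeff m).symm.toContinuousLinearEquiv.toContinuousLinearMap (vecCoeff m f) = f :=
    (vecCoeff m).symm_apply_apply f
  rw [h3] at h2
  have h4 : ∀ a : Fin m × ℕ, f a.1 a.2 • vecBasis a =
      (vecCoeff m).symm (lp.single 2 a (vecCoeff m f a)) := by
    intro a
    rw [← vecCoeff_apply, vecBasis, ← map_smul, ← lp.single_smul, smul_eq_mul, mul_one]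
  simp only [h4]
  exact h2

theorem ext_vecBasis {T T' : HardyDiskVec m →L[ℂ] HardyDiskVec m}
    (h : ∀ a a', inner ℂ (vecBasis a) (T (vecBasis a')) =
      inner ℂ (vecBasis a) (T' (vecBasis a'))) : T = T' := by
  have hb : ∀ a', T (vecBasis a') = T' (vecBasis a') := by
    intro a'
    ext i k
    have := h (i, k) a'
    rwa [inner_vecBasis, inner_vecBasis] at this
  ext1 f
  have h1 := (hasSum_vecBasis f).mapL T
  have h2 := (hasSum_vecBasis f).mapL T'
  simp only [map_smul, hb] at h1 h2
  exact h1.unique h2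

end Toeplitz

/-! ### Existence of the symbol and its uniqueness on the circle. -/

section Symbols

variable {m n : ℕ} {p : MvPolynomial (Fin 2) ℂ} {S₁ S₂ : Submodule ℂ HardyBidisk}

theorem inner_compression {S : Submodule ℂ HardyBidisk} [S.HasOrthogonalProjection]
    (T : HardyBidisk →L[ℂ] HardyBidisk) (x y : S) :
    inner ℂ x (compression S T y) = inner ℂ (x : HardyBidisk) (T y) :=
  Submodule.inner_orthogonalProjectionOnto_eq_of_mem_left x (T y)

theorem woldEquiv_vecBasis {S : Submodule ℂ HardyBidisk}
    (hclosed : IsClosed (S : Set HardyBidisk)) (hinv : ∀ f ∈ S, mulZ2 f ∈ S)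
    (b : OrthonormalBasis (Fin m) ℂ (wandering S)) (a : Fin m × ℕ) :
    (woldEquiv hclosed hinv b (vecBasis a) : HardyBidisk) = woldVec b a := by
  rw [woldEquiv, LinearIsometryEquiv.trans_apply, vecBasis, LinearIsometryEquiv.apply_symm_apply,
    HilbertBasis.repr_symm_single, woldBasis_apply]

/-- The conjugate of an analytic function has only nonpositive frequencies, which matches the
triangular matrix of the compression. -/
theorem fourierCoeff_symbol {g : HardyDisk} {G : ℂ → ℂ}
    (hG : ContinuousOn G (Metric.closedBall 0 1)) (hGg : ∀ z, ‖z‖ < 1 → G z = diskEval g z)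
    (k l : ℕ) : fourierCoeff (fun t : AddCircle (1 : ℝ) => conj (G (AddCircle.toCircle t : ℂ)))
      ((k : ℤ) - l) = if k ≤ l then conj (g (l - k)) else 0 := by
  rw [fourierCoeff_conj, fourierCoeff_boundary hG hGg, neg_sub]
  split_ifs with h
  · have := coeffExtend_apply (Nat.castEmbedding : ℕ ↪ ℤ) g (l - k)
    have hkl : (l : ℤ) - k = (Nat.castEmbedding : ℕ ↪ ℤ) (l - k) := (Nat.cast_sub (R := ℤ) h).symm
    rw [← this, hkl]
  · rw [coeffExtend_apply' Nat.castEmbedding g, map_zero]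
    rintro ⟨a, ha⟩
    have : (a : ℤ) = (l : ℤ) - k := ha
    omega

theorem IsSymbol.continuousSymbol [S₂.HasOrthogonalProjection]
    {b : OrthonormalBasis (Fin m) ℂ (wandering S₂)} {M : ℂ → Matrix (Fin m) (Fin m) ℂ}
    (hM : IsSymbol S₂ b M) : ContinuousSymbol M :=
  fun i j => continuous_comp_toCircle (hM.continuous i j)

/-- There is a symbol, and in the disk it is given by the functions `conj gᵢⱼ`. -/
theorem IsShiftDecomposition.exists_isSymbol (hp : IsRationalInner m n p)
    [S₂.HasOrthogonalProjection]
    (hS : IsShiftDecomposition (modelSpace (theta m n p)) S₁ S₂)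
    (b : OrthonormalBasis (Fin m) ℂ (wandering S₂)) :
    ∃ M : ℂ → Matrix (Fin m) (Fin m) ℂ, IsSymbol S₂ b M ∧
      ∀ z, ‖z‖ < 1 → ∀ i j, M z i j = conj (diskEval (symbolVec hS b i j) z) := by
  have hex : ∀ i j, ∃ A B : Polynomial ℂ, (∀ z, ‖z‖ ≤ 1 → B.eval z ≠ 0) ∧
      ∀ z, ‖z‖ < 1 → B.eval z * diskEval (symbolVec hS b i j) z = A.eval z := by
    intro i j
    obtain ⟨A, B, hB, h⟩ := exists_symbolVec_rational hp hS b i j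
    exact exists_rational_without_poles hB h
  choose A B hB hAB using hex
  have hin : ∀ z, ‖z‖ < 1 → ∀ i j,
      (A i j).eval z / (B i j).eval z = diskEval (symbolVec hS b i j) z := by
    intro z hz i j
    have := hB i j z hz.le
    rw [← hAB i j z hz]
    field_simp
  have hcont : ∀ i j, ContinuousOn (fun z => (A i j).eval z / (B i j).eval z)
      (Metric.closedBall 0 1) := fun i j =>
    (A i j).continuous.continuousOn.div (B i j).continuous.continuousOn fun z hz =>
      hB i j z (by simpa using hz)
  refine ⟨fun z => Matrix.of fun i j => conj ((A i j).eval z / (B i j).eval z), ?_,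
    fun z hz i j => congrArg conj (hin z hz i j)⟩
  have hconj : ∀ (P : Polynomial ℂ) (z : ℂ),
      (P.map (starRingEnd ℂ)).eval (conj z) = conj (P.eval z) := fun P z => by
    rw [Polynomial.eval_map, Polynomial.eval₂_at_apply]
  have hc : ∀ i j, ContinuousOn (fun z => conj ((A i j).eval z / (B i j).eval z))
      (Metric.closedBall 0 1) := fun i j => Complex.continuous_conj.comp_continuousOn (hcont i j)
  refine ⟨fun i j => ⟨(A i j).map (starRingEnd ℂ), (B i j).map (starRingEnd ℂ), ?_, ?_⟩, hc,
    woldEquiv hS.closed_snd hS.invariant_snd b, fun f z hz => bidiskEval_woldEquiv _ _ b f hz, ?_⟩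
  · rw [Ne, Polynomial.map_eq_zero]
    intro h0
    exact hB i j 0 (by simp) (by rw [h0, Polynomial.eval_zero])
  · intro z _ _
    rw [hconj, hconj, Matrix.of_apply, map_div₀]
  · set U := woldEquiv hS.closed_snd hS.invariant_snd b with hU
    have hT : toeplitz (fun z => Matrix.of fun i j => conj ((A i j).eval z / (B i j).eval z)) =
        U.symm.toContinuousLinearEquiv.toContinuousLinearMap ∘L compression S₂ mulZ1 ∘L
          U.toContinuousLinearEquiv.toContinuousLinearMap := by
      refine ext_vecBasis fun ⟨i, k⟩ ⟨j, l⟩ => ?_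
      rw [inner_vecBasis_toeplitz (fun i j => continuous_comp_toCircle (hc i j))]
      have h1 : inner ℂ (vecBasis (i, k)) ((U.symm.toContinuousLinearEquiv.toContinuousLinearMap ∘L
          compression S₂ mulZ1 ∘L U.toContinuousLinearEquiv.toContinuousLinearMap)
            (vecBasis (j, l))) = inner ℂ (woldVec b (i, k)) (mulZ1 (woldVec b (j, l))) := by
        change inner ℂ (vecBasis (i, k)) (U.symm (compression S₂ mulZ1 (U (vecBasis (j, l))))) = _
        rw [← U.inner_map_map, LinearIsometryEquiv.apply_symm_apply, inner_compression, hU,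
          woldEquiv_vecBasis, woldEquiv_vecBasis]
      rw [h1, inner_woldVec_mulZ1 hS]
      exact fourierCoeff_symbol (hcont i j) (fun z hz => hin z hz i j) k l
    rw [hT]
    ext1 x
    change _ = U (U.symm (compression S₂ mulZ1 (U (U.symm x))))
    rw [LinearIsometryEquiv.apply_symm_apply, LinearIsometryEquiv.apply_symm_apply]

variable [S₂.HasOrthogonalProjection]

/-- The unitary in `IsSymbol` is only asserted to exist, but its pointwise formula forces it to be
the Wold unitary on basis vectors. Hence the matrix of `T_M` is the same for all symbols. -/
theorem IsSymbol.inner_toeplitz_vecBasis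
    (hS : IsShiftDecomposition (modelSpace (theta m n p)) S₁ S₂)
    {b : OrthonormalBasis (Fin m) ℂ (wandering S₂)} {M : ℂ → Matrix (Fin m) (Fin m) ℂ}
    (hM : IsSymbol S₂ b M) (a a' : Fin m × ℕ) :
    inner ℂ (vecBasis a) (toeplitz M (vecBasis a')) =
      inner ℂ (woldVec b a) (mulZ1 (woldVec b a')) := by
  obtain ⟨U, hU, hC⟩ := hM.unitarily_equivalent
  have hUb : ∀ a, (U (vecBasis a) : HardyBidisk) = woldVec b a := by
    intro a
    rw [← woldEquiv_vecBasis hS.closed_snd hS.invariant_snd b a]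
    refine eq_of_bidiskEval_eq fun z hz => ?_
    rw [hU _ z hz, bidiskEval_woldEquiv _ _ b _ hz]
  have h1 : U (toeplitz M (vecBasis a')) = compression S₂ mulZ1 (U (vecBasis a')) := by
    rw [hC]
    change _ = U (toeplitz M (U.symm (U (vecBasis a'))))
    rw [LinearIsometryEquiv.symm_apply_apply]
  rw [← U.inner_map_map, h1, inner_compression, hUb, hUb]

theorem IsSymbol.numericalRange_eq {b : OrthonormalBasis (Fin m) ℂ (wandering S₂)}
    {M : ℂ → Matrix (Fin m) (Fin m) ℂ} (hM : IsSymbol S₂ b M) :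
    numericalRange (compression S₂ mulZ1) = numericalRange (toeplitz M) := by
  obtain ⟨U, -, hC⟩ := hM.unitarily_equivalent
  have h1 : ∀ x, compression S₂ mulZ1 x = U (toeplitz M (U.symm x)) := fun x => by
    rw [hC]; rfl
  ext w
  constructor
  · rintro ⟨x, hx, rfl⟩
    refine ⟨U.symm x, by rw [LinearIsometryEquiv.norm_map, hx], ?_⟩
    rw [h1, ← U.inner_map_map, LinearIsometryEquiv.apply_symm_apply]
  · rintro ⟨x, hx, rfl⟩
    refine ⟨U x, by rw [LinearIsometryEquiv.norm_map, hx], ?_⟩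
    rw [h1, U.inner_map_map, LinearIsometryEquiv.symm_apply_apply]

/-- Two symbols agree on the unit circle. -/
theorem IsSymbol.eqOn_sphere (hS : IsShiftDecomposition (modelSpace (theta m n p)) S₁ S₂)
    {b : OrthonormalBasis (Fin m) ℂ (wandering S₂)} {M M' : ℂ → Matrix (Fin m) (Fin m) ℂ}
    (hM : IsSymbol S₂ b M) (hM' : IsSymbol S₂ b M') {τ : ℂ} (hτ : τ ∈ Metric.sphere (0 : ℂ) 1) :
    M τ = M' τ := by
  obtain ⟨t, ht⟩ : ∃ t : AddCircle (1 : ℝ), (AddCircle.toCircle t : ℂ) = τ := by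
    obtain ⟨t, ht⟩ := (AddCircle.homeomorphCircle (T := 1) one_ne_zero).surjective
      ⟨τ, by simpa [Submonoid.unitSphere] using hτ⟩
    refine ⟨t, ?_⟩
    rw [← AddCircle.homeomorphCircle_apply one_ne_zero, ht]
  subst ht
  ext i j
  let f : C(AddCircle (1 : ℝ), ℂ) := ⟨_, hM.continuousSymbol i j⟩
  let f' : C(AddCircle (1 : ℝ), ℂ) := ⟨_, hM'.continuousSymbol i j⟩
  have hcoeff : ∀ k : ℤ, fourierCoeff f k = fourierCoeff f' k := by
    intro k
    -- The pair `k.toNat`, `(-k).toNat` writes any integer frequency `k` as a difference of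
    -- naturals.
    have h1 := inner_vecBasis_toeplitz hM.continuousSymbol i j k.toNat (-k).toNat
    have h2 := inner_vecBasis_toeplitz hM'.continuousSymbol i j k.toNat (-k).toNat
    rw [hM.inner_toeplitz_vecBasis hS, ← hM'.inner_toeplitz_vecBasis hS, h2,
      show ((k.toNat : ℤ) - (-k).toNat) = k by omega] at h1
    exact h1.symm
  have heq : ContinuousMap.toLp (E := ℂ) 2 AddCircle.haarAddCircle ℂ f =
      ContinuousMap.toLp (E := ℂ) 2 AddCircle.haarAddCircle ℂ f' := by
    apply fourierBasis.repr.injective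
    ext k
    rw [fourierBasis_repr, fourierBasis_repr, fourierCoeff_toLp, fourierCoeff_toLp, hcoeff]
  have := ContinuousMap.toLp_injective _ heq
  exact congrArg (fun f : C(AddCircle (1 : ℝ), ℂ) => f t) this

end Symbols

/-! ### Numerical ranges -/

section NumericalRange

variable {m : ℕ}

theorem inner_toEuclideanCLM (A : Matrix (Fin m) (Fin m) ℂ) (x : EuclideanSpace ℂ (Fin m)) :
    inner ℂ x (Matrix.toEuclideanCLM (𝕜 := ℂ) A x) = ∑ i, ∑ j, conj (x i) * (A i j * x j) := by
  rw [PiLp.inner_apply]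
  refine Finset.sum_congr rfl fun i _ => ?_
  rw [Matrix.ofLp_toEuclideanCLM, RCLike.inner_apply, Matrix.mulVec, dotProduct, mul_comm,
    Finset.mul_sum]

/-- A half plane that contains the numerical range of `A` bounds the quadratic form of `A`. -/
theorem quadraticForm_le {A : Matrix (Fin m) (Fin m) ℂ} {u : ℂ →L[ℝ] ℝ} {c : ℝ}
    (h : ∀ w ∈ matrixNumericalRange A, u w ≤ c) (x : Fin m → ℂ) :
    u (∑ i, ∑ j, conj (x i) * (A i j * x j)) ≤ c * ∑ i, ‖x i‖ ^ 2 := by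
  set y : EuclideanSpace ℂ (Fin m) := WithLp.toLp 2 x with hy
  have h1 := inner_toEuclideanCLM A y
  have h2 : ‖y‖ ^ 2 = ∑ i, ‖x i‖ ^ 2 := EuclideanSpace.norm_sq_eq y
  have h3 : ∑ i, ∑ j, conj (x i) * (A i j * x j) =
      inner ℂ y (Matrix.toEuclideanCLM (𝕜 := ℂ) A y) := h1.symm
  rw [h3, ← h2]
  by_cases hy0 : y = 0
  · simp [hy0]
  have hn : ‖y‖ ≠ 0 := norm_ne_zero_iff.2 hy0
  have h4 := h _ ⟨((‖y‖⁻¹ : ℝ) : ℂ) • y, by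
    rw [norm_smul, Complex.norm_real, norm_inv, norm_norm, inv_mul_cancel₀ hn], rfl⟩
  rw [map_smul, inner_smul_left, inner_smul_right, Complex.conj_ofReal, ← mul_assoc,
    ← Complex.ofReal_mul, ← Complex.real_smul, map_smul, smul_eq_mul] at h4
  have h5 : u (inner ℂ y (Matrix.toEuclideanCLM (𝕜 := ℂ) A y)) =
      ‖y‖ ^ 2 * (‖y‖⁻¹ * ‖y‖⁻¹ * u (inner ℂ y (Matrix.toEuclideanCLM (𝕜 := ℂ) A y))) := by
    field_simp
  rw [h5, mul_comm c]
  exact mul_le_mul_of_nonneg_left h4 (by positivity)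

/-- A point outside `K` would be separated from it by a real functional `u` and a level `c`.
Integrating the pointwise bound `u ≤ c ∑ |φᵢ|²` over the circle contradicts this, as the right side
integrates to `c`. -/
theorem numericalRange_toeplitz_subset {F : ℂ → Matrix (Fin m) (Fin m) ℂ}
    (hF : ContinuousSymbol F) {K : Set ℂ} (hK : Convex ℝ K) (hKc : IsClosed K)
    (h : ∀ τ ∈ Metric.sphere (0 : ℂ) 1, matrixNumericalRange (F τ) ⊆ K) :
    numericalRange (toeplitz F) ⊆ K := by
  rintro w ⟨f, hf, rfl⟩
  by_contra hw
  obtain ⟨u, c, huc, hcw⟩ := geometric_hahn_banach_closed_point hK hKc hw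
  refine absurd hcw (not_lt.2 ?_)
  let φ : Fin m → CircleL2 := fun i => boundaryValue (f i)
  have hint : ∀ i j, Integrable (fun t => conj (φ i t) *
      (F (AddCircle.toCircle t : ℂ) i j * φ j t)) AddCircle.haarAddCircle := fun i j =>
    integrable_mulL2 (hF i j) (φ i) (φ j)
  have h1 : inner ℂ f (toeplitz F f) = ∫ t, ∑ i, ∑ j, conj (φ i t) *
      (F (AddCircle.toCircle t : ℂ) i j * φ j t) ∂AddCircle.haarAddCircle := by
    rw [inner_toeplitz, integral_finsetSum _ fun i _ => integrable_finsetSum _ fun j _ => hint i j]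
    refine Finset.sum_congr rfl fun i _ => ?_
    rw [integral_finsetSum _ fun j _ => hint i j]
    exact Finset.sum_congr rfl fun j _ => inner_mulL2 (hF i j) _ _
  have hsq : ∀ i, Integrable (fun t => ‖φ i t‖ ^ 2) (AddCircle.haarAddCircle (T := (1 : ℝ))) :=
    fun i => (Lp.memLp (φ i)).integrable_norm_pow (by norm_num)
  have h2 : ∫ t, ∑ i, ‖φ i t‖ ^ 2 ∂(AddCircle.haarAddCircle (T := (1 : ℝ))) = 1 := by
    rw [integral_finsetSum _ fun i _ => hsq i]
    have h3 : ∀ i, ∫ t, ‖φ i t‖ ^ 2 ∂(AddCircle.haarAddCircle (T := (1 : ℝ))) = ‖f i‖ ^ 2 := by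
      intro i
      have h4 : inner ℂ (φ i) (φ i) =
          ((∫ t, ‖φ i t‖ ^ 2 ∂(AddCircle.haarAddCircle (T := (1 : ℝ))) : ℝ) : ℂ) := by
        rw [L2.inner_def, ← integral_complex_ofReal]
        refine integral_congr_ae (Filter.Eventually.of_forall fun t => ?_)
        simp
      have h5 := inner_self_eq_norm_sq (𝕜 := ℂ) (φ i)
      rw [h4] at h5
      have h6 : ‖φ i‖ = ‖f i‖ := boundaryValue.norm_map (f i)
      rw [← h6, ← h5]
      exact (Complex.ofReal_re _).symm
    rw [Finset.sum_congr rfl fun i _ => h3 i]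
    have h7 := PiLp.norm_sq_eq_of_L2 (fun _ : Fin m => HardyDisk) f
    rw [← h7, hf, one_pow]
  rw [h1, ← u.integral_comp_comm (integrable_finsetSum _ fun i _ => integrable_finsetSum _
    fun j _ => hint i j)]
  calc ∫ t, u (∑ i, ∑ j, conj (φ i t) * (F (AddCircle.toCircle t : ℂ) i j * φ j t))
        ∂AddCircle.haarAddCircle
      ≤ ∫ t, c * ∑ i, ‖φ i t‖ ^ 2 ∂AddCircle.haarAddCircle := by
        refine integral_mono (u.integrable_comp (integrable_finsetSum _ fun i _ =>
          integrable_finsetSum _ fun j _ => hint i j))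
          ((integrable_finsetSum _ fun i _ => hsq i).const_mul c) fun t => ?_
        exact quadraticForm_le (fun w hw => (huc w (h _ (by rw [mem_sphere_zero_iff_norm, Circle.norm_coe]) hw)).le) fun i => φ i t
    _ = c := by rw [integral_const_mul, h2, mul_one]

/-- In a finite-dimensional space the convex hull of a compact set is compact. -/
theorem isCompact_convexHull_of_finiteDimensional {E : Type*} [NormedAddCommGroup E]
    [NormedSpace ℝ E] [FiniteDimensional ℝ E] {K : Set E} (hK : IsCompact K) :
    IsCompact (convexHull ℝ K) := by
  rcases K.eq_empty_or_nonempty with rfl | ⟨x₀, hx₀⟩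
  · simp
  -- By Carathéodory, `N` points suffice, so the hull is a continuous image of a simplex times `K ^
  -- N`.
  let N := Module.finrank ℝ E + 1
  let Ψ : (Fin N → ℝ) × (Fin N → E) → E := fun q => ∑ k, q.1 k • q.2 k
  have hΨ : Continuous Ψ := by fun_prop
  have hcomp : IsCompact (stdSimplex ℝ (Fin N) ×ˢ Set.univ.pi fun _ : Fin N => K) :=
    (isCompact_stdSimplex ℝ (Fin N)).prod (isCompact_univ_pi fun _ => hK)
  convert hcomp.image hΨ
  ext x
  constructor
  · intro hx
    obtain ⟨ι, hι, z, w, hz, hind, hw0, hw1, rfl⟩ := eq_pos_convex_span_of_mem_convexHull hx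
    have hcard : Fintype.card ι ≤ Fintype.card (Fin N) := by
      rw [Fintype.card_fin]
      exact hind.card_le_finrank_succ.trans
        (Nat.succ_le_succ (Submodule.finrank_le _))
    obtain ⟨e⟩ := Function.Embedding.nonempty_of_card_le hcard
    obtain ⟨w', hw'⟩ : ∃ w' : Fin N → ℝ, w' = Function.extend e w 0 := ⟨_, rfl⟩
    -- Unused slots get weight zero, but still need a point of `K`, namely `x₀`.
    obtain ⟨z', hz'⟩ : ∃ z' : Fin N → E, z' = Function.extend e z fun _ => x₀ := ⟨_, rfl⟩
    have hwe : ∀ i, w' (e i) = w i := fun i => hw' ▸ e.injective.extend_apply _ _ _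
    have hze : ∀ i, z' (e i) = z i := fun i => hz' ▸ e.injective.extend_apply _ _ _
    have hext : ∀ k, k ∉ Set.range e → w' k = 0 := fun k hk =>
      hw' ▸ Function.extend_apply' _ _ _ (by simpa using hk)
    refine ⟨(w', z'), ⟨⟨fun k => ?_, ?_⟩, fun k _ => ?_⟩, ?_⟩
    · change 0 ≤ w' k
      by_cases hk : ∃ i, e i = k
      · obtain ⟨i, rfl⟩ := hk
        rw [hwe]
        exact (hw0 i).le
      · exact (hext k (by simpa using hk)).ge
    · rw [← hw1]
      exact (Fintype.sum_of_injective e e.injective _ _ hext fun i => (hwe i).symm).symm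
    · change z' k ∈ K
      by_cases hk : ∃ i, e i = k
      · obtain ⟨i, rfl⟩ := hk
        rw [hze]
        exact hz ⟨i, rfl⟩
      · rw [hz', Function.extend_apply' _ _ _ hk]
        exact hx₀
    · refine (Fintype.sum_of_injective e e.injective _ _ (fun k hk => ?_) fun i => ?_).symm
      · change w' k • z' k = 0
        rw [hext k hk, zero_smul]
      · change w i • z i = w' (e i) • z' (e i)
        rw [hwe, hze]
  · rintro ⟨⟨w, z⟩, ⟨hw, hz⟩, rfl⟩
    exact (convex_convexHull ℝ K).sum_mem (fun k _ => hw.1 k) hw.2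
      fun k _ => subset_convexHull ℝ K (hz k trivial)

theorem isCompact_iUnion_matrixNumericalRange {F : ℂ → Matrix (Fin m) (Fin m) ℂ}
    (hF : ∀ i j, ContinuousOn (fun z => F z i j) (Metric.closedBall (0 : ℂ) 1)) :
    IsCompact (⋃ τ ∈ Metric.sphere (0 : ℂ) 1, matrixNumericalRange (F τ)) := by
  have hcomp : IsCompact (Metric.sphere (0 : ℂ) 1 ×ˢ
      Metric.sphere (0 : EuclideanSpace ℂ (Fin m)) 1) :=
    (isCompact_sphere 0 1).prod (isCompact_sphere 0 1)
  have hcont : ContinuousOn (fun q : ℂ × EuclideanSpace ℂ (Fin m) =>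
      ∑ i, ∑ j, conj (q.2 i) * (F q.1 i j * q.2 j))
      (Metric.sphere (0 : ℂ) 1 ×ˢ Metric.sphere (0 : EuclideanSpace ℂ (Fin m)) 1) := by
    refine continuousOn_finsetSum _ fun i _ => continuousOn_finsetSum _ fun j _ => ?_
    have hcoord : ∀ j, Continuous fun q : ℂ × EuclideanSpace ℂ (Fin m) => q.2 j := fun j => by
      fun_prop
    refine (Complex.continuous_conj.comp (hcoord i)).continuousOn.mul
      (ContinuousOn.mul ?_ (hcoord j).continuousOn)
    exact (hF i j).comp continuous_fst.continuousOn fun q hq =>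
      Metric.sphere_subset_closedBall hq.1
  convert hcomp.image_of_continuousOn hcont
  ext w
  simp only [Set.mem_iUnion, matrixNumericalRange, numericalRange, Set.mem_ofPred_eq, Set.mem_image,
    Set.mem_prod, mem_sphere_zero_iff_norm, Prod.exists, inner_toEuclideanCLM]
  constructor
  · rintro ⟨τ, hτ, x, hx, h⟩
    exact ⟨τ, x, ⟨hτ, hx⟩, h⟩
  · rintro ⟨τ, x, ⟨hτ, hx⟩, h⟩
    exact ⟨τ, hτ, x, hx, h⟩

theorem mem_closure_numericalRange {H : Type*} [NormedAddCommGroup H] [InnerProductSpace ℂ H]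
    (T : H →L[ℂ] H) {h : ℕ → H} {w : ℂ}
    (h1 : Filter.Tendsto (fun N => ‖h N‖) Filter.atTop (nhds 1))
    (h2 : Filter.Tendsto (fun N => inner ℂ (h N) (T (h N))) Filter.atTop (nhds w)) :
    w ∈ closure (numericalRange T) := by
  have h3 : Filter.Tendsto (fun N => (((‖h N‖⁻¹ * ‖h N‖⁻¹ : ℝ) : ℂ)) *
      inner ℂ (h N) (T (h N))) Filter.atTop (nhds w) := by
    have h4 := h1.inv₀ one_ne_zero
    have h5 := ((Complex.continuous_ofReal.tendsto _).comp (h4.mul h4)).mul h2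
    simpa using h5
  refine mem_closure_of_tendsto h3 ?_
  filter_upwards [h1.eventually (lt_mem_nhds (zero_lt_one' ℝ))] with N hN
  refine ⟨((‖h N‖⁻¹ : ℝ) : ℂ) • h N, ?_, ?_⟩
  · rw [norm_smul, Complex.norm_real, norm_inv, norm_norm, inv_mul_cancel₀ hN.ne']
  · rw [map_smul, inner_smul_left, inner_smul_right, Complex.conj_ofReal]
    push_cast
    ring

/-- The powers of `z₂` tend weakly to zero: once `N` exceeds the `z₂`-degrees of a finite truncation
of `f`, only the small tail of `f` contributes. -/
theorem tendsto_inner_monomialMul_snd (f g : HardyBidisk) :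
    Filter.Tendsto (fun N => inner ℂ f (monomialMul 0 N g)) Filter.atTop (nhds 0) := by
  rw [Metric.tendsto_nhds]
  intro ε hε
  have hδ : 0 < ε / (‖g‖ + 1) := by positivity
  obtain ⟨s, hs⟩ := (Metric.tendsto_nhds.1
    (lp.hasSum_single (E := fun _ : ℕ × ℕ => ℂ) (p := 2) (by norm_num) f) _ hδ).exists
  filter_upwards [Filter.eventually_gt_atTop (s.sup fun a => a.2)] with N hN
  have h0 : inner ℂ (∑ a ∈ s, lp.single (E := fun _ : ℕ × ℕ => ℂ) 2 a (f a))
      (monomialMul 0 N g) = 0 := by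
    rw [sum_inner]
    refine Finset.sum_eq_zero fun a ha => ?_
    have : a.2 < N := (Finset.le_sup (f := fun a : ℕ × ℕ => a.2) ha).trans_lt hN
    rw [lp.inner_single_left, monomialMul_snd_apply, if_neg (not_le.2 this), inner_zero_right]
  rw [dist_zero_right]
  calc ‖inner ℂ f (monomialMul 0 N g)‖
      = ‖inner ℂ (f - ∑ a ∈ s, lp.single (E := fun _ : ℕ × ℕ => ℂ) 2 a (f a))
          (monomialMul 0 N g)‖ := by rw [inner_sub_left, h0, sub_zero]
    _ ≤ ‖f - ∑ a ∈ s, lp.single (E := fun _ : ℕ × ℕ => ℂ) 2 a (f a)‖ * ‖g‖ := by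
        rw [← norm_monomialMul 0 N g]
        exact norm_inner_le_norm _ _
    _ ≤ ε / (‖g‖ + 1) * ‖g‖ := by
        rw [dist_comm, dist_eq_norm] at hs
        gcongr
    _ < ε := by
        rw [div_mul_eq_mul_div, div_lt_iff₀ (by positivity)]
        nlinarith [norm_nonneg g]

/-- The closure of the numerical range of the compression is convex. -/
theorem convex_closure_numericalRange_compression {S : Submodule ℂ HardyBidisk}
    [S.HasOrthogonalProjection] (hinv : ∀ f ∈ S, mulZ2 f ∈ S) :
    Convex ℝ (closure (numericalRange (compression S mulZ1))) := by
  have key : ∀ s t : ℝ, 0 ≤ s → 0 ≤ t → s + t = 1 →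
      ∀ x ∈ numericalRange (compression S mulZ1), ∀ y ∈ numericalRange (compression S mulZ1),
        s • x + t • y ∈ closure (numericalRange (compression S mulZ1)) := by
    rintro s t hs ht hst x ⟨f, hf, rfl⟩ y ⟨g, hg, rfl⟩
    -- Shifting by `z₂ᴺ` changes neither the norm nor the quadratic form of `g`. The vectors `√s f +
    -- √t z₂ᴺ g` therefore have norms tending to `1` and forms tending to the convex combination.
    let v : ℕ → S := fun N => ⟨monomialMul 0 N g, monomialMul_snd_mem hinv g.2 N⟩
    let a : ℂ := (Real.sqrt s : ℝ)
    let c : ℂ := (Real.sqrt t : ℝ)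
    have ha : conj a * a = s := by
      simp only [a, Complex.conj_ofReal]
      rw [← Complex.ofReal_mul, Real.mul_self_sqrt hs]
    have hc : conj c * c = t := by
      simp only [c, Complex.conj_ofReal]
      rw [← Complex.ofReal_mul, Real.mul_self_sqrt ht]
    -- Used twice: the identity controls the norms, and multiplication by `z₁` the quadratic form.
    have hgen : ∀ T : HardyBidisk →L[ℂ] HardyBidisk, (∀ N h, T (monomialMul 0 N h) =
        monomialMul 0 N (T h)) → Filter.Tendsto (fun N => inner ℂ ((a • f + c • v N : S) :
          HardyBidisk) (T ((a • f + c • v N : S) : HardyBidisk))) Filter.atTop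
          (nhds (s * inner ℂ (f : HardyBidisk) (T f) + t * inner ℂ (g : HardyBidisk) (T g))) := by
      intro T hT
      have h1 := tendsto_inner_monomialMul_snd (f : HardyBidisk) (T g)
      have h2 := (Complex.continuous_conj.tendsto 0).comp
        (tendsto_inner_monomialMul_snd (T f) (g : HardyBidisk))
      rw [map_zero] at h2
      have h3 := (((h1.const_mul (conj a * c)).add (h2.const_mul (conj c * a))).const_add
        (s * inner ℂ (f : HardyBidisk) (T f) + t * inner ℂ (g : HardyBidisk) (T g)))
      rw [mul_zero, mul_zero, add_zero, add_zero] at h3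
      refine h3.congr fun N => ?_
      simp only [Submodule.coe_add, Submodule.coe_smul, v, map_add, map_smul, inner_add_left,
        inner_add_right, inner_smul_left, inner_smul_right, Function.comp_apply, inner_conj_symm,
        hT, inner_monomialMul]
      rw [← ha, ← hc]
      ring
    refine mem_closure_numericalRange (compression S mulZ1) (h := fun N => a • f + c • v N) ?_ ?_
    · have h1 := hgen (ContinuousLinearMap.id ℂ _) fun _ _ => rfl
      have h2 : (s * inner ℂ (f : HardyBidisk) (f : HardyBidisk) +
          t * inner ℂ (g : HardyBidisk) (g : HardyBidisk) : ℂ) = 1 := by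
        rw [inner_self_eq_norm_sq_to_K, inner_self_eq_norm_sq_to_K, Submodule.norm_coe,
          Submodule.norm_coe, hf, hg]
        simp only [RCLike.ofReal_one, one_pow, mul_one]
        exact_mod_cast hst
      simp only [ContinuousLinearMap.id_apply] at h1
      rw [h2] at h1
      have h3 := (Real.continuous_sqrt.tendsto _).comp ((Complex.continuous_re.tendsto 1).comp h1)
      rw [Complex.one_re, Real.sqrt_one] at h3
      refine h3.congr fun N => ?_
      rw [← Submodule.norm_coe, norm_eq_sqrt_re_inner (𝕜 := ℂ)]
      rfl
    · have h1 := hgen mulZ1 fun N h => mulZ1_monomialMul 0 N h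
      simp only [inner_compression, Complex.real_smul]
      exact h1
  intro x hx y hy s t hs ht hst
  rw [← closure_closure]
  exact map_mem_closure₂ (f := fun x y : ℂ => s • x + t • y) (by fun_prop) hx hy
    (key s t hs ht hst)

/-- For a co-analytic symbol, `T_M (k_z x) = k_z (M(z) x)`. -/
theorem toeplitz_szego {F : ℂ → Matrix (Fin m) (Fin m) ℂ} {g : Fin m → Fin m → HardyDisk}
    (hF : ∀ i j k l, inner ℂ (vecBasis (i, k)) (toeplitz F (vecBasis (j, l))) =
      if k ≤ l then conj (g i j (l - k)) else 0) {z : ℂ} (hz : ‖z‖ < 1) (x : Fin m → ℂ)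
    (i : Fin m) : toeplitz F (WithLp.toLp 2 fun j => x j • szego z hz) i =
      (∑ j, conj (diskEval (g i j) z) * x j) • szego z hz := by
  ext k
  set f : HardyDiskVec m := WithLp.toLp 2 fun j => x j • szego z hz with hf
  have h1 := (hasSum_vecBasis f).mapL (innerSL ℂ (vecBasis (i, k)) ∘L toeplitz F)
  simp only [ContinuousLinearMap.comp_apply, map_smul, innerSL_apply_apply, inner_vecBasis,
    smul_eq_mul] at h1
  rw [← h1.tsum_eq, h1.summable.tsum_prod, tsum_fintype, lp.coeFn_smul, Pi.smul_apply,
    smul_eq_mul, Finset.sum_mul]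
  refine Finset.sum_congr rfl fun j _ => ?_
  have h2 : ∀ l, toeplitz F (vecBasis (j, l)) i k = if k ≤ l then conj (g i j (l - k)) else 0 :=
    fun l => by rw [← hF, inner_vecBasis]
  simp only [h2]
  have h3 : HasSum (fun d => conj (g i j d * z ^ d)) (conj (diskEval (g i j) z)) :=
    (hasSum_diskEval hz (g i j)).map (starRingEnd ℂ) Complex.continuous_conj
  have h4 := h3.mul_left (x j * conj z ^ k)
  -- Only `l ≥ k` contributes; reindexing by `l = d + k` pulls out `conj z ^ k`, the `k`-th
  -- coefficient of the kernel.
  have hinj : Function.Injective fun d : ℕ => d + k := add_left_injective k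
  have h5 : HasSum (fun l : ℕ => x j * conj z ^ l * if k ≤ l then conj (g i j (l - k)) else 0)
      (x j * conj z ^ k * conj (diskEval (g i j) z)) := by
    rw [← hinj.hasSum_iff]
    · have he : ((fun l : ℕ => x j * conj z ^ l * if k ≤ l then conj (g i j (l - k)) else 0) ∘
          fun d : ℕ => d + k) = fun d : ℕ => x j * conj z ^ k * conj (g i j d * z ^ d) := by
        funext d
        simp only [Function.comp_apply, if_pos (Nat.le_add_left k d), Nat.add_sub_cancel,
          map_mul, map_pow, pow_add]
        ring
      rw [he]
      exact h4
    · intro l hl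
      rw [if_neg, mul_zero]
      intro hkl
      exact hl ⟨l - k, Nat.sub_add_cancel hkl⟩
  refine h5.tsum_eq.trans ?_
  rw [szego_apply]
  ring

/-- The Szegő kernel tensored with a unit vector `x` and normalized has the same quadratic form
under `T_F` as `x` under `F z`. -/
theorem matrixNumericalRange_subset {F : ℂ → Matrix (Fin m) (Fin m) ℂ}
    {g : Fin m → Fin m → HardyDisk}
    (hF : ∀ i j k l, inner ℂ (vecBasis (i, k)) (toeplitz F (vecBasis (j, l))) =
      if k ≤ l then conj (g i j (l - k)) else 0) {z : ℂ} (hz : ‖z‖ < 1)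
    (hFz : ∀ i j, F z i j = conj (diskEval (g i j) z)) :
    matrixNumericalRange (F z) ⊆ numericalRange (toeplitz F) := by
  rintro w ⟨x, hx, rfl⟩
  set f : HardyDiskVec m := WithLp.toLp 2 fun j => x j • szego z hz with hf
  have hk0 : szego z hz ≠ 0 := by
    intro h0
    have h := szego_apply z hz 0
    rw [h0] at h
    simp at h
  have hk : ‖szego z hz‖ ≠ 0 := norm_ne_zero_iff.2 hk0
  have hfn : ‖f‖ = ‖szego z hz‖ := by
    have h1 := PiLp.norm_sq_eq_of_L2 (fun _ : Fin m => HardyDisk) f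
    have h2 : ∑ i, ‖f i‖ ^ 2 = ‖x‖ ^ 2 * ‖szego z hz‖ ^ 2 := by
      rw [EuclideanSpace.norm_sq_eq, Finset.sum_mul]
      refine Finset.sum_congr rfl fun i _ => ?_
      rw [← mul_pow, ← norm_smul]
    rw [h2, hx, one_pow, one_mul] at h1
    exact (sq_eq_sq₀ (norm_nonneg _) (norm_nonneg _)).1 h1
  have hin : inner ℂ f (toeplitz F f) =
      ((‖szego z hz‖ ^ 2 : ℝ) : ℂ) * inner ℂ x (Matrix.toEuclideanCLM (𝕜 := ℂ) (F z) x) := by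
    rw [PiLp.inner_apply, inner_toEuclideanCLM, Finset.mul_sum]
    refine Finset.sum_congr rfl fun i _ => ?_
    rw [hf, toeplitz_szego hF hz]
    change inner ℂ (x i • szego z hz) _ = _
    rw [inner_smul_left, inner_smul_right, inner_self_eq_norm_sq_to_K]
    simp only [hFz, Finset.mul_sum, Finset.sum_mul]
    refine Finset.sum_congr rfl fun j _ => ?_
    push_cast
    simp only [Complex.coe_algebraMap]
    ring
  refine ⟨((‖szego z hz‖⁻¹ : ℝ) : ℂ) • f, ?_, ?_⟩
  · rw [norm_smul, Complex.norm_real, norm_inv, norm_norm, hfn, inv_mul_cancel₀ hk]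
  · rw [map_smul, inner_smul_left, inner_smul_right, Complex.conj_ofReal, hin]
    have hk' : ((‖szego z hz‖ : ℝ) : ℂ) ≠ 0 := by exact_mod_cast hk
    push_cast
    field_simp

end NumericalRange

/-! ### The numerical range formula. -/

section Main

variable {m n : ℕ} {p : MvPolynomial (Fin 2) ℂ} {S₁ S₂ : Submodule ℂ HardyBidisk}

theorem IsShiftDecomposition.closure_numericalRange (hp : IsRationalInner m n p)
    [S₂.HasOrthogonalProjection]
    (hS : IsShiftDecomposition (modelSpace (theta m n p)) S₁ S₂)
    {b : OrthonormalBasis (Fin m) ℂ (wandering S₂)} {M : ℂ → Matrix (Fin m) (Fin m) ℂ}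
    (hM : IsSymbol S₂ b M) : closure (numericalRange (compression S₂ mulZ1)) =
      convexHull ℝ (⋃ τ ∈ Metric.sphere (0 : ℂ) 1, matrixNumericalRange (M τ)) := by
  refine Set.Subset.antisymm ?_ ?_
  · have hcl := (isCompact_convexHull_of_finiteDimensional
      (isCompact_iUnion_matrixNumericalRange hM.continuous)).isClosed
    refine closure_minimal ?_ hcl
    rw [hM.numericalRange_eq]
    refine numericalRange_toeplitz_subset hM.continuousSymbol (convex_convexHull ℝ _) hcl
      fun τ hτ => ?_
    exact (Set.subset_biUnion_of_mem (u := fun τ => matrixNumericalRange (M τ)) hτ).trans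
      (subset_convexHull ℝ _)
  · refine convexHull_min ?_ (convex_closure_numericalRange_compression hS.invariant_snd)
    -- The constructed symbol has a known formula inside the disk, where the kernel argument takes
    -- place. The given one only has to agree with it on the circle.
    obtain ⟨M', hM', hdisk⟩ := hS.exists_isSymbol hp b
    refine Set.iUnion₂_subset fun τ hτ => ?_
    rw [hM.eqOn_sphere hS hM' hτ]
    rintro w ⟨x, hx, rfl⟩
    have hentries : ∀ i j k l, inner ℂ (vecBasis (i, k)) (toeplitz M' (vecBasis (j, l))) =
        if k ≤ l then conj (symbolVec hS b i j (l - k)) else 0 := fun i j k l => by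
      rw [hM'.inner_toeplitz_vecBasis hS, inner_woldVec_mulZ1 hS]
    rw [hM'.numericalRange_eq]
    have hτ1 : ‖τ‖ = 1 := by simpa using hτ
    have hmaps : ∀ r ∈ Set.Ioo (0 : ℝ) 1, ‖(r : ℂ) * τ‖ < 1 := fun r hr => by
      rw [norm_mul, hτ1, mul_one, Complex.norm_real, Real.norm_of_nonneg hr.1.le]
      exact hr.2
    have hlim : Filter.Tendsto (fun r : ℝ =>
        inner ℂ x (Matrix.toEuclideanCLM (𝕜 := ℂ) (M' ((r : ℂ) * τ)) x))
        (nhdsWithin 1 (Set.Iio 1))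
        (nhds (inner ℂ x (Matrix.toEuclideanCLM (𝕜 := ℂ) (M' τ) x))) := by
      simp only [inner_toEuclideanCLM]
      refine tendsto_finsetSum _ fun i _ => tendsto_finsetSum _ fun j _ =>
        Filter.Tendsto.const_mul _ (Filter.Tendsto.mul_const _ ?_)
      have h1 := (hM'.continuous i j) τ (by simp [hτ1])
      refine h1.tendsto.comp (tendsto_nhdsWithin_iff.2 ⟨?_, ?_⟩)
      · have hcont : Continuous fun r : ℝ => (r : ℂ) * τ := by fun_prop
        have := (hcont.tendsto 1).mono_left (nhdsWithin_le_nhds (s := Set.Iio 1))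
        simpa using this
      · filter_upwards [Ioo_mem_nhdsLT (zero_lt_one' ℝ)] with r hr
        simpa using (hmaps r hr).le
    refine mem_closure_of_tendsto hlim ?_
    filter_upwards [Ioo_mem_nhdsLT (zero_lt_one' ℝ)] with r hr
    exact matrixNumericalRange_subset hentries (hmaps r hr) (hdisk _ (hmaps r hr)) ⟨x, hx, rfl⟩

end Main

end BidiskModel

end

theorem corollary3p3 (m n : ℕ) (p : MvPolynomial (Fin 2) ℂ) (hp : IsRationalInner m n p)
    (S₁ S₂ : Submodule ℂ HardyBidisk) [S₂.HasOrthogonalProjection]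
    (hS : IsShiftDecomposition (modelSpace (theta m n p)) S₁ S₂) :
    Nonempty (OrthonormalBasis (Fin m) ℂ (wandering S₂)) ∧
    ∀ b : OrthonormalBasis (Fin m) ℂ (wandering S₂),
      (∃ M : ℂ → Matrix (Fin m) (Fin m) ℂ, IsSymbol S₂ b M) ∧
      ∀ M : ℂ → Matrix (Fin m) (Fin m) ℂ, IsSymbol S₂ b M →
        closure (numericalRange (compression S₂ mulZ1)) =
          convexHull ℝ (⋃ τ ∈ Metric.sphere (0 : ℂ) 1, matrixNumericalRange (M τ)) := by
  refine ⟨hS.nonempty_orthonormalBasis hp, fun b => ⟨?_, fun M hM => ?_⟩⟩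
  · obtain ⟨M, hM, -⟩ := hS.exists_isSymbol hp b
    exact ⟨M, hM⟩
  · exact hS.closure_numericalRange hp hM
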